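/- **Setting.** Let $p$ be an odd prime. *Coefficients.* Let $F$ be a number field of degree $g$ with ring of integers $\mathcal O_F$, fix a $\mathbb Z$-basis of $\mathcal O_F$ in which $1$ has coordinate vector $u_1=(1,\dots,1)^t$, and let $\Phi:\mathcal O_F\to M_{g\times g}(\mathbb Z)$ be the induced embedding (multiplication matrices). Let $N\ge 1$ be prime to $p$, let $a_q\in\mathcal O_F$ for every prime $q$, and assume that $a_p$ lies in every prime of $\mathcal O_F$ above $p$. Put $C_p=\Phi(a_p)$ and define $C_n=\Phi(a_n)$ by $\sum_n a_n n^{-s}=\prod_q(1-a_qq^{-s}+\mathbf 1_{q\nmid N}\,q^{1-2s})^{-1}$. (For a weight-two newform $f$ of level $N$ with trivial nebentype, Hecke field $F$ and eigenvalues $a_q$, whose abelian variety $A=A_f$ has good supersingular reduction at $p$, these assumptions hold, and the formal group of $A$ is the one with logarithm $\sum_{n\ge1}\frac{C_n}{n}\mathbf x^n$, $\mathbf x^n=(X_1^n,\dots,X_g^n)^t$.) *Fields.* Let $\mathbb Q_p=k_0\subset k_1\subset\cdots\subset\overline{\mathbb Q}_p$ be the layers of a totally ramified $\mathbb Z_p$-extension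 of $\mathbb Q_p$ ($k_n/\mathbb Q_p$ is cyclic of degree $p^n$). Put $L_0=\mathbb Q_p$, $L_{n+1}=k_n(\mu_p)$, $L_\infty=\bigcup_n L_n$. For a finite extension $M/\mathbb Q_p$ let $\mathfrak m_M$ be its maximal ideal. *Lubin–Tate group.* Let $\pi\in\mathbb Z_p$ with $\pi/p\equiv1\bmod p$, let $\mathfrak f(X)=\pi X+\sum_{i=2}^p\binom piX^i$ with iterates $\mathfrak f^{(k)}$ ($\mathfrak f^{(0)}=X$), and let $\mathscr F$ be the height-one Lubin–Tate formal group with $[\pi]_{\mathscr F}=\mathfrak f$, so that $\mathscr F[\pi^n]$ is the set of zeros of $\mathfrak f^{(n)}$ in the maximal ideal of $\overline{\mathbb Q}_p$. Let $(e_n)_{n\ge0}$ be a $\pi$-sequence in $L_\infty$: $e_0=0$ and, for $n\ge1$, $e_n\in\mathscr F[\pi^n]\setminus\mathscr F[\pi^{n-1}]$ and $\mathfrak f(e_n)=e_{n-1}$. *Logarithm.* Let $x_{-1}=0$, $x_0=I_g$, $px_k=C_px_{k-1}-x_{k-2}$ for $k\ge1$, and $$\ell(\mathbf x)=\sum_{k\ge0}x_k\,\mathfrak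 f^{(k)}(\mathbf x)\in\mathbb Q_p[[X_1,\dots,X_g]]^g,$$ where $\mathfrak f^{(k)}$ is applied to each coordinate and the sum is taken coefficientwise. **Theorem.** The power series $\ell$ has a compositional inverse and $\widehat A(\mathbf x,\mathbf y):=\ell^{-1}(\ell(\mathbf x)+\ell(\mathbf y))$ is a $g$-dimensional commutative formal group law over $\mathbb Z_p$. So is the formal group with logarithm $\sum_{n\ge1}\frac{C_n}{n}\mathbf x^n$, and $\widehat A$ is strongly isomorphic to it over $\mathbb Z_p$ (by an isomorphism $\equiv\mathbf x$ modulo degree $2$). Every $B\in M_{g\times g}(\mathbb Z_p)$ commuting with $C_p$ acts on $\widehat A$ by an endomorphism $[B]$ over $\mathbb Z_p$ with $\ell\circ[B]=B\ell$; write $B\cdot x=[B](x)$ for $x\in\widehat A(M)=\mathfrak m_M^{g}$, $M/\mathbb Q_p$ finite. There is $\epsilon\in(p\mathbb Z_p)^g$ with $\ell(\epsilon)=(1+p-C_p)^{-1}(pu_1)$. For every such $\epsilon$ one has $e_n\in L_n$ for all $n\ge0$. Put $c_n=\epsilon+_{\widehat A}(e_nu_1)\in\widehat A(L_n)$ (so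 $c_0=\epsilon$) and let $d_n\in\widehat A(k_n)$ be the trace of $c_{n+1}$ from $\widehat A(L_{n+1})$ to $\widehat A(k_n)$, traces being taken for the group law of $\widehat A$. Let $\mathrm{Tr}_{n+1/n}:\widehat A(k_{n+1})\to\widehat A(k_n)$ be the trace. Then 1. $\mathrm{Tr}_{n+1/n}(d_{n+1})=C_p\cdot d_n-d_{n-1}$ in $\widehat A(k_n)$ for all $n\ge1$; 2. $\mathrm{Tr}_{1/0}(d_1)=\bigl(C_p-(C_p-2)^{-1}(p-1)\bigr)\cdot d_0$ in $\widehat A(\mathbb Q_p)$. -/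

import Mathlib

open scoped NumberField

noncomputable section

/-! ### Commutative formal group laws of arbitrary finite dimension -/

/-- A commutative formal group law over `R` in the variables indexed by `ι`
(so of dimension `#ι`): a tuple `add` of power series `F(x, y)` and its formal inverse `neg`. -/
structure FormalGroupLaw (ι : Type*) (R : Type*) [CommRing R] where
  /-- the power series `F(x, y)`; `Sum.inl` indexes `x` and `Sum.inr` indexes `y` -/
  add : ι → MvPowerSeries (ι ⊕ ι) R
  /-- the formal inverse -/
  neg : ι → MvPowerSeries ι R
  constantCoeff_add : ∀ i, (add i).constantCoeff = 0
  constantCoeff_neg : ∀ i, (neg i).constantCoeff = 0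
  /-- `F(x, 0) = x` -/
  add_zero : ∀ i, (add i).subst (Sum.elim MvPowerSeries.X 0 : ι ⊕ ι → MvPowerSeries ι R) =
    MvPowerSeries.X i
  /-- `F(y, x) = F(x, y)` -/
  add_comm : ∀ i, (add i).subst
    (Sum.elim (fun j => MvPowerSeries.X (Sum.inr j)) (fun j => MvPowerSeries.X (Sum.inl j)) :
      ι ⊕ ι → MvPowerSeries (ι ⊕ ι) R) = add i
  /-- `F(F(x, y), z) = F(x, F(y, z))`; the variables `x, y, z` are indexed by the three summands -/
  add_assoc : ∀ i,
    (add i).subst (Sum.elim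
      (fun j => (add j).subst (Sum.elim (fun l => MvPowerSeries.X (Sum.inl l))
        (fun l => MvPowerSeries.X (Sum.inr (Sum.inl l))) :
          ι ⊕ ι → MvPowerSeries (ι ⊕ (ι ⊕ ι)) R))
      (fun j => MvPowerSeries.X (Sum.inr (Sum.inr j)))) =
    (add i).subst (Sum.elim
      (fun j => MvPowerSeries.X (Sum.inl j))
      (fun j => (add j).subst (Sum.elim (fun l => MvPowerSeries.X (Sum.inr (Sum.inl l)))
        (fun l => MvPowerSeries.X (Sum.inr (Sum.inr l))) :
          ι ⊕ ι → MvPowerSeries (ι ⊕ (ι ⊕ ι)) R)))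
  /-- `F(x, neg(x)) = 0` -/
  add_neg : ∀ i, (add i).subst (Sum.elim MvPowerSeries.X neg : ι ⊕ ι → MvPowerSeries ι R) = 0

namespace FormalGroupLaw

/-- Homomorphisms of formal group laws over `R`: `φ(F(x, y)) = G(φ(x), φ(y))`, `φ(0) = 0`. -/
structure Hom {ι R : Type*} [CommRing R] (F G : FormalGroupLaw ι R) where
  /-- the underlying power series -/
  series : ι → MvPowerSeries ι R
  constantCoeff_series : ∀ i, (series i).constantCoeff = 0
  map_add : ∀ i, (series i).subst F.add =
    (G.add i).subst (Sum.elim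
      (fun j => (series j).subst (fun l => (MvPowerSeries.X (Sum.inl l) : MvPowerSeries (ι ⊕ ι) R)))
      (fun j => (series j).subst (fun l => (MvPowerSeries.X (Sum.inr l) : MvPowerSeries (ι ⊕ ι) R))))

/-- A strong isomorphism is a homomorphism `φ` with `φ(x) ≡ x` modulo degree 2. -/
def Hom.IsStrongIso {ι R : Type*} [DecidableEq ι] [CommRing R] {F G : FormalGroupLaw ι R}
    (φ : F.Hom G) : Prop :=
  ∀ i j, MvPowerSeries.coeff (Finsupp.single j 1) (φ.series i) = if i = j then 1 else 0

end FormalGroupLaw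

/-- `m` is the compositional inverse of the tuple `ℓ` of power series without constant term. -/
structure IsCompInverse {ι R : Type*} [CommRing R] (ℓ m : ι → MvPowerSeries ι R) : Prop where
  left_zero : ∀ i, (ℓ i).constantCoeff = 0
  right_zero : ∀ i, (m i).constantCoeff = 0
  left : ∀ i, (ℓ i).subst m = MvPowerSeries.X i
  right : ∀ i, (m i).subst ℓ = MvPowerSeries.X i

theorem tsum_subst {R T : Type*} [CommRing R] [CommRing T] [UniformSpace T] [T2Space T]
    [CompleteSpace T] [IsUniformAddGroup T] [IsTopologicalRing T] [IsLinearTopology T T]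
    (φ : R →+* T) {σ τ : Type*} {a : σ → MvPowerSeries τ R} (ha : MvPowerSeries.HasSubst a)
    {x : τ → T} (hx : MvPowerSeries.HasEval x) {y : σ → T} (hy : MvPowerSeries.HasEval y)
    (hyx : ∀ s, y s = ∑' d : τ →₀ ℕ, φ (MvPowerSeries.coeff d (a s)) * d.prod fun t n => x t ^ n)
    (f : MvPowerSeries σ R) :
    ∑' d : τ →₀ ℕ, φ (MvPowerSeries.coeff d (f.subst a)) * (d.prod fun t n => x t ^ n) =
      ∑' d : σ →₀ ℕ, φ (MvPowerSeries.coeff d f) * d.prod fun s n => y s ^ n := by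
  let _ : UniformSpace R := ⊥
  let _ : Algebra R T := φ.toAlgebra
  have : DiscreteUniformity R := ⟨rfl⟩
  have hφ : Continuous (algebraMap R T) := continuous_of_discreteTopology
  have h := MvPowerSeries.eval₂_subst (T := T) ha hx f
  rw [MvPowerSeries.eval₂_eq_tsum hφ hx] at h
  have h2 : (fun s => MvPowerSeries.eval₂ (algebraMap R T) x (a s)) = y := by
    funext s
    rw [hyx, MvPowerSeries.eval₂_eq_tsum hφ hx]
    rfl
  rw [h2, MvPowerSeries.eval₂_eq_tsum hφ hy] at h
  exact h

theorem summable_eval {R T : Type*} [CommRing R] [CommRing T] [UniformSpace T] [T2Space T]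
    [CompleteSpace T] [IsUniformAddGroup T] [IsTopologicalRing T] [IsLinearTopology T T]
    (φ : R →+* T) {τ : Type*} {x : τ → T} (hx : MvPowerSeries.HasEval x)
    (f : MvPowerSeries τ R) :
    Summable fun d : τ →₀ ℕ => φ (MvPowerSeries.coeff d f) * d.prod fun t n => x t ^ n := by
  let _ : UniformSpace R := ⊥
  have : DiscreteUniformity R := ⟨rfl⟩
  have hφ : Continuous φ := continuous_of_discreteTopology
  exact (MvPowerSeries.hasSum_eval₂ hφ hx f).summable

section Padic

variable {p : ℕ} [Fact p.Prime]

/-- The image in `ℚ_p⟦x⟧` of a power series over `ℤ_p`. -/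
abbrev toQp {σ : Type*} (f : MvPowerSeries σ ℤ_[p]) : MvPowerSeries σ ℚ_[p] :=
  MvPowerSeries.map (algebraMap ℤ_[p] ℚ_[p]) f

/-- `F(x, y) = ℓ⁻¹(ℓ(x) + ℓ(y))` over `ℚ_p`. -/
def FormalGroupLaw.IsOfLog {ι : Type*} (F : FormalGroupLaw ι ℤ_[p])
    (ℓ : ι → MvPowerSeries ι ℚ_[p]) : Prop :=
  ∃ m : ι → MvPowerSeries ι ℚ_[p], IsCompInverse ℓ m ∧
    ∀ i, toQp (F.add i) = (m i).subst (fun j =>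
      (ℓ j).subst (fun l => (MvPowerSeries.X (Sum.inl l) : MvPowerSeries (ι ⊕ ι) ℚ_[p])) +
      (ℓ j).subst (fun l => (MvPowerSeries.X (Sum.inr l) : MvPowerSeries (ι ⊕ ι) ℚ_[p])))

/-- `ℓ(φ(x)) = B ℓ(x)`: the endomorphism `φ` acts as the matrix `B` through `ℓ`. -/
def FormalGroupLaw.Hom.ActsAs {ι : Type*} [Fintype ι] {F : FormalGroupLaw ι ℤ_[p]}
    (φ : F.Hom F) (ℓ : ι → MvPowerSeries ι ℚ_[p]) (B : Matrix ι ι ℤ_[p]) : Prop :=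
  ∀ i, (ℓ i).subst (fun j => toQp (φ.series j)) = ∑ j, (B i j : ℚ_[p]) • ℓ j

/-- The value of a power series over `ℚ_p` at a point of an extension `M`. -/
def evalAt {σ M : Type*} [NormedField M] [NormedAlgebra ℚ_[p] M]
    (f : MvPowerSeries σ ℚ_[p]) (x : σ → M) : M :=
  ∑' d : σ →₀ ℕ, algebraMap ℚ_[p] M (MvPowerSeries.coeff d f) * d.prod fun s n => x s ^ n

section Evaluation

variable {M : Type*} [NormedField M] [NormedAlgebra ℚ_[p] M]

theorem evalAt_X {σ : Type*} (s : σ) (x : σ → M) :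
    evalAt (toQp (MvPowerSeries.X s : MvPowerSeries σ ℤ_[p])) x = x s := by
  classical
  unfold evalAt
  rw [tsum_eq_single (Finsupp.single s 1)]
  · simp [MvPowerSeries.coeff_X]
  · intro d hd
    simp [MvPowerSeries.coeff_X, hd]

theorem evalAt_zero {σ : Type*} (x : σ → M) :
    evalAt (toQp (0 : MvPowerSeries σ ℤ_[p])) x = 0 := by
  simp [evalAt]

variable [IsUltrametricDist M]

/-- The ring of integers of `M`. -/
def unitBall (M : Type*) [NormedField M] [IsUltrametricDist M] : Subring M where
  carrier := {x | ‖x‖ ≤ 1}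
  mul_mem' {a b} ha hb := by
    simp only [Set.mem_ofPred_eq, norm_mul] at *
    exact mul_le_one₀ ha (norm_nonneg _) hb
  one_mem' := by simp
  add_mem' {a b} ha hb := (IsUltrametricDist.norm_add_le_max a b).trans (max_le ha hb)
  zero_mem' := by simp
  neg_mem' {a} ha := by simpa using ha

/-- The ideal of elements of norm less than `r`. -/
def ballIdeal (M : Type*) [NormedField M] [IsUltrametricDist M] (r : {r : ℝ // 0 < r}) :
    Ideal (unitBall M) where
  carrier := {x | ‖(x : M)‖ < r}
  add_mem' {a b} ha hb :=
    (IsUltrametricDist.norm_add_le_max (a : M) (b : M)).trans_lt (max_lt ha hb)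
  zero_mem' := by simpa using r.2
  smul_mem' c x hx := by
    have hc : ‖(c : M)‖ ≤ 1 := c.2
    have hx' : ‖(x : M)‖ < r := hx
    change ‖((c : M) * (x : M))‖ < r
    rw [norm_mul]
    exact (mul_le_of_le_one_left (norm_nonneg _) hc).trans_lt hx'

theorem isLinearTopology_unitBall : IsLinearTopology (unitBall M) (unitBall M) := by
  refine IsLinearTopology.mk_of_hasBasis (unitBall M) (p := fun _ : {r : ℝ // 0 < r} => True)
    (s := fun r => ballIdeal M r) ?_
  refine ⟨fun t => ?_⟩
  rw [Metric.mem_nhds_iff]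
  constructor
  · rintro ⟨r, hr, h⟩
    refine ⟨⟨r, hr⟩, trivial, fun x hx => h ?_⟩
    have : ‖(x : M)‖ < r := hx
    simpa [Subtype.dist_eq] using this
  · rintro ⟨r, -, h⟩
    refine ⟨r, r.2, fun x hx => h ?_⟩
    change ‖(x : M)‖ < r
    simpa [Subtype.dist_eq] using hx

theorem completeSpace_unitBall [CompleteSpace M] : CompleteSpace (unitBall M) := by
  have : IsClosed (unitBall M : Set M) := isClosed_le continuous_norm continuous_const
  exact this.completeSpace_coe

/-- The structure map `ℤ_p → 𝓞_M`. -/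
def intToBall : ℤ_[p] →+* unitBall M :=
  ((algebraMap ℚ_[p] M).comp (algebraMap ℤ_[p] ℚ_[p])).codRestrict (unitBall M) (fun x => by
    change ‖algebraMap ℚ_[p] M (x : ℚ_[p])‖ ≤ 1
    rw [norm_algebraMap']
    exact x.2)

theorem hasEval_of_norm_lt_one {σ : Type*} [Finite σ] (x : σ → unitBall M)
    (hx : ∀ s, ‖(x s : M)‖ < 1) : MvPowerSeries.HasEval x where
  hpow s := by
    change Filter.Tendsto (fun n => x s ^ n) Filter.atTop (nhds 0)
    rw [tendsto_subtype_rng]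
    simpa using tendsto_pow_atTop_nhds_zero_of_norm_lt_one (hx s)
  tendsto_zero := by
    rw [Filter.cofinite_eq_bot]
    exact Filter.tendsto_bot


/-- Evaluation in `M` agrees with evaluation in `𝓞_M`. -/
theorem evalAt_toQp_eq [CompleteSpace M] {σ : Type*} [Finite σ] (f : MvPowerSeries σ ℤ_[p])
    (x : σ → unitBall M) (hx : ∀ s, ‖(x s : M)‖ < 1) :
    evalAt (toQp f) (fun s => (x s : M)) =
      ((∑' d : σ →₀ ℕ, intToBall (MvPowerSeries.coeff d f) * d.prod fun s n => x s ^ n :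
        unitBall M) : M) := by
  have : IsLinearTopology (unitBall M) (unitBall M) := isLinearTopology_unitBall
  have : CompleteSpace (unitBall M) := completeSpace_unitBall
  have h := (summable_eval (intToBall : ℤ_[p] →+* unitBall M) (hasEval_of_norm_lt_one x hx) f).hasSum
  have h2 := h.map (unitBall M).subtype continuous_subtype_val
  refine Eq.trans ?_ h2.tsum_eq
  refine tsum_congr fun d => ?_
  simp only [MvPowerSeries.coeff_map, Function.comp_apply, map_mul, Finsupp.prod, map_prod,
    map_pow]
  rfl

theorem norm_evalAt_lt_one {σ : Type*} [Finite σ] (f : MvPowerSeries σ ℤ_[p])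
    (hf : f.constantCoeff = 0) (x : σ → M) (hx : ∀ s, ‖x s‖ < 1) :
    ‖evalAt (toQp f) x‖ < 1 := by
  classical
  let _ := Fintype.ofFinite σ
  obtain ⟨r, hr0, hr1, hr⟩ : ∃ r : ℝ, 0 ≤ r ∧ r < 1 ∧ ∀ s, ‖x s‖ ≤ r := by
    rcases isEmpty_or_nonempty σ with h | h
    · exact ⟨0, le_rfl, one_pos, fun s => (h.false s).elim⟩
    · obtain ⟨s, hs⟩ := Finite.exists_max fun s => ‖x s‖
      exact ⟨‖x s‖, norm_nonneg _, hx s, hs⟩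
  refine (IsUltrametricDist.norm_tsum_le_of_forall_le_of_nonneg hr0 fun d => ?_).trans_lt hr1
  by_cases hd : d = 0
  · subst hd
    have : MvPowerSeries.coeff 0 f = 0 := by simpa using hf
    simp [MvPowerSeries.coeff_map, hr0, hf]
  · obtain ⟨s, hs⟩ := Finsupp.ne_iff.1 hd
    rw [norm_mul, norm_algebraMap', MvPowerSeries.coeff_map]
    refine (mul_le_of_le_one_left (norm_nonneg _) (PadicInt.norm_le_one _)).trans ?_
    rw [Finsupp.prod_fintype _ _ (fun _ => pow_zero _), norm_prod,
      ← Finset.mul_prod_erase _ _ (Finset.mem_univ s)]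
    have h1 : ‖x s ^ d s‖ ≤ r := by
      rw [norm_pow]
      exact (pow_le_of_le_one (norm_nonneg _) (hx s).le (by simpa using hs)).trans (hr s)
    refine (mul_le_of_le_one_right (norm_nonneg _) ?_).trans h1
    refine Finset.prod_le_one (fun _ _ => norm_nonneg _) fun t _ => ?_
    rw [norm_pow]
    exact pow_le_one₀ (norm_nonneg _) (hx t).le

theorem evalAt_subst [CompleteSpace M] {σ τ : Type*} [Finite σ] [Finite τ]
    (f : MvPowerSeries σ ℤ_[p]) (a : σ → MvPowerSeries τ ℤ_[p])
    (ha : ∀ s, (a s).constantCoeff = 0) (x : τ → M) (hx : ∀ t, ‖x t‖ < 1) :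
    evalAt (toQp (f.subst a)) x = evalAt (toQp f) fun s => evalAt (toQp (a s)) x := by
  have : IsLinearTopology (unitBall M) (unitBall M) := isLinearTopology_unitBall
  have : CompleteSpace (unitBall M) := completeSpace_unitBall
  have hy := fun s => norm_evalAt_lt_one (a s) (ha s) x hx
  let x' : τ → unitBall M := fun t => ⟨x t, (hx t).le⟩
  let y' : σ → unitBall M := fun s => ⟨evalAt (toQp (a s)) x, (hy s).le⟩
  have h := tsum_subst (intToBall : ℤ_[p] →+* unitBall M)
    (MvPowerSeries.hasSubst_of_constantCoeff_zero ha) (hasEval_of_norm_lt_one x' hx)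
    (hasEval_of_norm_lt_one y' hy) (fun s => Subtype.ext (evalAt_toQp_eq (a s) x' hx)) f
  have h1 := evalAt_toQp_eq (M := M) (f.subst a) x' hx
  have h2 := evalAt_toQp_eq (M := M) f y' hy
  rw [h] at h1
  exact h1.trans h2.symm

end Evaluation

/-! ### Points of a formal group law -/

namespace FormalGroupLaw

/-- The points `F(𝔪_M)`: tuples of elements of the maximal ideal of `M`. -/
@[ext]
structure Points {ι : Type*} (F : FormalGroupLaw ι ℤ_[p]) (M : Type*) [NormedField M] where
  /-- the coordinates -/
  coord : ι → M
  norm_lt_one : ∀ i, ‖coord i‖ < 1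

namespace Points

variable {ι : Type*} {F G : FormalGroupLaw ι ℤ_[p]}
variable {M : Type*} [NormedField M]

theorem norm_elim_lt_one (x y : F.Points M) : ∀ s, ‖Sum.elim x.coord y.coord s‖ < 1 := by
  rintro (i | i)
  exacts [x.norm_lt_one i, y.norm_lt_one i]

instance : Zero (F.Points M) where
  zero := ⟨fun _ => 0, fun _ => by simp⟩

theorem zero_coord (i : ι) : (0 : F.Points M).coord i = 0 := rfl

variable [Finite ι] [NormedAlgebra ℚ_[p] M] [IsUltrametricDist M]

/-- `x +_F y = F(x, y)`. -/
instance : Add (F.Points M) where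
  add x y := ⟨fun i => evalAt (toQp (F.add i)) (Sum.elim x.coord y.coord), fun i =>
    norm_evalAt_lt_one _ (F.constantCoeff_add i) _ (norm_elim_lt_one x y)⟩

instance : Neg (F.Points M) where
  neg x := ⟨fun i => evalAt (toQp (F.neg i)) x.coord, fun i =>
    norm_evalAt_lt_one _ (F.constantCoeff_neg i) _ x.norm_lt_one⟩

theorem add_coord (x y : F.Points M) (i : ι) :
    (x + y).coord i = evalAt (toQp (F.add i)) (Sum.elim x.coord y.coord) := rfl

theorem neg_coord (x : F.Points M) (i : ι) :
    (-x).coord i = evalAt (toQp (F.neg i)) x.coord := rfl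

section Laws

variable [CompleteSpace M]

protected theorem add_comm (x y : F.Points M) : x + y = y + x := by
  ext i
  rw [add_coord, add_coord]
  conv_lhs => rw [← F.add_comm i]
  rw [evalAt_subst _ _ _ _ (norm_elim_lt_one x y)]
  · congr 1
    funext s
    rcases s with j | j <;> exact evalAt_X _ _
  · rintro (j | j) <;> simp

protected theorem add_zero (x : F.Points M) : x + 0 = x := by
  ext i
  rw [add_coord]
  refine Eq.trans ?_ (evalAt_X (p := p) i x.coord)
  rw [← F.add_zero i, evalAt_subst _ _ _ _ x.norm_lt_one]
  · congr 1
    funext s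
    rcases s with j | j
    · exact (evalAt_X (p := p) j x.coord).symm
    · exact (evalAt_zero (p := p) x.coord).symm
  · rintro (j | j) <;> simp

protected theorem add_neg (x : F.Points M) : x + -x = 0 := by
  ext i
  rw [add_coord, zero_coord]
  refine Eq.trans ?_ (evalAt_zero (p := p) x.coord)
  rw [← F.add_neg i, evalAt_subst _ _ _ _ x.norm_lt_one]
  · congr 1
    funext s
    rcases s with j | j
    · exact (evalAt_X (p := p) j x.coord).symm
    · rfl
  · rintro (j | j)
    · simp
    · exact F.constantCoeff_neg j

protected theorem add_assoc (x y z : F.Points M) : x + y + z = x + (y + z) := by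
  ext i
  have hw : ∀ s, ‖(Sum.elim x.coord (Sum.elim y.coord z.coord) : ι ⊕ (ι ⊕ ι) → M) s‖ < 1 := by
    rintro (j | j | j)
    exacts [x.norm_lt_one j, y.norm_lt_one j, z.norm_lt_one j]
  have hX : ∀ u v : ι → ι ⊕ (ι ⊕ ι), ∀ j, MvPowerSeries.constantCoeff ((F.add j).subst
      (Sum.elim (fun l => MvPowerSeries.X (u l)) (fun l => MvPowerSeries.X (v l)) :
        ι ⊕ ι → MvPowerSeries (ι ⊕ (ι ⊕ ι)) ℤ_[p])) = 0 := by
    intro u v j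
    have h0 : ∀ s, MvPowerSeries.constantCoeff ((Sum.elim (fun l => MvPowerSeries.X (u l))
        (fun l => MvPowerSeries.X (v l)) : ι ⊕ ι → MvPowerSeries (ι ⊕ (ι ⊕ ι)) ℤ_[p]) s) = 0 := by
      rintro (l | l) <;> simp
    exact MvPowerSeries.constantCoeff_subst_eq_zero
      (MvPowerSeries.hasSubst_of_constantCoeff_zero h0) h0 (F.constantCoeff_add j)
  have hE : ∀ u v : ι → ι ⊕ (ι ⊕ ι), ∀ j, evalAt (toQp ((F.add j).subst
      (Sum.elim (fun l => MvPowerSeries.X (u l)) (fun l => MvPowerSeries.X (v l)) :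
        ι ⊕ ι → MvPowerSeries (ι ⊕ (ι ⊕ ι)) ℤ_[p])))
          (Sum.elim x.coord (Sum.elim y.coord z.coord)) =
      evalAt (toQp (F.add j)) (Sum.elim
        (fun l => (Sum.elim x.coord (Sum.elim y.coord z.coord) : ι ⊕ (ι ⊕ ι) → M) (u l))
        (fun l => (Sum.elim x.coord (Sum.elim y.coord z.coord) : ι ⊕ (ι ⊕ ι) → M) (v l))) := by
    intro u v j
    rw [evalAt_subst _ _ _ _ hw]
    · congr 1
      funext s
      rcases s with l | l <;> exact evalAt_X _ _
    · rintro (l | l) <;> simp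
  have key := congrArg (fun f => evalAt (toQp f) (Sum.elim x.coord (Sum.elim y.coord z.coord)))
    (F.add_assoc i)
  simp only at key
  rw [evalAt_subst _ _ _ _ hw, evalAt_subst _ _ _ _ hw] at key
  · rw [add_coord, add_coord]
    refine Eq.trans ?_ (key.trans ?_)
    · congr 1
      funext s
      rcases s with j | j
      · exact (hE Sum.inl (fun l => Sum.inr (Sum.inl l)) j).symm
      · exact (evalAt_X (p := p) (Sum.inr (Sum.inr j))
          (Sum.elim x.coord (Sum.elim y.coord z.coord))).symm
    · congr 1
      funext s
      rcases s with j | j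
      · exact evalAt_X (p := p) (Sum.inl j) (Sum.elim x.coord (Sum.elim y.coord z.coord))
      · exact hE (fun l => Sum.inr (Sum.inl l)) (fun l => Sum.inr (Sum.inr l)) j
  · rintro (j | j)
    · simp
    · exact hX _ _ j
  · rintro (j | j)
    · exact hX _ _ j
    · simp

end Laws

/-- The group of points of `F` over a finite extension `M` of `ℚ_p`. -/
instance [FiniteDimensional ℚ_[p] M] : AddCommGroup (F.Points M) :=
  have : CompleteSpace M := FiniteDimensional.complete ℚ_[p] M
  { add_assoc := Points.add_assoc
    zero_add := fun x => (Points.add_comm 0 x).trans (Points.add_zero x)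
    add_zero := Points.add_zero
    add_comm := Points.add_comm
    neg_add_cancel := fun x => (Points.add_comm (-x) x).trans (Points.add_neg x)
    nsmul := nsmulRec
    zsmul := zsmulRec }

end Points

/-- The map `F(𝔪_M) → G(𝔪_M)` given by a homomorphism `F → G`. -/
def Hom.onPoints {ι : Type*} [Finite ι] {F G : FormalGroupLaw ι ℤ_[p]} (φ : F.Hom G)
    {M : Type*} [NormedField M] [NormedAlgebra ℚ_[p] M] [IsUltrametricDist M]
    (x : F.Points M) : G.Points M :=
  ⟨fun i => evalAt (toQp (φ.series i)) x.coord, fun i =>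
    norm_evalAt_lt_one _ (φ.constantCoeff_series i) _ x.norm_lt_one⟩

/-- The map `F(𝔪_M) → F(𝔪_M')` induced by a `ℚ_p`-algebra homomorphism `M → M'`
between algebraic extensions (which preserves the norm). -/
def Points.map {ι : Type*} {F : FormalGroupLaw ι ℤ_[p]} {M M' : Type*}
    [NormedField M] [NormedAlgebra ℚ_[p] M] [Algebra.IsAlgebraic ℚ_[p] M]
    [NormedField M'] [NormedAlgebra ℚ_[p] M'] [Algebra.IsAlgebraic ℚ_[p] M']
    (f : M →ₐ[ℚ_[p]] M') (x : F.Points M) : F.Points M' :=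
  ⟨fun i => f (x.coord i), fun i => by
    have h : ‖f (x.coord i)‖ = ‖x.coord i‖ := by
      rw [NormedAlgebra.norm_eq_spectralNorm ℚ_[p] (f (x.coord i)),
        NormedAlgebra.norm_eq_spectralNorm ℚ_[p] (x.coord i), spectralNorm, spectralNorm,
        minpoly.algHom_eq f f.injective]
    rw [h]
    exact x.norm_lt_one i⟩

open scoped Classical in
/-- `y ∈ F(𝔪_{M₂})` is the trace of `x ∈ F(𝔪_{M₁})`, i.e. the sum of `σ(x)` for the group law of
`F` over `σ ∈ Gal(M₁/M₂)`, the automorphisms of `M₁` that fix `M₂` pointwise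
(for a finite Galois extension `M₁/M₂`). -/
def IsTrace {ι : Type*} [Finite ι] (F : FormalGroupLaw ι ℤ_[p])
    {M₁ M₂ : IntermediateField ℚ_[p] (PadicAlgCl p)} (h : M₂ ≤ M₁)
    [FiniteDimensional ℚ_[p] M₁] [FiniteDimensional ℚ_[p] M₂]
    (x : F.Points M₁) (y : F.Points M₂) : Prop :=
  y.map (IntermediateField.inclusion h) =
    ∑ σ : M₁ ≃ₐ[ℚ_[p]] M₁ with ∀ z : M₁, (z : PadicAlgCl p) ∈ M₂ → σ z = z,
      x.map (σ : M₁ →ₐ[ℚ_[p]] M₁)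

end FormalGroupLaw

/-! ### The tower of local fields -/

/-- `ℚ_p = k_0 ⊂ k_1 ⊂ ⋯` is the tower of layers of a totally ramified `ℤ_p`-extension:
`k_n / ℚ_p` is cyclic of degree `p ^ n` with residue field `𝔽_p`. -/
structure IsRamifiedZpTower (k : ℕ → IntermediateField ℚ_[p] (PadicAlgCl p)) : Prop where
  le_succ : ∀ n, k n ≤ k (n + 1)
  finrank_eq : ∀ n, Module.finrank ℚ_[p] (k n) = p ^ n
  isGalois : ∀ n, IsGalois ℚ_[p] (k n)
  isCyclic : ∀ n, IsCyclic (k n ≃ₐ[ℚ_[p]] k n)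
  residue : ∀ n, ∀ x : k n, ‖x‖ ≤ 1 → ∃ y : ℤ_[p], ‖x - algebraMap ℚ_[p] (k n) y‖ < 1

/-- `ℚ_p(μ_p)` -/
def muField (p : ℕ) [Fact p.Prime] : IntermediateField ℚ_[p] (PadicAlgCl p) :=
  IntermediateField.adjoin ℚ_[p] {ζ | ζ ^ p = 1}

instance : FiniteDimensional ℚ_[p] (muField p) := by
  have h : ({ζ | ζ ^ p = 1} : Set (PadicAlgCl p)).Finite := by
    refine (Polynomial.nthRootsFinset p (1 : PadicAlgCl p)).finite_toSet.subset fun ζ hζ => ?_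
    simpa [Polynomial.mem_nthRootsFinset (Fact.out : p.Prime).pos] using hζ
  have : Finite ({ζ | ζ ^ p = 1} : Set (PadicAlgCl p)) := h
  exact IntermediateField.finiteDimensional_adjoin fun x _ => Algebra.IsIntegral.isIntegral x

/-- `L_0 = ℚ_p` and `L_{n+1} = k_n(μ_p)`. -/
def cycloLayer (k : ℕ → IntermediateField ℚ_[p] (PadicAlgCl p)) :
    ℕ → IntermediateField ℚ_[p] (PadicAlgCl p)
  | 0 => ⊥
  | n + 1 => k n ⊔ muField p

instance (k : ℕ → IntermediateField ℚ_[p] (PadicAlgCl p)) [∀ n, FiniteDimensional ℚ_[p] (k n)] :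
    ∀ n, FiniteDimensional ℚ_[p] (cycloLayer k n)
  | 0 => inferInstanceAs
      (FiniteDimensional ℚ_[p] (⊥ : IntermediateField ℚ_[p] (PadicAlgCl p)))
  | n + 1 => IntermediateField.finiteDimensional_sup (k n) (muField p)

theorem le_cycloLayer (k : ℕ → IntermediateField ℚ_[p] (PadicAlgCl p)) (n : ℕ) :
    k n ≤ cycloLayer k (n + 1) :=
  le_sup_left

/-! ### The Lubin-Tate group of height one -/

/-- `𝔣(X) = π X + ∑_{i=2}^p (p choose i) X ^ i` -/
def ltFrob (π : ℤ_[p]) : Polynomial ℤ_[p] :=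
  Polynomial.C π * Polynomial.X +
    ∑ i ∈ Finset.Icc 2 p, Polynomial.C (p.choose i : ℤ_[p]) * Polynomial.X ^ i

/-- `𝔣^{(k)}`, the `k`-th iterate of `𝔣` -/
def ltIter (π : ℤ_[p]) : ℕ → Polynomial ℤ_[p]
  | 0 => Polynomial.X
  | k + 1 => (ltFrob π).comp (ltIter π k)

/-- The value of a polynomial over `ℤ_p` at an element of the algebraic closure. -/
def evalPoly (f : Polynomial ℤ_[p]) (x : PadicAlgCl p) : PadicAlgCl p :=
  f.eval₂ ((algebraMap ℚ_[p] (PadicAlgCl p)).comp (algebraMap ℤ_[p] ℚ_[p])) x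

/-- The `π ^ n`-torsion of the Lubin-Tate formal group with Frobenius lift `𝔣 = [π]`. -/
def ltTorsion (π : ℤ_[p]) (n : ℕ) : Set (PadicAlgCl p) :=
  {x | ‖x‖ < 1 ∧ evalPoly (ltIter π n) x = 0}

/-- `π`-sequences -/
structure IsPiSequence (π : ℤ_[p]) (e : ℕ → PadicAlgCl p) : Prop where
  zero : e 0 = 0
  mem : ∀ n, e (n + 1) ∈ ltTorsion π (n + 1)
  notMem : ∀ n, e (n + 1) ∉ ltTorsion π n
  map_succ : ∀ n, evalPoly (ltFrob π) (e (n + 1)) = e n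

/-! ### The logarithms -/

/-- The matrices `x_k` with `x_0 = 1` and `p x_k = C x_{k-1} - x_{k-2}` for `k ≥ 1`,
where `x_{-1} = 0`. -/
def xSeq {ι : Type*} [Fintype ι] [DecidableEq ι] (C : Matrix ι ι ℚ_[p]) : ℕ → Matrix ι ι ℚ_[p]
  | 0 => 1
  | 1 => (p : ℚ_[p])⁻¹ • C
  | k + 2 => (p : ℚ_[p])⁻¹ • (C * xSeq C (k + 1) - xSeq C k)

/-- `ℓ(x) = ∑_{k ≥ 0} x_k 𝔣^{(k)}(x)`, where `𝔣^{(k)}` is applied to each coordinate of `x` and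
the sum is taken coefficient by coefficient. -/
def ltLog {ι : Type*} [Fintype ι] [DecidableEq ι] (π : ℤ_[p]) (C : Matrix ι ι ℚ_[p]) (i : ι) :
    MvPowerSeries ι ℚ_[p] :=
  fun d => ∑' k : ℕ, ∑ j, xSeq C k i j * MvPowerSeries.coeff d
    (toQp (Polynomial.aeval (MvPowerSeries.X j : MvPowerSeries ι ℤ_[p]) (ltIter π k)))

/-- The coefficient of `T ^ k` in `(1 - a T + c T ^ 2)⁻¹`. -/
def eulerCoeff {R : Type*} [CommRing R] (a c : R) : ℕ → R
  | 0 => 1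
  | 1 => a
  | k + 2 => a * eulerCoeff a c (k + 1) - c * eulerCoeff a c k

/-- The coefficient `a_n` of the Dirichlet series
`∑ a_n n ^ (-s) = ∏_q (1 - a_q q ^ (-s) + ψ(q) q ^ (1 - 2 s))⁻¹`,
where `ψ(q) = 0` if `q` divides `N` and `ψ(q) = 1` otherwise. -/
def dirichletCoeff {R : Type*} [CommRing R] (N : ℕ) (a : ℕ → R) (n : ℕ) : R :=
  n.factorization.prod fun q k => eulerCoeff (a q) (if q ∣ N then 0 else (q : R)) k

/-- `∑_{n ≥ 1} (C_n / n) x ^ n`, where `x ^ n` is the vector of the `n`-th powers of the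
coordinates of `x`. -/
def dirichletLog {ι : Type*} [Fintype ι] [DecidableEq ι] (C : ℕ → Matrix ι ι ℚ_[p]) (i : ι) :
    MvPowerSeries ι ℚ_[p] :=
  fun d => ∑ j, if d j ≠ 0 ∧ d = Finsupp.single j (d j) then C (d j) i j / (d j : ℚ_[p]) else 0

end Padic

/-- The matrix over `ℤ_p` of multiplication by `a` in the `ℤ`-basis `b` of `𝓞 F`. -/
def mulMatrix (p : ℕ) [Fact p.Prime] {F : Type*} [Field F] {g : ℕ}
    (b : Module.Basis (Fin g) ℤ (𝓞 F)) (a : 𝓞 F) : Matrix (Fin g) (Fin g) ℤ_[p] :=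
  (Algebra.leftMulMatrix b a).map (Int.castRingHom ℤ_[p])

end

noncomputable section

/-! Integrality comes from Honda's theory. Let φ be the substitution x ↦ x^p and C = C_p. A tuple h
has type p - Cφ + φ² if p h - C φ(h) + φ²(h) ≡ 0 mod p. If a logarithm with invertible integral
linear part has this type (`HondaType`), then its inverse series carries every tuple of the same
type to an integral tuple (`HondaType.exists_toQp_eq`). Applied to ℓ(x) + ℓ(y), to -ℓ(x) and to Bℓ
with B commuting with C, this gives the group law, its inverse, the endomorphisms [B], and the
homomorphisms between groups with two logarithms of one type.

The recurrence of the x_k telescopes to the exact identity pℓ - Cℓ∘𝔣 + ℓ∘𝔣∘𝔣 = p x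
(`IsLtCoeff.coeff_relation`). Since 𝔣 ≡ X^p mod p, ℓ has type p - Cφ + φ². The Dirichlet logarithm
has the same type by its Euler factor at p. The sum defining ℓ converges because C is nilpotent
modulo p.

The logarithm is injective on the points over k_n (`logHom_injective`): its kernel is p-power
torsion, the Galois group is a cyclic p-group, so a nonzero kernel would contain a nonzero
Galois-fixed point, and the logarithm is injective on pℤ_p for odd p. Trace relations may therefore
be checked on logarithms, where they become linear algebra.

Eisenstein polynomials give [ℚ_p(e_{n+1}) : ℚ_p] = (p - 1)p^n. The fields L_m are cyclic over ℚ_p,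
so comparing degrees gives ℚ_p(e_{n+1}) = L_{n+1}. The normalized trace of e_{n+2} to L_{n+1} is -1,
and that of e_1 to ℚ_p is -p/(p - 1).

As 𝔣^{(j)}(e_n) = e_{n-j}, the logarithm of e_n u_1 is the finite sum of the x_j u_1 e_{n-j}, j < n.
With W = log ε, log d_n is (p - 1) times W plus the normalized trace of this sum for e_{n+1}.
Applying the trace and the recurrence of the x_j to log d_{n+1} yields (p - 1)(pW - p u_1) plus a
combination of C and earlier terms; the condition (1 + p - C)W = p u_1 on ε turns pW - p u_1 into CW
- W, which is what relation 1 needs. At the bottom log d_0 = (C - 2)W, whence relation 2. -/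

theorem IsUltrametricDist.norm_sub_le_max {M : Type*} [SeminormedAddCommGroup M]
    [IsUltrametricDist M] (x y : M) : ‖x - y‖ ≤ max ‖x‖ ‖y‖ := by
  rw [sub_eq_add_neg, ← norm_neg y]
  exact IsUltrametricDist.norm_add_le_max x (-y)

/-! ### Orders of power series and of substitutions. -/

namespace MvPowerSeries

variable {τ R : Type*} [CommRing R]

theorem le_order_sub_of_le {f g : MvPowerSeries τ R} {n : ℕ∞} (hf : n ≤ f.order)
    (hg : n ≤ g.order) : n ≤ (f - g).order := by
  rw [sub_eq_add_neg]
  exact (le_min hf (by rwa [order_neg])).trans min_order_le_add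

theorem le_order_add_of_le {f g : MvPowerSeries τ R} {n : ℕ∞} (hf : n ≤ f.order)
    (hg : n ≤ g.order) : n ≤ (f + g).order :=
  (le_min hf hg).trans min_order_le_add

theorem le_order_mul_of_le {f g : MvPowerSeries τ R} {m n : ℕ∞} (hf : m ≤ f.order)
    (hg : n ≤ g.order) : m + n ≤ (f * g).order :=
  (add_le_add hf hg).trans le_order_mul

theorem le_order_sum {α : Type*} {s : Finset α} {f : α → MvPowerSeries τ R} {n : ℕ∞}
    (h : ∀ i ∈ s, n ≤ (f i).order) : n ≤ (∑ i ∈ s, f i).order := by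
  classical
  induction s using Finset.induction_on with
  | empty => simp
  | insert a s ha ih =>
    rw [Finset.sum_insert ha]
    exact le_order_add_of_le (h a (by simp)) (ih fun i hi => h i (by simp [hi]))

theorem one_le_order {f : MvPowerSeries τ R} (h : f.constantCoeff = 0) : 1 ≤ f.order :=
  one_le_order_iff_constCoeff_eq_zero.2 h

end MvPowerSeries

namespace PowerSeries

variable {τ R : Type*} [CommRing R]

theorem exists_eq_C_add_X_mul (f : R⟦X⟧) :
    ∃ g : R⟦X⟧, f = C (coeff 0 f) + X * g ∧ coeff 0 g = coeff 1 f := by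
  refine ⟨mk fun n => coeff (n + 1) f, ?_, by simp⟩
  conv_lhs => rw [eq_X_mul_shift_add_const f]
  rw [_root_.add_comm]
  simp

theorem subst_C_add_X_mul {a : MvPowerSeries τ R} (ha : HasSubst a) (c : R) (g : R⟦X⟧) :
    (C c + X * g).subst a = MvPowerSeries.C c + a * g.subst a := by
  rw [subst_add ha, subst_mul ha, subst_X ha, subst_C]

theorem le_order_subst_sub_subst {a b : MvPowerSeries τ R} (ha : a.constantCoeff = 0)
    (hb : b.constantCoeff = 0) {n : ℕ∞} (hab : n ≤ (a - b).order) (f : R⟦X⟧) :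
    n ≤ (f.subst a - f.subst b).order := by
  have ha' := HasSubst.of_constantCoeff_zero ha
  have hb' := HasSubst.of_constantCoeff_zero hb
  -- The bound is truncated at k to allow induction: each factor X peeled off f becomes a factor b
  -- of order at least 1.
  have key : ∀ k : ℕ, ∀ f : R⟦X⟧, min n k ≤ (f.subst a - f.subst b).order := by
    intro k
    induction k with
    | zero => intro f; simp
    | succ k ih =>
      intro f
      obtain ⟨g, hg, -⟩ := exists_eq_C_add_X_mul f
      rw [hg, subst_C_add_X_mul ha', subst_C_add_X_mul hb']
      have : MvPowerSeries.C (coeff 0 f) + a * g.subst a - (MvPowerSeries.C (coeff 0 f) +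
          b * g.subst b) = (a - b) * g.subst a + b * (g.subst a - g.subst b) := by ring
      rw [this]
      refine MvPowerSeries.le_order_add_of_le ?_ ?_
      · refine (min_le_left _ _).trans ?_
        simpa using MvPowerSeries.le_order_mul_of_le (n := 0) hab bot_le
      · refine le_trans ?_ (MvPowerSeries.le_order_mul_of_le (MvPowerSeries.one_le_order hb) (ih g))
        rw [← min_add_add_left]
        refine min_le_min le_add_self ?_
        push_cast
        rw [_root_.add_comm]
  refine ENat.forall_natCast_le_iff_le.1 fun m hm => ?_
  simpa [min_eq_right hm] using key m f

/-- With f = c + X g and g = f_1 + X q, the difference minus its linear part is (a - b) a q(a) +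
(g(a) - g(b)) b, and each summand has an extra factor of order at least 1. This is the Newton
estimate behind inverting a logarithm. -/
theorem le_order_subst_sub_subst_sub_smul {a b : MvPowerSeries τ R} (ha : a.constantCoeff = 0)
    (hb : b.constantCoeff = 0) {n : ℕ∞} (hab : n ≤ (a - b).order) (f : R⟦X⟧) :
    n + 1 ≤ (f.subst a - f.subst b - coeff 1 f • (a - b)).order := by
  have ha' := HasSubst.of_constantCoeff_zero ha
  have hb' := HasSubst.of_constantCoeff_zero hb
  obtain ⟨g, hg, hg1⟩ := exists_eq_C_add_X_mul f
  obtain ⟨q, hq, -⟩ := exists_eq_C_add_X_mul g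
  have hq' : g.subst a = MvPowerSeries.C (coeff 1 f) + a * q.subst a := by
    conv_lhs => rw [hq, subst_C_add_X_mul ha', hg1]
  have : f.subst a - f.subst b - coeff 1 f • (a - b) =
      (a - b) * (a * q.subst a) + (g.subst a - g.subst b) * b := by
    rw [MvPowerSeries.smul_eq_C_mul]
    have h1 : f.subst a = MvPowerSeries.C (coeff 0 f) + a * g.subst a := by
      conv_lhs => rw [hg, subst_C_add_X_mul ha']
    have h2 : f.subst b = MvPowerSeries.C (coeff 0 f) + b * g.subst b := by
      conv_lhs => rw [hg, subst_C_add_X_mul hb']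
    rw [h1, h2, hq']
    ring
  rw [this]
  refine MvPowerSeries.le_order_add_of_le ?_ ?_
  · refine MvPowerSeries.le_order_mul_of_le hab ?_
    simpa using MvPowerSeries.le_order_mul_of_le (n := 0) (MvPowerSeries.one_le_order ha) bot_le
  · exact MvPowerSeries.le_order_mul_of_le (le_order_subst_sub_subst ha hb hab g)
      (MvPowerSeries.one_le_order hb)

end PowerSeries

/-! ### Congruences modulo p for logarithms with denominators n. -/

section Padic

variable {p : ℕ} [Fact p.Prime]

theorem norm_coeff_toQp_le_one {σ : Type*} (f : MvPowerSeries σ ℤ_[p]) (d : σ →₀ ℕ) :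
    ‖MvPowerSeries.coeff d (toQp f)‖ ≤ 1 := by
  rw [MvPowerSeries.coeff_map]
  exact PadicInt.norm_le_one _

theorem exists_toQp_eq {σ : Type*} {f : MvPowerSeries σ ℚ_[p]}
    (h : ∀ d, ‖MvPowerSeries.coeff d f‖ ≤ 1) : ∃ g : MvPowerSeries σ ℤ_[p], toQp g = f :=
  ⟨(fun d => (⟨MvPowerSeries.coeff d f, h d⟩ : ℤ_[p]) : (σ →₀ ℕ) → ℤ_[p]), by
    ext d
    exact MvPowerSeries.coeff_map _ _ _⟩

theorem toQp_injective {σ : Type*} :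
    Function.Injective (toQp : MvPowerSeries σ ℤ_[p] → MvPowerSeries σ ℚ_[p]) := by
  intro f g h
  ext d
  have := congrArg (MvPowerSeries.coeff d) h
  simp only [MvPowerSeries.coeff_map] at this
  exact_mod_cast this

theorem toQp_subst {σ τ : Type*} {a : σ → MvPowerSeries τ ℤ_[p]}
    (ha : MvPowerSeries.HasSubst a) (f : MvPowerSeries σ ℤ_[p]) :
    toQp (f.subst a) = (toQp f).subst fun s => toQp (a s) :=
  MvPowerSeries.map_subst ha f

theorem toQp_X {σ : Type*} (s : σ) :
    toQp (MvPowerSeries.X s : MvPowerSeries σ ℤ_[p]) = MvPowerSeries.X s := by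
  simp

theorem constantCoeff_toQp {σ : Type*} {f : MvPowerSeries σ ℤ_[p]} (hf : f.constantCoeff = 0) :
    (toQp f).constantCoeff = 0 := by
  rw [MvPowerSeries.constantCoeff_map, hf, map_zero]

theorem constantCoeff_of_toQp {σ : Type*} {f : MvPowerSeries σ ℤ_[p]}
    (hf : (toQp f).constantCoeff = 0) : f.constantCoeff = 0 := by
  rw [MvPowerSeries.constantCoeff_map] at hf
  exact (map_eq_zero_iff _ (FaithfulSMul.algebraMap_injective ℤ_[p] ℚ_[p])).1 hf

/-- `p • f` has coefficients in `p ℤ_p` iff they have norm at most `p⁻¹`. -/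
theorem exists_smul_toQp_eq {σ : Type*} {f : MvPowerSeries σ ℚ_[p]}
    (h : ∀ d, ‖MvPowerSeries.coeff d f‖ ≤ (p : ℝ)⁻¹) :
    ∃ g : MvPowerSeries σ ℤ_[p], f = (p : ℚ_[p]) • toQp g := by
  have hp : (p : ℚ_[p]) ≠ 0 := by exact_mod_cast (Fact.out : p.Prime).ne_zero
  obtain ⟨g, hg⟩ := exists_toQp_eq (f := (p : ℚ_[p])⁻¹ • f) fun d => by
    rw [MvPowerSeries.coeff_smul, norm_mul, norm_inv, Padic.norm_p, inv_inv]
    have : (0 : ℝ) < p := by exact_mod_cast (Fact.out : p.Prime).pos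
    calc (p : ℝ) * _ ≤ p * (p : ℝ)⁻¹ := by gcongr; exact h d
      _ = 1 := mul_inv_cancel₀ this.ne'
  exact ⟨g, by rw [hg, smul_smul, mul_inv_cancel₀ hp, one_smul]⟩

/-- Write n = p^k m with p ∤ m. The p^k-th power of a congruence modulo p holds modulo p^(k+1), and
m is a unit in every ℤ_p-algebra. The factor n gained here pays for the denominators of a logarithm.
-/
theorem dvd_pow_sub_pow_mul {R : Type*} [CommRing R] [Algebra ℤ_[p] R] {a b : R}
    (h : (p : R) ∣ a - b) (n : ℕ) : ((p * n : ℕ) : R) ∣ a ^ n - b ^ n := by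
  rcases eq_or_ne n 0 with rfl | hn
  · simp
  obtain ⟨k, m, hm, rfl⟩ := Nat.exists_eq_pow_mul_and_not_dvd hn p (Fact.out : p.Prime).ne_one
  have hu : IsUnit (m : ℤ_[p]) := by
    rw [PadicInt.isUnit_iff]
    have := PadicInt.norm_lt_one_iff_dvd (p := p) (m : ℤ_[p])
    by_contra hne
    have h1 := this.1 (lt_of_le_of_ne (PadicInt.norm_le_one _) hne)
    have h2 := (PadicInt.norm_int_lt_one_iff_dvd (p := p) (m : ℤ)).1
    rw [← this] at h1
    exact hm (by exact_mod_cast h2 (by exact_mod_cast h1))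
  have hu' : IsUnit (m : R) := by simpa using hu.map (algebraMap ℤ_[p] R)
  have h1 : (p : R) ^ (k + 1) ∣ a ^ (p ^ k * m) - b ^ (p ^ k * m) := by
    rw [pow_mul, pow_mul]
    exact (dvd_sub_pow_of_dvd_sub h k).trans (sub_dvd_pow_sub_pow _ _ m)
  have h2 : ((p * (p ^ k * m) : ℕ) : R) = (p : R) ^ (k + 1) * m := by push_cast; ring
  rw [h2]
  exact hu'.mul_right_dvd.2 h1

variable {ι τ : Type*} [Fintype ι]

/-- The one-variable power series `∑ (D n i j / n) X ^ n`. -/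
def logCoeff (D : ℕ → Matrix ι ι ℤ_[p]) (i j : ι) : PowerSeries ℚ_[p] :=
  PowerSeries.mk fun n => (D n i j : ℚ_[p]) / n

/-- The tuple `∑ (D n / n) a ^ n`. -/
def logSubst (D : ℕ → Matrix ι ι ℤ_[p]) (a : ι → MvPowerSeries τ ℚ_[p]) (i : ι) :
    MvPowerSeries τ ℚ_[p] :=
  ∑ j, (logCoeff D i j).subst (a j)

omit [Fintype ι] in
theorem logCoeff_zero (D : ℕ → Matrix ι ι ℤ_[p]) (i j : ι) :
    PowerSeries.constantCoeff (logCoeff D i j) = 0 := by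
  simp [logCoeff, ← PowerSeries.coeff_zero_eq_constantCoeff_apply]

theorem constantCoeff_logSubst (D : ℕ → Matrix ι ι ℤ_[p]) {a : ι → MvPowerSeries τ ℚ_[p]}
    (ha : ∀ j, (a j).constantCoeff = 0) (i : ι) : (logSubst D a i).constantCoeff = 0 := by
  rw [logSubst, map_sum]
  exact Finset.sum_eq_zero fun j _ =>
    PowerSeries.constantCoeff_subst_eq_zero (ha j) _ (logCoeff_zero D i j)

theorem subst_logSubst (D : ℕ → Matrix ι ι ℤ_[p]) {a : ι → MvPowerSeries τ ℚ_[p]}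
    (ha : ∀ j, (a j).constantCoeff = 0) {υ : Type*} {b : τ → MvPowerSeries υ ℚ_[p]}
    (hb : MvPowerSeries.HasSubst b) (i : ι) :
    (logSubst D a i).subst b = logSubst D (fun j => (a j).subst b) i := by
  rw [logSubst, ← MvPowerSeries.coe_substAlgHom hb, map_sum, logSubst]
  refine Finset.sum_congr rfl fun j _ => ?_
  rw [MvPowerSeries.coe_substAlgHom hb]
  exact MvPowerSeries.subst_comp_subst_apply
    (PowerSeries.HasSubst.of_constantCoeff_zero (ha j)).const hb _

theorem dirichletLog_eq_logSubst [DecidableEq ι] (D : ℕ → Matrix ι ι ℤ_[p]) (i : ι) :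
    dirichletLog (fun n => (D n).map (algebraMap ℤ_[p] ℚ_[p])) i =
      logSubst D MvPowerSeries.X i := by
  ext d
  rw [logSubst, map_sum]
  change ∑ j, _ = _
  refine Finset.sum_congr rfl fun j _ => ?_
  rw [PowerSeries.coeff_subst_single]
  by_cases h : d = Finsupp.single j (d j)
  · rw [if_pos h]
    by_cases h0 : d j = 0
    · simp [h0, logCoeff]
    · rw [if_pos ⟨h0, h⟩]
      simp [logCoeff]
  · rw [if_neg h, if_neg fun h' => h h'.2]

theorem subst_dirichletLog [DecidableEq ι] (D : ℕ → Matrix ι ι ℤ_[p])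
    {a : ι → MvPowerSeries τ ℚ_[p]} (ha : ∀ j, (a j).constantCoeff = 0) (i : ι) :
    (dirichletLog (fun n => (D n).map (algebraMap ℤ_[p] ℚ_[p])) i).subst a = logSubst D a i := by
  have ha' := MvPowerSeries.hasSubst_of_constantCoeff_zero ha
  rw [dirichletLog_eq_logSubst, subst_logSubst D (fun j => by simp) ha']
  congr 1
  funext j
  exact MvPowerSeries.subst_X ha' j

/-- A power series log agrees with its linear part up to higher order. -/
theorem le_order_logSubst_sub (D : ℕ → Matrix ι ι ℤ_[p]) {a b : ι → MvPowerSeries τ ℚ_[p]}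
    (ha : ∀ j, (a j).constantCoeff = 0) (hb : ∀ j, (b j).constantCoeff = 0) {n : ℕ∞}
    (hab : ∀ j, n ≤ (a j - b j).order) (i : ι) :
    n + 1 ≤ (logSubst D a i - logSubst D b i -
      ∑ j, (D 1 i j : ℚ_[p]) • (a j - b j)).order := by
  rw [logSubst, logSubst, ← Finset.sum_sub_distrib, ← Finset.sum_sub_distrib]
  refine MvPowerSeries.le_order_sum fun j _ => ?_
  have := PowerSeries.le_order_subst_sub_subst_sub_smul (ha j) (hb j) (hab j) (logCoeff D i j)
  simpa [logCoeff] using this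

omit [Fintype ι] in
-- In the n-th term the difference a^n - b^n is divisible by pn, so a factor p survives division by
-- n.
theorem norm_coeff_logCoeff_subst_sub_le (D : ℕ → Matrix ι ι ℤ_[p]) {a b : MvPowerSeries τ ℤ_[p]}
    (ha : a.constantCoeff = 0) (hb : b.constantCoeff = 0)
    (hab : (p : MvPowerSeries τ ℤ_[p]) ∣ a - b) (i j : ι) (d : τ →₀ ℕ) :
    ‖MvPowerSeries.coeff d ((logCoeff D i j).subst (toQp a) -
      (logCoeff D i j).subst (toQp b))‖ ≤ (p : ℝ)⁻¹ := by
  have ha' := PowerSeries.HasSubst.of_constantCoeff_zero (constantCoeff_toQp ha)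
  have hb' := PowerSeries.HasSubst.of_constantCoeff_zero (constantCoeff_toQp hb)
  rw [map_sub, PowerSeries.coeff_subst ha', PowerSeries.coeff_subst hb',
    ← finsum_sub_distrib (PowerSeries.coeff_subst_finite ha' _ d)
      (PowerSeries.coeff_subst_finite hb' _ d), finsum]
  -- The second case is the default value 0 of a `finsum` with infinite support.
  split_ifs with hfin
  swap
  · simp
  refine IsUltrametricDist.norm_sum_le_of_forall_le_of_nonneg (by positivity) fun n _ => ?_
  obtain ⟨c, hc⟩ := dvd_pow_sub_pow_mul hab (PLift.down n)
  rcases eq_or_ne n.down 0 with h0 | h0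
  · simp [h0]
  rw [← smul_sub, ← map_sub, ← map_pow, ← map_pow, ← map_sub, hc]
  have h1 : (((p * n.down : ℕ) : MvPowerSeries τ ℤ_[p]) * c) =
      ((p * n.down : ℕ) : ℤ_[p]) • c := by
    rw [MvPowerSeries.smul_eq_C_mul]; simp
  rw [h1, MvPowerSeries.coeff_map, MvPowerSeries.coeff_smul, logCoeff, PowerSeries.coeff_mk,
    smul_eq_mul, map_mul, map_natCast]
  have h2 : (n.down : ℚ_[p]) ≠ 0 := by exact_mod_cast h0
  have h3 : (D n.down i j : ℚ_[p]) / n.down * (((p * n.down : ℕ) : ℚ_[p]) *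
      algebraMap ℤ_[p] ℚ_[p] (MvPowerSeries.coeff d c)) =
      p * ((D n.down i j * MvPowerSeries.coeff d c : ℤ_[p]) : ℚ_[p]) := by
    push_cast
    field_simp
    rfl
  rw [h3, norm_mul, Padic.norm_p]
  exact mul_le_of_le_one_right (by positivity) (PadicInt.norm_le_one _)

theorem norm_coeff_logSubst_sub_le (D : ℕ → Matrix ι ι ℤ_[p]) {a b : ι → MvPowerSeries τ ℤ_[p]}
    (ha : ∀ j, (a j).constantCoeff = 0) (hb : ∀ j, (b j).constantCoeff = 0)
    (hab : ∀ j, (p : MvPowerSeries τ ℤ_[p]) ∣ a j - b j) (i : ι) (d : τ →₀ ℕ) :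
    ‖MvPowerSeries.coeff d (logSubst D (fun j => toQp (a j)) i -
      logSubst D (fun j => toQp (b j)) i)‖ ≤ (p : ℝ)⁻¹ := by
  rw [logSubst, logSubst, ← Finset.sum_sub_distrib, map_sum]
  exact IsUltrametricDist.norm_sum_le_of_forall_le_of_nonneg (by positivity) fun j _ =>
    norm_coeff_logCoeff_subst_sub_le D (ha j) (hb j) (hab j) i j d

end Padic
end

/-! ### Integral matrices acting on tuples. -/

noncomputable section

section MatAct

variable {p : ℕ} [Fact p.Prime] {ι V W : Type*} [Fintype ι] [AddCommGroup V] [Module ℚ_[p] V]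
  [AddCommGroup W] [Module ℚ_[p] W]

/-- The action of a matrix over `ℤ_p` on tuples of elements of a `ℚ_p`-vector space. -/
def matAct (B : Matrix ι ι ℤ_[p]) (v : ι → V) (i : ι) : V :=
  ∑ j, (B i j : ℚ_[p]) • v j

theorem matAct_mul (A B : Matrix ι ι ℤ_[p]) (v : ι → V) :
    matAct (A * B) v = matAct A (matAct B v) := by
  funext i
  simp only [matAct, Matrix.mul_apply, PadicInt.coe_sum, PadicInt.coe_mul, Finset.sum_smul,
    Finset.smul_sum, mul_smul]
  exact Finset.sum_comm

theorem matAct_one [DecidableEq ι] (v : ι → V) : matAct (1 : Matrix ι ι ℤ_[p]) v = v := by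
  funext i
  rw [matAct, Finset.sum_eq_single i]
  · simp
  · intro j _ hj
    simp [Matrix.one_apply_ne' hj]
  · simp

theorem matAct_sub_right (B : Matrix ι ι ℤ_[p]) (v w : ι → V) :
    matAct B (v - w) = matAct B v - matAct B w := by
  funext i
  simp [matAct, smul_sub]

theorem matAct_add_right (B : Matrix ι ι ℤ_[p]) (v w : ι → V) :
    matAct B (v + w) = matAct B v + matAct B w := by
  funext i
  simp [matAct, smul_add, Finset.sum_add_distrib]

theorem matAct_neg_right (B : Matrix ι ι ℤ_[p]) (v : ι → V) :
    matAct B (-v) = -matAct B v := by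
  funext i
  simp [matAct]

theorem matAct_zero_right (B : Matrix ι ι ℤ_[p]) : matAct B (0 : ι → V) = 0 := by
  funext i
  simp [matAct]

theorem matAct_add_left (A B : Matrix ι ι ℤ_[p]) (v : ι → V) :
    matAct (A + B) v = matAct A v + matAct B v := by
  funext i
  simp [matAct, add_smul, Finset.sum_add_distrib]

theorem matAct_sub_left (A B : Matrix ι ι ℤ_[p]) (v : ι → V) :
    matAct (A - B) v = matAct A v - matAct B v := by
  funext i
  simp [matAct, sub_smul, Finset.sum_sub_distrib]

theorem matAct_natCast [DecidableEq ι] (n : ℕ) (v : ι → V) :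
    matAct (n : Matrix ι ι ℤ_[p]) v = (n : ℚ_[p]) • v := by
  induction n with
  | zero => funext i; simp [matAct]
  | succ n ih => rw [Nat.cast_succ, matAct_add_left, ih, matAct_one, Nat.cast_succ, add_smul,
      one_smul]

theorem matAct_comm {A B : Matrix ι ι ℤ_[p]} (h : Commute A B) (v : ι → V) :
    matAct A (matAct B v) = matAct B (matAct A v) := by
  rw [← matAct_mul, h.eq, matAct_mul]

theorem matAct_smul_right (B : Matrix ι ι ℤ_[p]) (c : ℚ_[p]) (v : ι → V) :
    matAct B (c • v) = c • matAct B v := by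
  funext i
  simp only [matAct, Pi.smul_apply, Finset.smul_sum]
  exact Finset.sum_congr rfl fun j _ => smul_comm _ _ _

theorem map_matAct {G : Type*} [FunLike G V W] [LinearMapClass G ℚ_[p] V W] (f : G)
    (B : Matrix ι ι ℤ_[p]) (v : ι → V) (i : ι) :
    f (matAct B v i) = matAct B (fun j => f (v j)) i := by
  simp [matAct, map_sum, map_smul]

end MatAct

/-! ### Honda types. -/

section Padic

variable {p : ℕ} [Fact p.Prime] {ι τ : Type*}

/-- All coefficients of `f` lie in `p ℤ_p`. -/
def IsSmall (f : MvPowerSeries τ ℚ_[p]) : Prop :=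
  ∀ d, ‖MvPowerSeries.coeff d f‖ ≤ (p : ℝ)⁻¹

theorem IsSmall.add {f g : MvPowerSeries τ ℚ_[p]} (hf : IsSmall f) (hg : IsSmall g) :
    IsSmall (f + g) := fun d => by
  rw [map_add]
  exact (IsUltrametricDist.norm_add_le_max _ _).trans (max_le (hf d) (hg d))

theorem IsSmall.neg {f : MvPowerSeries τ ℚ_[p]} (hf : IsSmall f) : IsSmall (-f) := fun d => by
  rw [map_neg, norm_neg]
  exact hf d

theorem IsSmall.sub {f g : MvPowerSeries τ ℚ_[p]} (hf : IsSmall f) (hg : IsSmall g) :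
    IsSmall (f - g) := by
  rw [sub_eq_add_neg]
  exact hf.add hg.neg

theorem IsSmall.sum {α : Type*} {s : Finset α} {f : α → MvPowerSeries τ ℚ_[p]}
    (h : ∀ i ∈ s, IsSmall (f i)) : IsSmall (∑ i ∈ s, f i) := fun d => by
  rw [map_sum]
  exact IsUltrametricDist.norm_sum_le_of_forall_le_of_nonneg (by positivity) fun i hi => h i hi d

theorem IsSmall.smul {f : MvPowerSeries τ ℚ_[p]} (hf : IsSmall f) (c : ℤ_[p]) :
    IsSmall ((c : ℚ_[p]) • f) := fun d => by
  rw [MvPowerSeries.coeff_smul, norm_mul]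
  exact (mul_le_of_le_one_left (norm_nonneg _) c.2).trans (hf d)

theorem isSmall_smul_toQp (f : MvPowerSeries τ ℤ_[p]) : IsSmall ((p : ℚ_[p]) • toQp f) :=
  fun d => by
    rw [MvPowerSeries.coeff_smul, norm_mul, Padic.norm_p]
    exact mul_le_of_le_one_right (by positivity) (norm_coeff_toQp_le_one f d)

theorem IsSmall.matAct [Fintype ι] {h : ι → MvPowerSeries τ ℚ_[p]} (hh : ∀ i, IsSmall (h i))
    (B : Matrix ι ι ℤ_[p]) (i : ι) : IsSmall (matAct B h i) :=
  IsSmall.sum fun j _ => (hh j).smul _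

theorem natCast_dvd_of_forall_coeff {f : MvPowerSeries τ ℤ_[p]}
    (h : ∀ d, (p : ℤ_[p]) ∣ MvPowerSeries.coeff d f) : (p : MvPowerSeries τ ℤ_[p]) ∣ f := by
  choose g hg using h
  let g' : MvPowerSeries τ ℤ_[p] := fun d => g d
  refine ⟨g', ?_⟩
  ext d
  have h1 : (p : MvPowerSeries τ ℤ_[p]) = MvPowerSeries.C (p : ℤ_[p]) := by simp
  rw [h1, ← MvPowerSeries.smul_eq_C_mul, MvPowerSeries.coeff_smul]
  exact hg d

/-- Over 𝔽_p the Frobenius fixes the coefficients, so f(x^p) = f(x)^p there. -/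
theorem natCast_dvd_expand_sub_pow (f : MvPowerSeries τ ℤ_[p]) :
    (p : MvPowerSeries τ ℤ_[p]) ∣ f.expand p (Fact.out : p.Prime).ne_zero - f ^ p := by
  refine natCast_dvd_of_forall_coeff fun d => ?_
  have h : MvPowerSeries.map (PadicInt.toZMod (p := p))
      (f.expand p (Fact.out : p.Prime).ne_zero - f ^ p) = 0 := by
    rw [map_sub, MvPowerSeries.map_expand, map_pow,
      ← MvPowerSeries.map_frobenius_expand p (Fact.out : p.Prime).ne_zero, ZMod.frobenius_zmod,
      MvPowerSeries.map_id]
    simp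
  have h2 := congrArg (MvPowerSeries.coeff d) h
  rw [MvPowerSeries.coeff_map, MvPowerSeries.coeff_zero, ← RingHom.mem_ker, PadicInt.ker_toZMod,
    PadicInt.maximalIdeal_eq_span_p, Ideal.mem_span_singleton] at h2
  exact h2

variable [Fintype ι]

/-- `p h - C φ(h) + φ²(h)`, where `φ` raises the variables to the `p`-th power. -/
def hondaOp (C : Matrix ι ι ℤ_[p]) (h : ι → MvPowerSeries τ ℚ_[p]) (i : ι) :
    MvPowerSeries τ ℚ_[p] :=
  (p : ℚ_[p]) • h i -
    matAct C (fun l => (h l).expand p (Fact.out : p.Prime).ne_zero) i +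
    ((h i).expand p (Fact.out : p.Prime).ne_zero).expand p (Fact.out : p.Prime).ne_zero

/-- `h` is of type `p - C φ + φ²` in the sense of Honda. -/
def IsHonda (C : Matrix ι ι ℤ_[p]) (h : ι → MvPowerSeries τ ℚ_[p]) : Prop :=
  ∀ i, IsSmall (hondaOp C h i)

theorem IsHonda.add {C : Matrix ι ι ℤ_[p]} {g h : ι → MvPowerSeries τ ℚ_[p]}
    (hg : IsHonda C g) (hh : IsHonda C h) : IsHonda C (g + h) := fun i => by
  convert (hg i).add (hh i) using 1
  have := congrFun (matAct_add_right C
    (fun l => (g l).expand p (Fact.out : p.Prime).ne_zero)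
    (fun l => (h l).expand p (Fact.out : p.Prime).ne_zero)) i
  simp only [hondaOp, Pi.add_apply, map_add, smul_add]
  have h2 : (fun l => (g l).expand p (Fact.out : p.Prime).ne_zero +
    (h l).expand p (Fact.out : p.Prime).ne_zero) =
    (fun l => (g l).expand p (Fact.out : p.Prime).ne_zero) +
    fun l => (h l).expand p (Fact.out : p.Prime).ne_zero := rfl
  rw [h2, this, Pi.add_apply]
  abel

/-- The action of B commutes with φ because its entries are constants, and with C by hypothesis; so
it commutes with the Honda operator. -/
theorem IsHonda.matAct {C B : Matrix ι ι ℤ_[p]} (hB : Commute B C)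
    {h : ι → MvPowerSeries τ ℚ_[p]} (hh : IsHonda C h) : IsHonda C (matAct B h) := fun i => by
  convert IsSmall.matAct hh B i using 1
  have h1 : hondaOp C h = (p : ℚ_[p]) • h -
      _root_.matAct C (fun l => (h l).expand p (Fact.out : p.Prime).ne_zero) +
      fun i => ((h i).expand p (Fact.out : p.Prime).ne_zero).expand p
        (Fact.out : p.Prime).ne_zero := rfl
  rw [h1, matAct_add_right, matAct_sub_right, matAct_comm hB, matAct_smul_right]
  simp only [hondaOp, map_matAct, Pi.add_apply, Pi.sub_apply, Pi.smul_apply]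

theorem IsHonda.neg {C : Matrix ι ι ℤ_[p]} {h : ι → MvPowerSeries τ ℚ_[p]}
    (hh : IsHonda C h) : IsHonda C (-h) := by
  classical
  have : -h = _root_.matAct (-1 : Matrix ι ι ℤ_[p]) h := by
    have := matAct_sub_left (0 : Matrix ι ι ℤ_[p]) 1 h
    rw [zero_sub, matAct_one] at this
    rw [this]
    funext i
    simp [_root_.matAct]
  rw [this]
  exact hh.matAct (Commute.one_left C).neg_left

theorem IsHonda.sub {C : Matrix ι ι ℤ_[p]} {g h : ι → MvPowerSeries τ ℚ_[p]}
    (hg : IsHonda C g) (hh : IsHonda C h) : IsHonda C (g - h) := by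
  rw [sub_eq_add_neg]
  exact hg.add hh.neg

theorem expand_logSubst (D : ℕ → Matrix ι ι ℤ_[p]) {a : ι → MvPowerSeries τ ℚ_[p]}
    (ha : ∀ j, (a j).constantCoeff = 0) (i : ι) :
    (logSubst D a i).expand p (Fact.out : p.Prime).ne_zero =
      logSubst D (fun j => (a j).expand p (Fact.out : p.Prime).ne_zero) i := by
  have hX := MvPowerSeries.HasSubst.X_pow (σ := τ) (S := ℚ_[p]) (Fact.out : p.Prime).ne_zero
  rw [MvPowerSeries.expand, MvPowerSeries.coe_substAlgHom]
  exact subst_logSubst D ha hX i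

/-- The logarithm `∑ (D n / n) X ^ n` has an invertible linear part and is of type
`p - C φ + φ²` in the sense of Honda. -/
structure HondaType [DecidableEq ι] (C : Matrix ι ι ℤ_[p]) (D : ℕ → Matrix ι ι ℤ_[p]) : Prop where
  isUnit : IsUnit (D 1)
  small : ∀ i j n, ‖PowerSeries.coeff n ((p : ℚ_[p]) • logCoeff D i j -
    ∑ l, (C i l : ℚ_[p]) • (logCoeff D l j).subst (PowerSeries.X ^ p : PowerSeries ℚ_[p]) +
    (logCoeff D i j).subst (PowerSeries.X ^ (p ^ 2) : PowerSeries ℚ_[p]))‖ ≤ (p : ℝ)⁻¹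

end Padic
end

/-! ### Honda's functional equation lemma. -/

noncomputable section
section Padic

variable {p : ℕ} [Fact p.Prime] {ι τ : Type*} [Fintype ι]

theorem logSubst_pow (D : ℕ → Matrix ι ι ℤ_[p]) {a : ι → MvPowerSeries τ ℚ_[p]}
    (ha : ∀ j, (a j).constantCoeff = 0) {n : ℕ} (hn : n ≠ 0) (i : ι) :
    logSubst D (fun j => a j ^ n) i = ∑ j, PowerSeries.subst (a j) ((logCoeff D i j).subst
      (PowerSeries.X ^ n : PowerSeries ℚ_[p])) := by
  refine Finset.sum_congr rfl fun j _ => ?_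
  have ha' := PowerSeries.HasSubst.of_constantCoeff_zero (ha j)
  rw [PowerSeries.subst_comp_subst_apply (PowerSeries.HasSubst.X_pow hn) ha',
    PowerSeries.subst_pow ha', PowerSeries.subst_X ha']

theorem le_order_matAct {v : ι → MvPowerSeries τ ℚ_[p]} {n : ℕ∞} (hv : ∀ j, n ≤ (v j).order)
    (B : Matrix ι ι ℤ_[p]) (i : ι) : n ≤ (matAct B v i).order :=
  MvPowerSeries.le_order_sum fun j _ => (hv j).trans MvPowerSeries.le_order_smul

variable [DecidableEq ι]

/-- A Honda logarithm takes integral tuples to tuples of the same type. -/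
theorem HondaType.isHonda {C : Matrix ι ι ℤ_[p]} {D : ℕ → Matrix ι ι ℤ_[p]}
    (hD : HondaType C D) {a : ι → MvPowerSeries τ ℤ_[p]} (ha : ∀ j, (a j).constantCoeff = 0) :
    IsHonda C (logSubst D fun j => toQp (a j)) := by
  have hp0 := (Fact.out : p.Prime).ne_zero
  have ha' := fun j => constantCoeff_toQp (ha j)
  have hpow0 : ∀ {n : ℕ}, n ≠ 0 → ∀ j, (a j ^ n).constantCoeff = 0 := fun hn j => by
    rw [map_pow, ha j, zero_pow hn]
  have hexp : ∀ j, ((a j).expand p hp0).constantCoeff = 0 := fun j => by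
    rw [MvPowerSeries.constantCoeff_expand, ha j]
  have hexp2 : ∀ j, (((a j).expand p hp0).expand p hp0).constantCoeff = 0 := fun j => by
    rw [MvPowerSeries.constantCoeff_expand, hexp j]
  have e1 : ∀ i, (logSubst D (fun j => toQp (a j)) i).expand p hp0 =
      logSubst D (fun j => toQp ((a j).expand p hp0)) i := fun i => by
    rw [expand_logSubst D ha' i]
    simp only [MvPowerSeries.map_expand]
  have e2 : ∀ i, ((logSubst D (fun j => toQp (a j)) i).expand p hp0).expand p hp0 =
      logSubst D (fun j => toQp (((a j).expand p hp0).expand p hp0)) i := fun i => by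
    rw [e1, expand_logSubst D (fun j => constantCoeff_toQp (hexp j)) i]
    simp only [MvPowerSeries.map_expand]
  -- Modulo p, φ(a) may be replaced by a^p and φ²(a) by a^(p²); the logarithm turns these changes
  -- into errors divisible by p.
  have s1 : ∀ i, IsSmall (logSubst D (fun j => toQp ((a j).expand p hp0)) i -
      logSubst D (fun j => toQp (a j ^ p)) i) := fun i =>
    norm_coeff_logSubst_sub_le D hexp (hpow0 hp0) (fun j => natCast_dvd_expand_sub_pow _) i
  have s2 : ∀ i, IsSmall (logSubst D (fun j => toQp (((a j).expand p hp0).expand p hp0)) i -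
      logSubst D (fun j => toQp (a j ^ (p ^ 2))) i) := fun i =>
    norm_coeff_logSubst_sub_le D hexp2 (hpow0 (pow_ne_zero 2 hp0)) (fun j => by
      have h1 := natCast_dvd_expand_sub_pow ((a j).expand p hp0)
      have h2 := (natCast_dvd_expand_sub_pow (a j)).trans (sub_dvd_pow_sub_pow _ _ p)
      have h3 := dvd_add h1 h2
      rwa [sub_add_sub_cancel, ← pow_mul, ← sq] at h3) i
  have s3 : ∀ i, IsSmall ((p : ℚ_[p]) • logSubst D (fun j => toQp (a j)) i -
      matAct C (logSubst D (fun j => toQp (a j ^ p))) i +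
      logSubst D (fun j => toQp (a j ^ (p ^ 2))) i) := by
    intro i
    have h1 := logSubst_pow D ha' hp0
    have h2 := logSubst_pow D ha' (pow_ne_zero 2 hp0) i
    simp only [← map_pow] at h1 h2
    rw [h2]
    simp only [matAct, h1]
    rw [logSubst, Finset.smul_sum]
    simp only [Finset.smul_sum]
    rw [Finset.sum_comm, ← Finset.sum_sub_distrib, ← Finset.sum_add_distrib]
    refine IsSmall.sum fun j _ => ?_
    have hs := PowerSeries.HasSubst.of_constantCoeff_zero (ha' j)
    -- The one-variable defect of the Honda relation is p times an integral series w, and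
    -- substituting the integral a_j into w stays integral.
    obtain ⟨w, hw⟩ := exists_smul_toQp_eq (σ := Unit) (p := p) (f := (p : ℚ_[p]) • logCoeff D i j -
      ∑ l, (C i l : ℚ_[p]) • (logCoeff D l j).subst (PowerSeries.X ^ p : PowerSeries ℚ_[p]) +
      (logCoeff D i j).subst (PowerSeries.X ^ (p ^ 2) : PowerSeries ℚ_[p])) fun d => by
        have := hD.small i j (d ())
        have hd : d = Finsupp.single () (d ()) := by
          ext
          simp
        rw [hd]
        exact this
    have key := congrArg (PowerSeries.subst (toQp (a j))) hw
    rw [PowerSeries.subst_add hs, PowerSeries.subst_sub hs, PowerSeries.subst_smul hs,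
      ← PowerSeries.coe_substAlgHom hs, map_sum] at key
    simp only [map_smul] at key
    rw [PowerSeries.coe_substAlgHom hs] at key
    rw [key]
    have : PowerSeries.subst (toQp (a j)) (toQp w) = toQp (PowerSeries.subst (a j) w) :=
      (PowerSeries.map_subst (PowerSeries.HasSubst.of_constantCoeff_zero (ha j)) w).symm
    rw [this]
    exact isSmall_smul_toQp _
  intro i
  have e3 : hondaOp C (logSubst D fun j => toQp (a j)) i =
      ((p : ℚ_[p]) • logSubst D (fun j => toQp (a j)) i -
      matAct C (logSubst D (fun j => toQp (a j ^ p))) i +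
      logSubst D (fun j => toQp (a j ^ (p ^ 2))) i) -
      matAct C (logSubst D (fun j => toQp ((a j).expand p hp0)) -
        logSubst D (fun j => toQp (a j ^ p))) i +
      (logSubst D (fun j => toQp (((a j).expand p hp0).expand p hp0)) i -
      logSubst D (fun j => toQp (a j ^ (p ^ 2))) i) := by
    rw [hondaOp, e2, matAct_sub_right, Pi.sub_apply]
    simp only [e1]
    abel
  rw [e3]
  exact ((s3 i).sub (IsSmall.matAct s1 C i)).add (s2 i)

/-- If a - b has order at least n, the logarithms differ by D 1 (a - b) up to order n + 1; equality
of logarithms thus raises the order of a - b by one, indefinitely. -/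
theorem logSubst_injective {D : ℕ → Matrix ι ι ℤ_[p]} (hD : IsUnit (D 1))
    {a b : ι → MvPowerSeries τ ℚ_[p]} (ha : ∀ j, (a j).constantCoeff = 0)
    (hb : ∀ j, (b j).constantCoeff = 0) (h : ∀ i, logSubst D a i = logSubst D b i) : a = b := by
  obtain ⟨E, hE⟩ := hD.exists_left_inv
  have key : ∀ n : ℕ, ∀ j, (n : ℕ∞) ≤ (a j - b j).order := by
    intro n
    induction n with
    | zero => simp
    | succ n ih =>
      have h1 : ∀ i, ((n + 1 : ℕ) : ℕ∞) ≤ (matAct (D 1) (a - b) i).order := fun i => by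
        have := le_order_logSubst_sub D ha hb ih i
        rw [h i, sub_self, zero_sub, MvPowerSeries.order_neg] at this
        exact_mod_cast this
      have h2 := le_order_matAct h1 E
      rw [← matAct_mul, hE, matAct_one] at h2
      exact h2
  funext j
  have : (a j - b j).order = ⊤ := ENat.eq_top_iff_forall_ge.2 fun n => key n j
  rwa [MvPowerSeries.order_eq_top_iff, sub_eq_zero] at this

theorem exists_logSubst_eq {D : ℕ → Matrix ι ι ℤ_[p]} (hD : IsUnit (D 1))
    {h : ι → MvPowerSeries τ ℚ_[p]} (hh : ∀ j, (h j).constantCoeff = 0) :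
    ∃ a : ι → MvPowerSeries τ ℚ_[p], (∀ j, (a j).constantCoeff = 0) ∧ logSubst D a = h := by
  obtain ⟨E, hE⟩ := hD.exists_right_inv
  -- Newton iteration with the constant inverse E of the linear part. Each step improves the order
  -- of the error by one.
  let s : ℕ → ι → MvPowerSeries τ ℚ_[p] := fun n =>
    Nat.rec 0 (fun _ a => a + matAct E (h - logSubst D a)) n
  have hs : ∀ n, s (n + 1) = s n + matAct E (h - logSubst D (s n)) := fun n => rfl
  have h0 : ∀ n j, (s n j).constantCoeff = 0 := by
    intro n
    induction n with
    | zero => intro j; exact map_zero _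
    | succ n ih =>
      intro j
      rw [hs, Pi.add_apply, map_add, ih j, zero_add, matAct, map_sum]
      refine Finset.sum_eq_zero fun l _ => ?_
      rw [← MvPowerSeries.coeff_zero_eq_constantCoeff_apply, MvPowerSeries.coeff_smul,
        Pi.sub_apply, MvPowerSeries.coeff_zero_eq_constantCoeff_apply, map_sub, hh,
        constantCoeff_logSubst D ih, sub_zero, mul_zero]
  have hstep : ∀ n : ℕ, (∀ i, ((n + 1 : ℕ) : ℕ∞) ≤ (h i - logSubst D (s n) i).order) →
      ∀ j, ((n + 1 : ℕ) : ℕ∞) ≤ (s (n + 1) j - s n j).order := fun n hn j => by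
    rw [hs, Pi.add_apply, add_sub_cancel_left]
    exact le_order_matAct hn E j
  have hord : ∀ n : ℕ, ∀ i, ((n + 1 : ℕ) : ℕ∞) ≤ (h i - logSubst D (s n) i).order := by
    intro n
    induction n with
    | zero =>
      intro i
      refine MvPowerSeries.one_le_order ?_
      rw [map_sub, hh, constantCoeff_logSubst D (h0 0), sub_zero]
    | succ n ih =>
      intro i
      have h1 := le_order_logSubst_sub D (h0 (n + 1)) (h0 n) (hstep n ih) i
      have h2 : matAct (D 1) (s (n + 1) - s n) i = h i - logSubst D (s n) i := by
        rw [hs, add_sub_cancel_left, ← matAct_mul, hE, matAct_one]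
        rfl
      have h3 : ∑ j, (D 1 i j : ℚ_[p]) • (s (n + 1) j - s n j) =
        matAct (D 1) (s (n + 1) - s n) i := rfl
      rw [h3, h2] at h1
      have h4 : h i - logSubst D (s (n + 1)) i = -(logSubst D (s (n + 1)) i -
          logSubst D (s n) i - (h i - logSubst D (s n) i)) := by abel
      rw [h4, MvPowerSeries.order_neg]
      exact h1
  have hmono : ∀ n m : ℕ, n ≤ m → ∀ j, ((n + 1 : ℕ) : ℕ∞) ≤ (s m j - s n j).order := by
    intro n m hnm
    induction m, hnm using Nat.le_induction with
    | base => intro j; simp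
    | succ m hnm ih =>
      intro j
      rw [← sub_add_sub_cancel _ (s m j)]
      refine MvPowerSeries.le_order_add_of_le (le_trans ?_ (hstep m (hord m) j)) (ih j)
      exact_mod_cast Nat.succ_le_succ hnm
  -- The limit of the iterates: coefficients of degree at most n no longer change after the n-th
  -- iterate.
  let a : ι → MvPowerSeries τ ℚ_[p] := fun j d => MvPowerSeries.coeff d (s d.degree j)
  have has : ∀ n : ℕ, ∀ j, ((n + 1 : ℕ) : ℕ∞) ≤ (a j - s n j).order := by
    intro n j
    refine MvPowerSeries.le_order fun d hd => ?_
    have hd' : d.degree < n + 1 := by exact_mod_cast hd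
    have h1 := MvPowerSeries.coeff_of_lt_order (f := s n j - s d.degree j) (d := d)
      (lt_of_lt_of_le (by exact_mod_cast Nat.lt_succ_self _)
        (hmono d.degree n (Nat.lt_succ_iff.1 hd') j))
    rw [map_sub, sub_eq_zero] at h1
    rw [map_sub, h1, sub_eq_zero]
    rfl
  have ha0 : ∀ j, (a j).constantCoeff = 0 := fun j => by
    rw [← MvPowerSeries.coeff_zero_eq_constantCoeff_apply]
    change MvPowerSeries.coeff 0 (s (Finsupp.degree (0 : τ →₀ ℕ)) j) = 0
    rw [MvPowerSeries.coeff_zero_eq_constantCoeff_apply, h0]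
  refine ⟨a, ha0, ?_⟩
  funext i
  refine (sub_eq_zero.1 ?_).symm
  rw [← MvPowerSeries.order_eq_top_iff]
  refine ENat.eq_top_iff_forall_ge.2 fun n => ?_
  have h1 := le_order_logSubst_sub D ha0 (h0 n) (has n) i
  have h2 := le_order_matAct (v := a - s n) (has n) (D 1) i
  have h3 := hord n i
  have h4 : h i - logSubst D a i = (h i - logSubst D (s n) i) -
      (logSubst D a i - logSubst D (s n) i - ∑ j, (D 1 i j : ℚ_[p]) • (a j - s n j)) -
      matAct (D 1) (a - s n) i := by
    have : ∑ j, (D 1 i j : ℚ_[p]) • (a j - s n j) = matAct (D 1) (a - s n) i := rfl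
    rw [this]
    abel
  rw [h4]
  refine le_trans (b := ((n + 1 : ℕ) : ℕ∞)) (by exact_mod_cast Nat.le_succ n) ?_
  exact MvPowerSeries.le_order_sub_of_le (MvPowerSeries.le_order_sub_of_le h3
    (le_trans le_self_add h1)) h2

omit [DecidableEq ι] in
-- The substitution φ multiplies orders by p, so in the lowest degree n > 0 only the term p h
-- survives.
theorem coeff_hondaOp (C : Matrix ι ι ℤ_[p]) {h : ι → MvPowerSeries τ ℚ_[p]} {n : ℕ} (hn : n ≠ 0)
    (hh : ∀ j, (n : ℕ∞) ≤ (h j).order) (i : ι) {d : τ →₀ ℕ} (hd : d.degree = n) :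
    MvPowerSeries.coeff d (hondaOp C h i) = p * MvPowerSeries.coeff d (h i) := by
  have hp := (Fact.out : p.Prime)
  have h1 : ∀ f : MvPowerSeries τ ℚ_[p], (n : ℕ∞) ≤ f.order →
      ((n + 1 : ℕ) : ℕ∞) ≤ (f.expand p hp.ne_zero).order := fun f hf => by
    rw [MvPowerSeries.order_expand]
    calc ((n + 1 : ℕ) : ℕ∞) ≤ ((p • n : ℕ) : ℕ∞) := by
          have := hp.two_le
          exact_mod_cast (show n + 1 ≤ p * n by nlinarith [Nat.pos_of_ne_zero hn])
      _ = p • (n : ℕ∞) := by simp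
      _ ≤ p • f.order := nsmul_le_nsmul_right hf p
  have h2 : ∀ f : MvPowerSeries τ ℚ_[p], ((n + 1 : ℕ) : ℕ∞) ≤ f.order →
      MvPowerSeries.coeff d f = 0 := fun f hf => by
    refine MvPowerSeries.coeff_of_lt_order (lt_of_lt_of_le ?_ hf)
    rw [hd]
    exact_mod_cast Nat.lt_succ_self n
  rw [hondaOp, map_add, map_sub, MvPowerSeries.coeff_smul,
    h2 _ (le_order_matAct (fun j => h1 _ (hh j)) C i),
    h2 _ (h1 _ (le_trans (by exact_mod_cast Nat.le_succ n) (h1 _ (hh i)))), sub_zero, add_zero]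

/-- If a Honda logarithm takes `a` to a tuple of the same type, then `a` is integral. -/
theorem HondaType.exists_toQp_eq {C : Matrix ι ι ℤ_[p]} {D : ℕ → Matrix ι ι ℤ_[p]}
    (hD : HondaType C D) {a : ι → MvPowerSeries τ ℚ_[p]} (ha : ∀ j, (a j).constantCoeff = 0)
    (h : IsHonda C (logSubst D a)) :
    ∃ b : ι → MvPowerSeries τ ℤ_[p], (∀ j, (b j).constantCoeff = 0) ∧ ∀ j, toQp (b j) = a j := by
  classical
  obtain ⟨E, hE⟩ := hD.isUnit.exists_left_inv
  have hp : (0 : ℝ) < p := by exact_mod_cast (Fact.out : p.Prime).pos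
  have key : ∀ n : ℕ, ∀ d : τ →₀ ℕ, d.degree < n → ∀ j, ‖MvPowerSeries.coeff d (a j)‖ ≤ 1 := by
    intro n
    induction n with
    | zero => intro d hd; omega
    | succ n ih =>
      intro d hd j
      rcases Nat.lt_succ_iff_lt_or_eq.1 hd with hd | hd
      · exact ih d hd j
      rcases eq_or_ne n 0 with rfl | hn
      · rw [(Finsupp.degree_eq_zero_iff d).1 hd, MvPowerSeries.coeff_zero_eq_constantCoeff_apply,
          ha]
        simp
      -- The truncation of a below degree n is integral by induction, so its logarithm has the Honda
      -- type. The difference of logarithms then has this type too, starts in degree n, and equals D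
      -- 1 (a - b') there.
      let b' : ι → MvPowerSeries τ ℚ_[p] := fun j d =>
        if d.degree < n then MvPowerSeries.coeff d (a j) else 0
      have hb' : ∀ j d, MvPowerSeries.coeff d (b' j) =
        if d.degree < n then MvPowerSeries.coeff d (a j) else 0 := fun j d => rfl
      have hb0 : ∀ j, (b' j).constantCoeff = 0 := fun j => by
        rw [← MvPowerSeries.coeff_zero_eq_constantCoeff_apply, hb',
          MvPowerSeries.coeff_zero_eq_constantCoeff_apply, ha, ite_self]
      choose b hb using fun j => _root_.exists_toQp_eq (f := b' j) fun d => by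
        rw [hb']
        split_ifs with hd
        · exact ih d hd j
        · simp
      have hab : ∀ j, (n : ℕ∞) ≤ (a j - b' j).order := fun j => by
        refine MvPowerSeries.le_order fun d hd => ?_
        rw [map_sub, hb', if_pos (by exact_mod_cast hd), sub_self]
      have hH : IsHonda C (logSubst D a - logSubst D b') := by
        refine h.sub ?_
        have := hD.isHonda (a := b) fun j => constantCoeff_of_toQp (by rw [hb, hb0])
        simpa only [hb] using this
      have hord := le_order_logSubst_sub D ha hb0 hab
      have hδ : ∀ i, (n : ℕ∞) ≤ ((logSubst D a - logSubst D b') i).order := fun i => by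
        have h1 := MvPowerSeries.le_order_add_of_le (le_trans le_self_add (hord i))
          (le_order_matAct (v := a - b') hab (D 1) i)
        have h2 : ∑ j, (D 1 i j : ℚ_[p]) • (a j - b' j) = matAct (D 1) (a - b') i := rfl
        rwa [h2, sub_add_cancel] at h1
      have h1 : ∀ i, ‖MvPowerSeries.coeff d (matAct (D 1) (a - b') i)‖ ≤ 1 := fun i => by
        -- In degree n the Honda operator is multiplication by p, so smallness of its value means
        -- integrality of the coefficient itself.
        have h2 := hH i d
        rw [coeff_hondaOp C hn hδ i hd, norm_mul, Padic.norm_p] at h2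
        have h3 : ‖MvPowerSeries.coeff d ((logSubst D a - logSubst D b') i)‖ ≤ 1 := by
          by_contra hlt
          push Not at hlt
          have := mul_lt_mul_of_pos_left hlt (inv_pos.2 hp)
          linarith
        have h4 := MvPowerSeries.coeff_of_lt_order (d := d) (lt_of_lt_of_le
          (by rw [hd]; exact_mod_cast Nat.lt_succ_self n) (hord i))
        rw [map_sub, sub_eq_zero] at h4
        have h5 : ∑ j, (D 1 i j : ℚ_[p]) • (a j - b' j) = matAct (D 1) (a - b') i := rfl
        rw [← h5, ← h4]
        exact h3
      have h6 : MvPowerSeries.coeff d (a j) =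
          ∑ i, (E j i : ℚ_[p]) * MvPowerSeries.coeff d (matAct (D 1) (a - b') i) := by
        have h7 : a j - b' j = matAct E (matAct (D 1) (a - b')) j := by
          rw [← matAct_mul, hE, matAct_one]; rfl
        have h8 := congrArg (MvPowerSeries.coeff d) h7
        rw [map_sub, hb', if_neg (by omega), sub_zero] at h8
        rw [h8, matAct, map_sum]
        rfl
      rw [h6]
      refine IsUltrametricDist.norm_sum_le_of_forall_le_of_nonneg zero_le_one fun i _ => ?_
      rw [norm_mul]
      exact mul_le_one₀ (PadicInt.norm_le_one _) (norm_nonneg _) (h1 i)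
  choose b hb using fun j => _root_.exists_toQp_eq (f := a j) fun d =>
    key (d.degree + 1) d (Nat.lt_succ_self _) j
  exact ⟨b, fun j => constantCoeff_of_toQp (by rw [hb, ha]), hb⟩

end Padic
end

/-! ### Formal groups and homomorphisms attached to a Honda type. -/

noncomputable section
section Padic

variable {p : ℕ} [Fact p.Prime] {ι τ σ : Type*} [Fintype ι]

theorem logSubst_zero (D : ℕ → Matrix ι ι ℤ_[p]) :
    logSubst D (0 : ι → MvPowerSeries τ ℚ_[p]) = 0 := by
  funext i
  exact Finset.sum_eq_zero fun j _ =>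
    PowerSeries.subst_zero_of_constantCoeff_zero (logCoeff_zero D i j)

theorem hasSubst_toQp [Finite σ] {c : σ → MvPowerSeries τ ℤ_[p]}
    (hc : ∀ s, (c s).constantCoeff = 0) : MvPowerSeries.HasSubst fun s => toQp (c s) :=
  MvPowerSeries.hasSubst_of_constantCoeff_zero fun s => constantCoeff_toQp (hc s)

theorem logSubst_toQp_subst [Finite σ] (D : ℕ → Matrix ι ι ℤ_[p])
    {b : ι → MvPowerSeries σ ℤ_[p]} (hb : ∀ j, (b j).constantCoeff = 0)
    {c : σ → MvPowerSeries τ ℤ_[p]} (hc : ∀ s, (c s).constantCoeff = 0) (i : ι) :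
    logSubst D (fun j => toQp ((b j).subst c)) i =
      (logSubst D (fun j => toQp (b j)) i).subst fun s => toQp (c s) := by
  rw [subst_logSubst D (fun j => constantCoeff_toQp (hb j)) (hasSubst_toQp hc)]
  congr 1
  funext j
  exact toQp_subst (MvPowerSeries.hasSubst_of_constantCoeff_zero hc) _

theorem logSubst_X_subst [Finite σ] (D : ℕ → Matrix ι ι ℤ_[p]) (u : ι → σ)
    {c : σ → MvPowerSeries τ ℚ_[p]} (hc : ∀ s, (c s).constantCoeff = 0) (i : ι) :
    (logSubst D (fun j => MvPowerSeries.X (u j)) i).subst c = logSubst D (fun j => c (u j)) i := by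
  have hc' := MvPowerSeries.hasSubst_of_constantCoeff_zero hc
  rw [subst_logSubst D (fun j => by simp) hc']
  congr 1
  funext j
  exact MvPowerSeries.subst_X hc' _

/-- `f(x, y) = ℓ⁻¹(ℓ(x) + ℓ(y))` for the logarithm `ℓ` with coefficients `D n / n`. -/
def HasLog (D : ℕ → Matrix ι ι ℤ_[p]) (f : ι → MvPowerSeries (ι ⊕ ι) ℤ_[p]) : Prop :=
  ∀ i, logSubst D (fun j => toQp (f j)) i =
    logSubst D (fun j => MvPowerSeries.X (Sum.inl j)) i +
      logSubst D (fun j => MvPowerSeries.X (Sum.inr j)) i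

omit [Fintype ι] in
theorem constantCoeff_elim {x y : ι → MvPowerSeries τ ℤ_[p]}
    (hx : ∀ j, (x j).constantCoeff = 0) (hy : ∀ j, (y j).constantCoeff = 0) :
    ∀ s, MvPowerSeries.constantCoeff (Sum.elim x y s) = 0 := by
  rintro (j | j)
  exacts [hx j, hy j]

theorem HasLog.logSubst_subst {D : ℕ → Matrix ι ι ℤ_[p]}
    {f : ι → MvPowerSeries (ι ⊕ ι) ℤ_[p]} (hf : HasLog D f)
    (hf0 : ∀ j, (f j).constantCoeff = 0) {x y : ι → MvPowerSeries τ ℤ_[p]}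
    (hx : ∀ j, (x j).constantCoeff = 0) (hy : ∀ j, (y j).constantCoeff = 0) (i : ι) :
    logSubst D (fun j => toQp ((f j).subst (Sum.elim x y))) i =
      logSubst D (fun j => toQp (x j)) i + logSubst D (fun j => toQp (y j)) i := by
  have hxy := constantCoeff_elim hx hy
  rw [logSubst_toQp_subst D hf0 hxy, hf, MvPowerSeries.subst_add (hasSubst_toQp hxy),
    logSubst_X_subst D _ fun s => constantCoeff_toQp (hxy s),
    logSubst_X_subst D _ fun s => constantCoeff_toQp (hxy s)]
  rfl

theorem constantCoeff_subst_of_zero [Finite σ] {f : MvPowerSeries σ ℤ_[p]}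
    (hf : f.constantCoeff = 0) {c : σ → MvPowerSeries τ ℤ_[p]}
    (hc : ∀ s, (c s).constantCoeff = 0) : (f.subst c).constantCoeff = 0 :=
  MvPowerSeries.constantCoeff_subst_eq_zero
    (MvPowerSeries.hasSubst_of_constantCoeff_zero hc) hc hf

variable [DecidableEq ι]

/-- Injectivity of the logarithm lets identities between integral tuples be tested on logarithms. -/
theorem HondaType.toQp_ext {C : Matrix ι ι ℤ_[p]} {D : ℕ → Matrix ι ι ℤ_[p]}
    (hD : HondaType C D) {a b : ι → MvPowerSeries τ ℤ_[p]} (ha : ∀ j, (a j).constantCoeff = 0)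
    (hb : ∀ j, (b j).constantCoeff = 0)
    (h : ∀ i, logSubst D (fun j => toQp (a j)) i = logSubst D (fun j => toQp (b j)) i) (i : ι) :
    a i = b i :=
  toQp_injective (congrFun (logSubst_injective hD.isUnit (fun j => constantCoeff_toQp (ha j))
    (fun j => constantCoeff_toQp (hb j)) h) i)

/-- The functional equation lemma in usable form: solve over ℚ_p, then observe that the solution is
integral. Group laws, inverses and homomorphisms are all produced by it. -/
theorem HondaType.exists_logSubst_toQp_eq {C : Matrix ι ι ℤ_[p]} {D : ℕ → Matrix ι ι ℤ_[p]}
    (hD : HondaType C D) {h : ι → MvPowerSeries τ ℚ_[p]} (hh0 : ∀ j, (h j).constantCoeff = 0)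
    (hh : IsHonda C h) : ∃ b : ι → MvPowerSeries τ ℤ_[p], (∀ j, (b j).constantCoeff = 0) ∧
      logSubst D (fun j => toQp (b j)) = h := by
  obtain ⟨a, ha, rfl⟩ := exists_logSubst_eq hD.isUnit hh0
  obtain ⟨b, hb, hba⟩ := hD.exists_toQp_eq ha hh
  refine ⟨b, hb, ?_⟩
  congr 1
  funext j
  exact hba j

theorem HondaType.isHonda_X {C : Matrix ι ι ℤ_[p]} {D : ℕ → Matrix ι ι ℤ_[p]}
    (hD : HondaType C D) (u : ι → τ) :
    IsHonda C (logSubst D fun j => (MvPowerSeries.X (u j) : MvPowerSeries τ ℚ_[p])) := by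
  have := hD.isHonda (a := fun j => (MvPowerSeries.X (u j) : MvPowerSeries τ ℤ_[p])) (by simp)
  simpa only [toQp_X] using this

/-- The formal group law of a Honda logarithm. -/
theorem HondaType.exists_formalGroupLaw {C : Matrix ι ι ℤ_[p]} {D : ℕ → Matrix ι ι ℤ_[p]}
    (hD : HondaType C D) : ∃ F : FormalGroupLaw ι ℤ_[p], HasLog D F.add := by
  obtain ⟨f, hf0, hf⟩ := hD.exists_logSubst_toQp_eq
    (h := logSubst D (fun j => (MvPowerSeries.X (Sum.inl j) : MvPowerSeries (ι ⊕ ι) ℚ_[p])) +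
      logSubst D (fun j => MvPowerSeries.X (Sum.inr j)))
    (fun j => by
      rw [Pi.add_apply, map_add, constantCoeff_logSubst D (by simp),
        constantCoeff_logSubst D (by simp), add_zero])
    ((hD.isHonda_X Sum.inl).add (hD.isHonda_X Sum.inr))
  obtain ⟨n, hn0, hn⟩ := hD.exists_logSubst_toQp_eq
    (h := -logSubst D (fun j => (MvPowerSeries.X j : MvPowerSeries ι ℚ_[p])))
    (fun j => by
      rw [Pi.neg_apply, map_neg, constantCoeff_logSubst D (by simp), neg_zero])
    (hD.isHonda_X id).neg
  have hlog : HasLog D f := fun i => congrFun hf i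
  have hX : ∀ {σ : Type _} (u : ι → σ) (j : ι),
      (MvPowerSeries.X (u j) : MvPowerSeries σ ℤ_[p]).constantCoeff = 0 := by simp
  have hX1 : ∀ j : ι, (MvPowerSeries.X j : MvPowerSeries ι ℤ_[p]).constantCoeff = 0 := by simp
  have h0 : ∀ j : ι, ((0 : ι → MvPowerSeries ι ℤ_[p]) j).constantCoeff = 0 := by simp
  have hz : (fun j => toQp ((0 : ι → MvPowerSeries ι ℤ_[p]) j)) = 0 := by
    funext j
    exact map_zero _
  -- On logarithms the four axioms become identities in an additive group.
  refine ⟨⟨f, n, hf0, hn0, ?_, ?_, ?_, ?_⟩, hlog⟩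
  · refine hD.toQp_ext (a := fun i => (f i).subst (Sum.elim MvPowerSeries.X 0))
      (fun j => constantCoeff_subst_of_zero (hf0 j) (constantCoeff_elim (hX id) h0))
      (hX id) fun i => ?_
    rw [hlog.logSubst_subst hf0 hX1 h0, hz, logSubst_zero, Pi.zero_apply, add_zero]
  · refine hD.toQp_ext (a := fun i => (f i).subst _)
      (fun j => constantCoeff_subst_of_zero (hf0 j) (constantCoeff_elim (hX _) (hX _)))
      hf0 fun i => ?_
    rw [hlog.logSubst_subst hf0 (hX _) (hX _), hlog i, add_comm]
    simp only [toQp_X]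
  · have h3 : ∀ u v : ι → ι ⊕ (ι ⊕ ι), ∀ j, ((f j).subst
        (Sum.elim (fun l => MvPowerSeries.X (u l)) (fun l => MvPowerSeries.X (v l)) :
          ι ⊕ ι → MvPowerSeries (ι ⊕ (ι ⊕ ι)) ℤ_[p])).constantCoeff = 0 := fun u v j =>
      constantCoeff_subst_of_zero (hf0 j) (constantCoeff_elim (hX _) (hX _))
    refine hD.toQp_ext (a := fun i => (f i).subst _) (b := fun i => (f i).subst _)
      (fun j => constantCoeff_subst_of_zero (hf0 j) (constantCoeff_elim (h3 _ _) (hX _)))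
      (fun j => constantCoeff_subst_of_zero (hf0 j) (constantCoeff_elim (hX _) (h3 _ _)))
      fun i => ?_
    rw [hlog.logSubst_subst hf0 (h3 _ _) (hX _), hlog.logSubst_subst hf0 (hX _) (h3 _ _),
      hlog.logSubst_subst hf0 (hX _) (hX _), hlog.logSubst_subst hf0 (hX _) (hX _), add_assoc]
  · refine hD.toQp_ext (a := fun i => (f i).subst _) (b := 0)
      (fun j => constantCoeff_subst_of_zero (hf0 j) (constantCoeff_elim (hX id) hn0))
      h0 fun i => ?_
    rw [hlog.logSubst_subst hf0 hX1 hn0, hn, hz, logSubst_zero]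
    simp only [toQp_X]
    exact add_neg_cancel _

/-- A matrix commuting with the Honda type defines a homomorphism of formal group laws. -/
theorem HondaType.exists_hom {C : Matrix ι ι ℤ_[p]} {D D' : ℕ → Matrix ι ι ℤ_[p]}
    (hD : HondaType C D) (hD' : HondaType C D') {F G : FormalGroupLaw ι ℤ_[p]}
    (hF : HasLog D F.add) (hG : HasLog D' G.add) {B : Matrix ι ι ℤ_[p]} (hB : Commute B C) :
    ∃ φ : F.Hom G, logSubst D' (fun j => toQp (φ.series j)) =
      matAct B (logSubst D MvPowerSeries.X) := by
  obtain ⟨s, hs0, hs⟩ := hD'.exists_logSubst_toQp_eq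
    (h := matAct B (logSubst D (MvPowerSeries.X : ι → MvPowerSeries ι ℚ_[p])))
    (fun j => by
      rw [matAct, map_sum]
      refine Finset.sum_eq_zero fun l _ => ?_
      rw [← MvPowerSeries.coeff_zero_eq_constantCoeff_apply, MvPowerSeries.coeff_smul,
        MvPowerSeries.coeff_zero_eq_constantCoeff_apply, constantCoeff_logSubst D (by simp),
        mul_zero])
    ((hD.isHonda_X id).matAct hB)
  have hX : ∀ {σ : Type _} (u : ι → σ) (j : ι),
      (MvPowerSeries.X (u j) : MvPowerSeries σ ℤ_[p]).constantCoeff = 0 := by simp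
  have key : ∀ {σ : Type _} (c : ι → MvPowerSeries σ ℤ_[p]),
      (∀ j, (c j).constantCoeff = 0) → ∀ i, logSubst D' (fun j => toQp ((s j).subst c)) i =
        matAct B (logSubst D fun j => toQp (c j)) i := by
    intro σ c hc i
    rw [logSubst_toQp_subst D' hs0 hc, hs, ← MvPowerSeries.coe_substAlgHom (hasSubst_toQp hc),
      map_matAct]
    congr 1
    funext j
    rw [MvPowerSeries.coe_substAlgHom]
    exact logSubst_X_subst D id (fun s => constantCoeff_toQp (hc s)) j
  refine ⟨⟨s, hs0, ?_⟩, hs⟩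
  have h3 : ∀ u : ι → ι ⊕ ι, ∀ j, ((s j).subst
      (fun l => (MvPowerSeries.X (u l) : MvPowerSeries (ι ⊕ ι) ℤ_[p]))).constantCoeff = 0 :=
    fun u j => constantCoeff_subst_of_zero (hs0 j) (hX _)
  refine hD'.toQp_ext (a := fun i => (s i).subst _) (b := fun i => (G.add i).subst _)
    (fun j => constantCoeff_subst_of_zero (hs0 j) F.constantCoeff_add)
    (fun j => constantCoeff_subst_of_zero (G.constantCoeff_add j)
      (constantCoeff_elim (h3 _) (h3 _))) fun i => ?_
  rw [hG.logSubst_subst G.constantCoeff_add (h3 _) (h3 _), key _ F.constantCoeff_add,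
    key _ (hX _), key _ (hX _)]
  simp only [toQp_X]
  have h4 : logSubst D (fun j => toQp (F.add j)) =
      logSubst D (fun j => MvPowerSeries.X (Sum.inl j)) +
      logSubst D (fun j => MvPowerSeries.X (Sum.inr j)) := funext hF
  rw [h4, matAct_add_right]
  rfl

/-- Solving log m = X gives a right inverse of the logarithm. Injectivity makes it two-sided and
identifies F with m(ℓ(x) + ℓ(y)). -/
theorem HondaType.isOfLog {C : Matrix ι ι ℤ_[p]} {D : ℕ → Matrix ι ι ℤ_[p]}
    (hD : HondaType C D) {F : FormalGroupLaw ι ℤ_[p]} (hF : HasLog D F.add) :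
    F.IsOfLog (dirichletLog fun n => (D n).map (algebraMap ℤ_[p] ℚ_[p])) := by
  have hX : ∀ {σ : Type _} (u : ι → σ) (j : ι),
      (MvPowerSeries.X (u j) : MvPowerSeries σ ℚ_[p]).constantCoeff = 0 := by simp
  obtain ⟨m, hm0, hm⟩ := exists_logSubst_eq hD.isUnit (hX id)
  have hl0 : ∀ i, (dirichletLog (fun n => (D n).map (algebraMap ℤ_[p] ℚ_[p])) i).constantCoeff
      = 0 := fun i => by
    rw [dirichletLog_eq_logSubst]
    exact constantCoeff_logSubst D (hX id) i
  have hinv : ∀ {σ : Type _} (h : ι → MvPowerSeries σ ℚ_[p]), (∀ j, (h j).constantCoeff = 0) →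
      ∀ i, logSubst D (fun j => (m j).subst h) i = h i := fun h hh i => by
    rw [← subst_logSubst D hm0 (MvPowerSeries.hasSubst_of_constantCoeff_zero hh), hm]
    exact MvPowerSeries.subst_X (MvPowerSeries.hasSubst_of_constantCoeff_zero hh) i
  have hsub0 : ∀ {σ : Type _} (h : ι → MvPowerSeries σ ℚ_[p]), (∀ j, (h j).constantCoeff = 0) →
      ∀ j, ((m j).subst h).constantCoeff = 0 := fun h hh j =>
    MvPowerSeries.constantCoeff_subst_eq_zero
      (MvPowerSeries.hasSubst_of_constantCoeff_zero hh) hh (hm0 j)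
  refine ⟨m, ⟨hl0, hm0, fun i => ?_, fun i => ?_⟩, fun i => ?_⟩
  · rw [subst_dirichletLog D hm0, hm]
    rfl
  · refine congrFun (logSubst_injective hD.isUnit (hsub0 _ hl0) (hX id) fun i => ?_) i
    rw [hinv _ hl0, dirichletLog_eq_logSubst]
    rfl
  · simp only [subst_dirichletLog D (hX _)]
    have h0 : ∀ j, (logSubst D (fun l =>
        (MvPowerSeries.X (Sum.inl l) : MvPowerSeries (ι ⊕ ι) ℚ_[p])) j +
        logSubst D (fun l => MvPowerSeries.X (Sum.inr l)) j).constantCoeff = 0 := fun j => by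
      rw [map_add, constantCoeff_logSubst D (hX _), constantCoeff_logSubst D (hX _), add_zero]
    refine congrFun (logSubst_injective hD.isUnit
      (fun j => constantCoeff_toQp (F.constantCoeff_add j)) (hsub0 _ h0) fun i => ?_) i
    rw [hinv _ h0, hF i]

omit [DecidableEq ι] in
theorem coeff_single_logSubst [DecidableEq τ] (D : ℕ → Matrix ι ι ℤ_[p])
    {a : ι → MvPowerSeries τ ℚ_[p]} (ha : ∀ j, (a j).constantCoeff = 0) (i : ι) (t : τ) :
    MvPowerSeries.coeff (Finsupp.single t 1) (logSubst D a i) =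
      ∑ j, (D 1 i j : ℚ_[p]) * MvPowerSeries.coeff (Finsupp.single t 1) (a j) := by
  have h := le_order_logSubst_sub D (b := 0) ha (by simp) (n := 1)
    (fun j => by simpa using MvPowerSeries.one_le_order (ha j)) i
  have h2 := MvPowerSeries.coeff_of_lt_order (d := Finsupp.single t 1) (lt_of_lt_of_le (by
    rw [Finsupp.degree_single]; exact ENat.natCast_lt_natCast.2 Nat.one_lt_two) h)
  rw [logSubst_zero, map_sub, sub_eq_zero] at h2
  simpa using h2

/-- On linear parts the relation reads D' 1 · dφ = B · D 1, so dφ = 1. A logarithm whose linear part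
is not the identity is thus corrected by B = (D 1)⁻¹. -/
theorem isStrongIso_of_logSubst {D D' : ℕ → Matrix ι ι ℤ_[p]} {F G : FormalGroupLaw ι ℤ_[p]}
    {B : Matrix ι ι ℤ_[p]} (h1 : D' 1 = 1) (hB : B * D 1 = 1) (φ : F.Hom G)
    (hφ : logSubst D' (fun j => toQp (φ.series j)) = matAct B (logSubst D MvPowerSeries.X)) :
    φ.IsStrongIso := by
  intro i j
  have h := congrArg (MvPowerSeries.coeff (Finsupp.single j 1)) (congrFun hφ i)
  have h2 : MvPowerSeries.coeff (Finsupp.single j 1)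
      (matAct B (logSubst D (MvPowerSeries.X : ι → MvPowerSeries ι ℚ_[p])) i) =
      matAct B (matAct (D 1) fun l => MvPowerSeries.coeff (Finsupp.single j 1)
        (MvPowerSeries.X l : MvPowerSeries ι ℚ_[p])) i := by
    rw [map_matAct]
    congr 1
    funext l
    rw [coeff_single_logSubst D (by simp)]
    rfl
  rw [h2, ← matAct_mul, hB, matAct_one,
    coeff_single_logSubst D' (fun j => constantCoeff_toQp (φ.constantCoeff_series j)), h1] at h
  have h3 := congrFun (matAct_one (p := p)
    fun l => MvPowerSeries.coeff (Finsupp.single j 1) (toQp (φ.series l))) i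
  have h4 := h3.symm.trans h
  rw [MvPowerSeries.coeff_map, MvPowerSeries.coeff_X] at h4
  have h5 : ((MvPowerSeries.coeff (Finsupp.single j 1) (φ.series i) : ℤ_[p]) : ℚ_[p]) =
      ((if i = j then 1 else 0 : ℤ_[p]) : ℚ_[p]) := by
    refine Eq.trans h4 ?_
    have : Finsupp.single j 1 = Finsupp.single i 1 ↔ i = j := by
      rw [Finsupp.single_left_inj one_ne_zero, eq_comm]
    by_cases hij : i = j <;> simp [hij, this]
  exact Subtype.ext h5

theorem actsAs_of_logSubst {D : ℕ → Matrix ι ι ℤ_[p]} {F : FormalGroupLaw ι ℤ_[p]}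
    {B : Matrix ι ι ℤ_[p]} (φ : F.Hom F)
    (hφ : logSubst D (fun j => toQp (φ.series j)) = matAct B (logSubst D MvPowerSeries.X)) :
    φ.ActsAs (dirichletLog fun n => (D n).map (algebraMap ℤ_[p] ℚ_[p])) B := by
  intro i
  rw [subst_dirichletLog D (fun j => constantCoeff_toQp (φ.constantCoeff_series j)), hφ, matAct]
  simp only [dirichletLog_eq_logSubst]

end Padic
end

/-! ### The Lubin–Tate logarithm: iterates, recurrence, convergence. -/

noncomputable section
section Padic

variable {p : ℕ} [Fact p.Prime]

/-! ### The iterates of `𝔣` -/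

theorem ltFrob_coeff_zero (π : ℤ_[p]) : (ltFrob π).coeff 0 = 0 := by
  rw [ltFrob, Polynomial.coeff_add, Polynomial.finsetSum_coeff, Finset.sum_eq_zero]
  · simp
  · intro i hi
    rw [Polynomial.coeff_C_mul_X_pow, if_neg]
    have := (Finset.mem_Icc.1 hi).1
    omega

theorem ltFrob_coeff_one (π : ℤ_[p]) : (ltFrob π).coeff 1 = π := by
  rw [ltFrob, Polynomial.coeff_add, Polynomial.finsetSum_coeff, Finset.sum_eq_zero]
  · simp
  · intro i hi
    rw [Polynomial.coeff_C_mul_X_pow, if_neg]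
    have := (Finset.mem_Icc.1 hi).1
    omega

theorem ltIter_coeff_zero (π : ℤ_[p]) (k : ℕ) : (ltIter π k).coeff 0 = 0 := by
  induction k with
  | zero => simp [ltIter]
  | succ k ih =>
    rw [Polynomial.coeff_zero_eq_eval_zero] at ih ⊢
    rw [ltIter, Polynomial.eval_comp, ih, ← Polynomial.coeff_zero_eq_eval_zero, ltFrob_coeff_zero]

/-- The definition composes with 𝔣 on the outside; the functional equation of ℓ needs 𝔣 on the
inside. -/
theorem ltIter_succ (π : ℤ_[p]) (k : ℕ) : ltIter π (k + 1) = (ltIter π k).comp (ltFrob π) := by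
  induction k with
  | zero => simp [ltIter]
  | succ k ih =>
    conv_lhs => rw [ltIter, ih, ← Polynomial.comp_assoc]
    rfl

theorem dvd_ltFrob_sub (π : ℤ_[p]) (hπ : (p : ℤ_[p]) ∣ π) :
    (p : Polynomial ℤ_[p]) ∣ ltFrob π - Polynomial.X ^ p := by
  have hp := (Fact.out : p.Prime)
  have h1 : (p : Polynomial ℤ_[p]) = Polynomial.C (p : ℤ_[p]) := by simp
  have h2 : Finset.Icc 2 p = insert p (Finset.Ico 2 p) := by
    rw [Finset.Ico_insert_right hp.two_le]
  rw [ltFrob, h2, Finset.sum_insert (by simp), Nat.choose_self, Nat.cast_one, map_one, one_mul,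
    h1, add_comm (Polynomial.X ^ p), ← add_assoc, add_sub_cancel_right]
  refine dvd_add ((map_dvd Polynomial.C hπ).mul_right _) (Finset.dvd_sum fun i hi => ?_)
  refine Dvd.dvd.mul_right (map_dvd Polynomial.C ?_) _
  have hi := Finset.mem_Ico.1 hi
  exact Nat.cast_dvd_cast (hp.dvd_choose_self (by omega) hi.2)

/-- Since 𝔣 ≡ X^p modulo p, the derivative of 𝔣 is divisible by p; the chain rule contributes one
such factor per iteration. -/
theorem dvd_derivative_ltIter (π : ℤ_[p]) (hπ : (p : ℤ_[p]) ∣ π) (k : ℕ) :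
    (p : Polynomial ℤ_[p]) ^ k ∣ Polynomial.derivative (ltIter π k) := by
  have h0 : (p : Polynomial ℤ_[p]) ∣ Polynomial.derivative (ltFrob π) := by
    obtain ⟨g, hg⟩ := dvd_ltFrob_sub π hπ
    rw [sub_eq_iff_eq_add] at hg
    rw [hg, Polynomial.derivative_add, Polynomial.derivative_X_pow, Polynomial.derivative_mul,
      Polynomial.derivative_natCast, zero_mul, zero_add, map_natCast]
    exact dvd_add (dvd_mul_right _ _) (dvd_mul_right _ _)
  induction k with
  | zero => simp
  | succ k ih =>
    rw [ltIter, Polynomial.derivative_comp, pow_succ]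
    refine mul_dvd_mul ih ?_
    obtain ⟨g, hg⟩ := h0
    rw [hg, Polynomial.mul_comp, Polynomial.natCast_comp]
    exact dvd_mul_right _ _

/-- Up to an index shift, n times the n-th coefficient is a coefficient of the derivative. -/
theorem pow_dvd_mul_coeff_ltIter (π : ℤ_[p]) (hπ : (p : ℤ_[p]) ∣ π) (k n : ℕ) :
    (p : ℤ_[p]) ^ k ∣ n * (ltIter π k).coeff n := by
  cases n with
  | zero => simp
  | succ n =>
    obtain ⟨g, hg⟩ := dvd_derivative_ltIter π hπ k
    have := congrArg (Polynomial.coeff · n) hg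
    simp only [Polynomial.coeff_derivative] at this
    have h1 : (p : Polynomial ℤ_[p]) ^ k = Polynomial.C ((p : ℤ_[p]) ^ k) := by simp
    rw [h1, Polynomial.coeff_C_mul] at this
    exact ⟨g.coeff n, by push_cast; rw [← this]; ring⟩

/-! ### The matrices `p ^ k x_k` -/

variable {ι : Type*} [Fintype ι] [DecidableEq ι]

/-- The integral matrices `p ^ k x_k`. -/
def ySeq (C : Matrix ι ι ℤ_[p]) : ℕ → Matrix ι ι ℤ_[p]
  | 0 => 1
  | 1 => C
  | k + 2 => C * ySeq C (k + 1) - (p : ℤ_[p]) • ySeq C k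

theorem ySeq_apply (C : Matrix ι ι ℤ_[p]) (k : ℕ) (i j : ι) :
    (ySeq C k i j : ℚ_[p]) =
      (p : ℚ_[p]) ^ k * xSeq (C.map (algebraMap ℤ_[p] ℚ_[p])) k i j := by
  have hp : (p : ℚ_[p]) ≠ 0 := by exact_mod_cast (Fact.out : p.Prime).ne_zero
  induction k using Nat.twoStepInduction generalizing i j with
  | zero =>
    by_cases h : i = j <;> simp [ySeq, xSeq, h, Matrix.one_apply]
  | one =>
    simp only [ySeq, xSeq, Matrix.smul_apply, Matrix.map_apply, smul_eq_mul, pow_one]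
    rw [mul_inv_cancel_left₀ hp]
    rfl
  | more k h0 h1 =>
    simp only [ySeq, xSeq, Matrix.sub_apply, Matrix.mul_apply, Matrix.smul_apply, smul_eq_mul,
      Matrix.map_apply, PadicInt.coe_sub, PadicInt.coe_sum, PadicInt.coe_mul, h0, h1,
      PadicInt.coe_natCast]
    have h2 : ∀ z : ℚ_[p], (p : ℚ_[p]) ^ (k + 2) * ((p : ℚ_[p])⁻¹ * z) = p ^ (k + 1) * z :=
      fun z => by field_simp; ring
    rw [h2, mul_sub, Finset.mul_sum]
    congr 1
    · exact Finset.sum_congr rfl fun l _ => mul_left_comm _ _ _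
    · ring

/-- `C` is nilpotent modulo `p`. -/
def IsNilpotentModP (C : Matrix ι ι ℤ_[p]) : Prop :=
  ∃ (m : ℕ) (E : Matrix ι ι ℤ_[p]), C ^ m = (p : ℤ_[p]) • E

/-- Once all later terms are divisible by p^r, the term p y_k drops out modulo p^(r+1) and the
recurrence becomes multiplication by C. After m further steps the factor C^m, divisible by p,
supplies one more power. -/
theorem IsNilpotentModP.exists_ySeq_eq {C : Matrix ι ι ℤ_[p]} (hC : IsNilpotentModP C) (r : ℕ) :
    ∃ K, ∀ k, K ≤ k → ∃ E, ySeq C k = (p : ℤ_[p]) ^ r • E := by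
  obtain ⟨m, E, hE⟩ := hC
  induction r with
  | zero => exact ⟨0, fun k _ => ⟨ySeq C k, by simp⟩⟩
  | succ r ih =>
    obtain ⟨K, hK⟩ := ih
    have key : ∀ j, ∃ E', ySeq C (K + 1 + j) =
        C ^ j * ySeq C (K + 1) + (p : ℤ_[p]) ^ (r + 1) • E' := by
      intro j
      induction j with
      | zero => exact ⟨0, by simp⟩
      | succ j ihj =>
        obtain ⟨E', hE'⟩ := ihj
        obtain ⟨E'', hE''⟩ := hK (K + j) (by omega)
        refine ⟨C * E' - E'', ?_⟩
        rw [show K + 1 + (j + 1) = K + j + 2 by omega, ySeq, show K + j + 1 = K + 1 + j by omega,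
          hE', hE'', mul_add, ← mul_assoc, ← pow_succ', smul_smul, ← pow_succ', smul_sub,
          Matrix.mul_smul, add_sub_assoc]
    refine ⟨K + 1 + m, fun k hk => ?_⟩
    obtain ⟨i, rfl⟩ := Nat.exists_eq_add_of_le hk
    obtain ⟨E', hE'⟩ := key (m + i)
    obtain ⟨E'', hE''⟩ := hK (K + 1) (by omega)
    refine ⟨C ^ i * E * E'' + E', ?_⟩
    rw [add_assoc (K + 1), hE', hE'', add_comm m, pow_add, hE, smul_add, Matrix.mul_smul,
      Matrix.mul_smul, Matrix.smul_mul, smul_smul, ← pow_succ]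

theorem IsNilpotentModP.tendsto_ySeq {C : Matrix ι ι ℤ_[p]} (hC : IsNilpotentModP C) (i j : ι) :
    Filter.Tendsto (fun k => ‖ySeq C k i j‖) Filter.atTop (nhds 0) := by
  rw [Metric.tendsto_atTop]
  intro ε hε
  obtain ⟨r, hr⟩ := PadicInt.exists_pow_neg_lt p hε
  obtain ⟨K, hK⟩ := hC.exists_ySeq_eq r
  refine ⟨K, fun k hk => ?_⟩
  obtain ⟨E, hE⟩ := hK k hk
  rw [dist_zero_right, norm_norm, hE, Matrix.smul_apply, smul_eq_mul, norm_mul, PadicInt.norm_p_pow]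
  exact (mul_le_of_le_one_right (by positivity) (PadicInt.norm_le_one _)).trans_lt hr

/-! ### The coefficients of `ℓ` -/

/-- The factor n brings out p^k from the coefficient of the iterate, and p^k x_k is the integral
matrix y_k. So the coefficients of ℓ in degree n have denominator at most n, and y_k → 0 makes the
defining sums converge. -/
theorem norm_mul_xSeq_mul_coeff_le (π : ℤ_[p]) (hπ : (p : ℤ_[p]) ∣ π) (C : Matrix ι ι ℤ_[p])
    (k n : ℕ) (i j : ι) :
    ‖(n : ℚ_[p]) * (xSeq (C.map (algebraMap ℤ_[p] ℚ_[p])) k i j * (ltIter π k).coeff n)‖ ≤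
      ‖ySeq C k i j‖ := by
  obtain ⟨z, hz⟩ := pow_dvd_mul_coeff_ltIter π hπ k n
  have hz' := congrArg (fun t : ℤ_[p] => (t : ℚ_[p])) hz
  simp only [PadicInt.coe_mul, PadicInt.coe_natCast, PadicInt.coe_pow] at hz'
  have h : (n : ℚ_[p]) * (xSeq (C.map (algebraMap ℤ_[p] ℚ_[p])) k i j * (ltIter π k).coeff n) =
      z * ySeq C k i j := by
    rw [ySeq_apply, mul_left_comm, hz']
    ring
  rw [h, norm_mul]
  exact mul_le_of_le_one_left (norm_nonneg _) z.2

theorem summable_xSeq_mul_coeff (π : ℤ_[p]) (hπ : (p : ℤ_[p]) ∣ π) {C : Matrix ι ι ℤ_[p]}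
    (hC : IsNilpotentModP C) (n : ℕ) (i j : ι) :
    Summable fun k => xSeq (C.map (algebraMap ℤ_[p] ℚ_[p])) k i j *
      ((ltIter π k).coeff n : ℚ_[p]) := by
  rcases eq_or_ne n 0 with rfl | hn
  · simp [ltIter_coeff_zero]
  have hn' : (n : ℚ_[p]) ≠ 0 := by exact_mod_cast hn
  refine NonarchimedeanAddGroup.summable_of_tendsto_cofinite_zero ?_
  rw [Nat.cofinite_eq_atTop]
  have h : Filter.Tendsto (fun k => ‖(n : ℚ_[p])‖⁻¹ * ‖ySeq C k i j‖) Filter.atTop (nhds 0) := by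
    simpa using (hC.tendsto_ySeq i j).const_mul ‖(n : ℚ_[p])‖⁻¹
  refine squeeze_zero_norm (fun k => ?_) h
  have := norm_mul_xSeq_mul_coeff_le π hπ C k n i j
  rw [norm_mul] at this
  rw [le_inv_mul_iff₀ (norm_pos_iff.2 hn')]
  exact this

theorem PowerSeries.coeff_subst_eq_sum_range {R : Type*} [CommRing R] (f : PowerSeries R)
    {a : PowerSeries R} (ha : PowerSeries.constantCoeff a = 0) (n : ℕ) :
    PowerSeries.coeff n (f.subst a) =
      ∑ m ∈ Finset.range (n + 1), PowerSeries.coeff m f * PowerSeries.coeff n (a ^ m) := by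
  rw [PowerSeries.coeff_subst' (PowerSeries.HasSubst.of_constantCoeff_zero' ha)]
  refine finsum_eq_sum_of_support_subset _ fun m hm => ?_
  simp only [Finset.coe_range, Set.mem_Iio]
  by_contra hlt
  refine hm ?_
  have : PowerSeries.coeff n (a ^ m) = 0 :=
    PowerSeries.coeff_of_lt_order _ (lt_of_lt_of_le (by exact_mod_cast (by omega : n < m))
      (PowerSeries.le_order_pow_of_constantCoeff_eq_zero m ha))
  simp [this]

theorem PowerSeries.coeff_comp_eq_sum_range {R : Type*} [CommRing R] (f : Polynomial R)
    {a : Polynomial R} (ha : a.coeff 0 = 0) (n : ℕ) :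
    (f.comp a).coeff n =
      ∑ m ∈ Finset.range (n + 1), f.coeff m * (a ^ m).coeff n := by
  have ha' : PowerSeries.constantCoeff (a : PowerSeries R) = 0 := by
    rw [← PowerSeries.coeff_zero_eq_constantCoeff_apply, Polynomial.coeff_coe, ha]
  have h := PowerSeries.coeff_subst_eq_sum_range (f : PowerSeries R) ha' n
  rw [PowerSeries.subst_coe (PowerSeries.HasSubst.of_constantCoeff_zero' ha')] at h
  have h2 : Polynomial.aeval (a : PowerSeries R) f = ((f.comp a : Polynomial R) : PowerSeries R) := by
    rw [Polynomial.comp_eq_aeval]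
    exact Polynomial.aeval_algHom_apply (Polynomial.coeToPowerSeries.algHom R) a f
  simp only [h2, ← Polynomial.coe_pow, Polynomial.coeff_coe] at h
  exact h

end Padic
end

/-! ### The Honda type of the Lubin–Tate logarithm. -/

noncomputable section
section Padic

variable {p : ℕ} [Fact p.Prime] {ι : Type*} [Fintype ι] [DecidableEq ι]

/-- `D n / n` are the coefficients of the logarithm `ltLog π C`. -/
def IsLtCoeff (π : ℤ_[p]) (C : Matrix ι ι ℤ_[p]) (D : ℕ → Matrix ι ι ℤ_[p]) : Prop :=
  ∀ n i j, HasSum (fun k => xSeq (C.map (algebraMap ℤ_[p] ℚ_[p])) k i j *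
    ((ltIter π k).coeff n : ℚ_[p])) ((D n i j : ℚ_[p]) / n)

theorem exists_isLtCoeff (π : ℤ_[p]) (hπ : (p : ℤ_[p]) ∣ π) {C : Matrix ι ι ℤ_[p]}
    (hC : IsNilpotentModP C) : ∃ D, IsLtCoeff π C D := by
  have hb : ∀ (n : ℕ) (i j : ι), ‖(n : ℚ_[p]) * ∑' k, xSeq (C.map (algebraMap ℤ_[p] ℚ_[p])) k i j *
      ((ltIter π k).coeff n : ℚ_[p])‖ ≤ 1 := fun n i j => by
    rw [← tsum_mul_left]
    exact IsUltrametricDist.norm_tsum_le_of_forall_le_of_nonneg zero_le_one fun k =>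
      (norm_mul_xSeq_mul_coeff_le π hπ C k n i j).trans (PadicInt.norm_le_one _)
  refine ⟨fun n => Matrix.of fun i j => ⟨_, hb n i j⟩, fun n i j => ?_⟩
  have h := (summable_xSeq_mul_coeff π hπ hC n i j).hasSum
  convert h using 1
  -- At n = 0 both sides vanish: the iterates have no constant term, and division by 0 gives 0.
  rcases eq_or_ne n 0 with rfl | hn
  · simp [ltIter_coeff_zero]
  · have hn' : (n : ℚ_[p]) ≠ 0 := by exact_mod_cast hn
    exact mul_div_cancel_left₀ _ hn'

/-- The iterates are applied coordinate by coordinate, so no mixed monomials occur and ℓ has the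
diagonal shape treated above. -/
theorem ltLog_eq_dirichletLog (π : ℤ_[p]) {C : Matrix ι ι ℤ_[p]} {D : ℕ → Matrix ι ι ℤ_[p]}
    (hD : IsLtCoeff π C D) :
    ltLog π (C.map (algebraMap ℤ_[p] ℚ_[p])) =
      dirichletLog fun n => (D n).map (algebraMap ℤ_[p] ℚ_[p]) := by
  funext i
  ext d
  rw [dirichletLog_eq_logSubst, logSubst, map_sum]
  refine HasSum.tsum_eq (hasSum_sum fun j _ => ?_)
  have h1 : ∀ k, (Polynomial.aeval (MvPowerSeries.X j : MvPowerSeries ι ℤ_[p]) (ltIter π k)) =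
      PowerSeries.subst (MvPowerSeries.X j) (ltIter π k : PowerSeries ℤ_[p]) := fun k =>
    (PowerSeries.subst_coe (PowerSeries.HasSubst.X j) _).symm
  simp only [h1, MvPowerSeries.coeff_map, PowerSeries.coeff_subst_single]
  by_cases h : d = Finsupp.single j (d j)
  · simp only [if_pos h, Polynomial.coeff_coe, logCoeff, PowerSeries.coeff_mk]
    exact hD (d j) i j
  · simp only [if_neg h, map_zero, mul_zero]
    exact hasSum_zero

/-- Composing with a polynomial that shifts the iterates of `𝔣`. -/
theorem IsLtCoeff.hasSum_coeff_subst {π : ℤ_[p]} {C : Matrix ι ι ℤ_[p]}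
    {D : ℕ → Matrix ι ι ℤ_[p]} (hD : IsLtCoeff π C D) {g : Polynomial ℤ_[p]} (hg : g.coeff 0 = 0)
    {s : ℕ} (hs : ∀ k, (ltIter π k).comp g = ltIter π (k + s)) (n : ℕ) (i j : ι) :
    HasSum (fun k => xSeq (C.map (algebraMap ℤ_[p] ℚ_[p])) k i j *
      ((ltIter π (k + s)).coeff n : ℚ_[p]))
      (PowerSeries.coeff n ((logCoeff D i j).subst
        (PowerSeries.map (algebraMap ℤ_[p] ℚ_[p]) g))) := by
  have hg' : PowerSeries.constantCoeff (PowerSeries.map (algebraMap ℤ_[p] ℚ_[p]) g) = 0 := by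
    rw [← PowerSeries.coeff_zero_eq_constantCoeff_apply, PowerSeries.coeff_map,
      Polynomial.coeff_coe, hg, map_zero]
  rw [PowerSeries.coeff_subst_eq_sum_range _ hg']
  have h := hasSum_sum (s := Finset.range (n + 1)) fun m _ => (hD m i j).mul_right
    (PowerSeries.coeff n (PowerSeries.map (algebraMap ℤ_[p] ℚ_[p]) (g : PowerSeries ℤ_[p]) ^ m))
  have e : (fun k => xSeq (C.map (algebraMap ℤ_[p] ℚ_[p])) k i j *
      ((ltIter π (k + s)).coeff n : ℚ_[p])) = fun k => ∑ m ∈ Finset.range (n + 1),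
        xSeq (C.map (algebraMap ℤ_[p] ℚ_[p])) k i j * ((ltIter π k).coeff m : ℚ_[p]) *
        PowerSeries.coeff n (PowerSeries.map (algebraMap ℤ_[p] ℚ_[p])
          (g : PowerSeries ℤ_[p]) ^ m) := by
    funext k
    rw [← hs, PowerSeries.coeff_comp_eq_sum_range _ hg, PadicInt.coe_sum, Finset.mul_sum]
    refine Finset.sum_congr rfl fun m _ => ?_
    rw [← map_pow, PowerSeries.coeff_map, ← Polynomial.coe_pow, Polynomial.coeff_coe,
      PadicInt.coe_mul, mul_assoc]
    rfl
  rw [e]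
  simpa only [logCoeff, PowerSeries.coeff_mk] using h

/-- The n-th coefficient of pℓ - Cℓ∘𝔣 + ℓ∘𝔣∘𝔣 = p x. Composing with 𝔣 shifts the iterates, so the
coefficient of 𝔣^{(k+2)} is p x_{k+2} - C x_{k+1} + x_k = 0 and only the first terms remain. -/
theorem IsLtCoeff.coeff_relation {π : ℤ_[p]} {C : Matrix ι ι ℤ_[p]}
    {D : ℕ → Matrix ι ι ℤ_[p]} (hD : IsLtCoeff π C D) (n : ℕ) (i j : ι) :
    (p : ℚ_[p]) * ((D n i j : ℚ_[p]) / n) - ∑ l, (C i l : ℚ_[p]) * PowerSeries.coeff n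
      ((logCoeff D l j).subst (PowerSeries.map (algebraMap ℤ_[p] ℚ_[p]) (ltFrob π))) +
      PowerSeries.coeff n ((logCoeff D i j).subst
        (PowerSeries.map (algebraMap ℤ_[p] ℚ_[p]) ((ltFrob π).comp (ltFrob π) :))) =
      p * ((1 : Matrix ι ι ℚ_[p]) i j * ((Polynomial.X : Polynomial ℤ_[p]).coeff n : ℚ_[p])) := by
  have hp : (p : ℚ_[p]) ≠ 0 := by exact_mod_cast (Fact.out : p.Prime).ne_zero
  set x := xSeq (C.map (algebraMap ℤ_[p] ℚ_[p])) with hx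
  have h0 := (hD n i j).mul_left (p : ℚ_[p])
  have h1 := hasSum_sum (s := Finset.univ) fun l _ => (hD.hasSum_coeff_subst (ltFrob_coeff_zero π)
    (s := 1) (fun k => (ltIter_succ π k).symm) n l j).mul_left (C i l : ℚ_[p])
  have h2 := hD.hasSum_coeff_subst (g := (ltFrob π).comp (ltFrob π)) (s := 2) (by
      rw [Polynomial.coeff_zero_eq_eval_zero, Polynomial.eval_comp,
        ← Polynomial.coeff_zero_eq_eval_zero, ltFrob_coeff_zero,
        ← Polynomial.coeff_zero_eq_eval_zero, ltFrob_coeff_zero])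
    (fun k => by rw [← Polynomial.comp_assoc, ← ltIter_succ, ← ltIter_succ]) n i j
  -- Removing two terms from the first series and one from the second aligns all three at the
  -- iterate k + 2.
  rw [← hasSum_nat_add_iff' 2] at h0
  rw [← hasSum_nat_add_iff' 1] at h1
  have h3 := (h0.sub h1).add h2
  have h4 : ∀ k, (p : ℚ_[p]) * (x (k + 2) i j * ((ltIter π (k + 2)).coeff n : ℚ_[p])) -
      ∑ l, (C i l : ℚ_[p]) * (x (k + 1) l j * ((ltIter π (k + 1 + 1)).coeff n : ℚ_[p])) +
      x k i j * ((ltIter π (k + 2)).coeff n : ℚ_[p]) = 0 := fun k => by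
    have : (p : ℚ_[p]) * x (k + 2) i j = ∑ l, (C i l : ℚ_[p]) * x (k + 1) l j - x k i j := by
      rw [hx, xSeq, Matrix.smul_apply, smul_eq_mul, mul_inv_cancel_left₀ hp, Matrix.sub_apply,
        Matrix.mul_apply]
      rfl
    rw [← mul_assoc, this]
    simp only [← mul_assoc]
    rw [← Finset.sum_mul]
    ring
  simp only [← hx, h4] at h3
  have h5 := h3.unique hasSum_zero
  have h6 : x 0 = 1 := rfl
  have h7 : (p : ℚ_[p]) * x 1 i j = C i j := by
    rw [hx, xSeq, Matrix.smul_apply, smul_eq_mul, mul_inv_cancel_left₀ hp]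
    rfl
  have h8 : ∑ l, (C i l : ℚ_[p]) * ((1 : Matrix ι ι ℚ_[p]) l j *
      ((ltIter π 1).coeff n : ℚ_[p])) =
      C i j * ((ltIter π 1).coeff n : ℚ_[p]) := by
    rw [Finset.sum_eq_single j]
    · simp
    · intro l _ hl
      simp [Matrix.one_apply_ne hl]
    · simp
  simp only [Finset.sum_range_succ, Finset.sum_range_zero, zero_add, h6, h8] at h5
  rw [← mul_assoc (p : ℚ_[p]) (x 1 i j), h7] at h5
  have h9 : ltIter π 0 = Polynomial.X := rfl
  rw [h9] at h5
  linear_combination h5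

/-- In degree one the exact identity says (p - πC + π²) D 1 = p; divide by p. The inverse of D 1 so
obtained is a polynomial in C, hence commutes with C, and will define the strong isomorphism. -/
theorem IsLtCoeff.mul_eq_one {π c : ℤ_[p]} (hπ : π = p * (1 + p * c)) {C : Matrix ι ι ℤ_[p]}
    {D : ℕ → Matrix ι ι ℤ_[p]} (hD : IsLtCoeff π C D) :
    (1 - (1 + p * c) • C + (p * (1 + p * c) ^ 2 : ℤ_[p]) • (1 : Matrix ι ι ℤ_[p])) * D 1 = 1 := by
  have hp : (p : ℚ_[p]) ≠ 0 := by exact_mod_cast (Fact.out : p.Prime).ne_zero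
  have hcoef : ∀ (g : Polynomial ℤ_[p]), g.coeff 0 = 0 → ∀ i j, PowerSeries.coeff 1
      ((logCoeff D i j).subst (PowerSeries.map (algebraMap ℤ_[p] ℚ_[p]) (g : PowerSeries ℤ_[p]))) =
      D 1 i j * g.coeff 1 := fun g hg i j => by
    have hg' : PowerSeries.constantCoeff (PowerSeries.map (algebraMap ℤ_[p] ℚ_[p]) g) = 0 := by
      rw [← PowerSeries.coeff_zero_eq_constantCoeff_apply, PowerSeries.coeff_map,
        Polynomial.coeff_coe, hg, map_zero]
    rw [PowerSeries.coeff_subst_eq_sum_range _ hg']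
    simp [Finset.sum_range_succ, logCoeff]
  have h2 : ((ltFrob π).comp (ltFrob π)).coeff 1 = π ^ 2 := by
    rw [PowerSeries.coeff_comp_eq_sum_range _ (ltFrob_coeff_zero π)]
    simp [Finset.sum_range_succ, ltFrob_coeff_zero, ltFrob_coeff_one, sq]
  have h3 : ((ltFrob π).comp (ltFrob π)).coeff 0 = 0 := by
    rw [PowerSeries.coeff_comp_eq_sum_range _ (ltFrob_coeff_zero π)]
    simp [ltFrob_coeff_zero]
  ext i j
  have h := hD.coeff_relation 1 i j
  rw [hcoef _ h3, h2] at h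
  simp only [hcoef _ (ltFrob_coeff_zero π), ltFrob_coeff_one, Polynomial.coeff_X_one] at h
  have h4 : (((1 - (1 + p * c) • C + (p * (1 + p * c) ^ 2 : ℤ_[p]) • (1 : Matrix ι ι ℤ_[p])) *
      D 1) i j : ℚ_[p]) = D 1 i j - (1 + p * c) * (∑ l, (C i l : ℚ_[p]) * D 1 l j) +
      p * (1 + p * c) ^ 2 * D 1 i j := by
    rw [add_mul, sub_mul, one_mul, Matrix.smul_mul, Matrix.smul_mul, one_mul, Matrix.add_apply,
      Matrix.sub_apply, Matrix.smul_apply, Matrix.smul_apply, Matrix.mul_apply]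
    simp only [smul_eq_mul, PadicInt.coe_add, PadicInt.coe_sub, PadicInt.coe_mul,
      PadicInt.coe_sum, PadicInt.coe_pow, PadicInt.coe_one, PadicInt.coe_natCast]
  have h5 : ((1 : Matrix ι ι ℤ_[p]) i j : ℚ_[p]) = (1 : Matrix ι ι ℚ_[p]) i j := by
    by_cases hij : i = j <;> simp [hij, Matrix.one_apply]
  refine Subtype.ext ?_
  rw [h5, h4]
  refine mul_left_cancel₀ hp ?_
  simp only [← mul_assoc] at h
  rw [← Finset.sum_mul, hπ] at h
  push_cast at h
  linear_combination h

/-- The exact identity involves 𝔣 and 𝔣∘𝔣 where the Honda type has X^p and X^(p²). These agree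
modulo p, so after applying the logarithm the error is divisible by p. -/
theorem IsLtCoeff.hondaType {π c : ℤ_[p]} (hπ : π = p * (1 + p * c)) {C : Matrix ι ι ℤ_[p]}
    {D : ℕ → Matrix ι ι ℤ_[p]} (hD : IsLtCoeff π C D) : HondaType C D := by
  have hp0 := (Fact.out : p.Prime).ne_zero
  have hdvd : (p : ℤ_[p]) ∣ π := ⟨_, hπ⟩
  refine ⟨isUnit_iff_exists.2 ⟨_, _root_.mul_eq_one_comm.1 (hD.mul_eq_one hπ),
    hD.mul_eq_one hπ⟩, fun i j n => ?_⟩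
  have hsmall : ∀ (g : Polynomial ℤ_[p]) (m : ℕ), m ≠ 0 → g.coeff 0 = 0 →
      (p : Polynomial ℤ_[p]) ∣ g - Polynomial.X ^ m → ∀ l, ‖PowerSeries.coeff n
        ((logCoeff D l j).subst (PowerSeries.map (algebraMap ℤ_[p] ℚ_[p])
          (g : PowerSeries ℤ_[p])) - (logCoeff D l j).subst
          (PowerSeries.X ^ m : PowerSeries ℚ_[p]))‖ ≤ (p : ℝ)⁻¹ := by
    intro g m hm hg hgm l
    have h := norm_coeff_logCoeff_subst_sub_le D (τ := Unit) (a := (g : PowerSeries ℤ_[p]))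
      (b := (PowerSeries.X ^ m : PowerSeries ℤ_[p])) (by
        change PowerSeries.constantCoeff (g : PowerSeries ℤ_[p]) = 0
        rw [← PowerSeries.coeff_zero_eq_constantCoeff_apply, Polynomial.coeff_coe, hg]) (by
        change PowerSeries.constantCoeff (PowerSeries.X ^ m : PowerSeries ℤ_[p]) = 0
        simp [hm]) (by
        obtain ⟨q, hq⟩ := hgm
        refine ⟨(q : PowerSeries ℤ_[p]), ?_⟩
        have := congrArg (fun f : Polynomial ℤ_[p] => (f : PowerSeries ℤ_[p])) hq
        have hc : ((p : Polynomial ℤ_[p]) : PowerSeries ℤ_[p]) = p :=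
          map_natCast Polynomial.coeToPowerSeries.ringHom p
        rw [← hc]
        simpa using this) l j (Finsupp.single () n)
    have h2 : toQp (PowerSeries.X ^ m : PowerSeries ℤ_[p]) =
        (PowerSeries.X ^ m : PowerSeries ℚ_[p]) := by
      change PowerSeries.map _ _ = _
      simp
    rw [h2] at h
    exact h
  have h1 := hsmall _ p hp0 (ltFrob_coeff_zero π) (dvd_ltFrob_sub π hdvd)
  have h2 := hsmall ((ltFrob π).comp (ltFrob π)) (p ^ 2) (pow_ne_zero 2 hp0) (by
      rw [PowerSeries.coeff_comp_eq_sum_range _ (ltFrob_coeff_zero π)]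
      simp [ltFrob_coeff_zero]) (by
      have h3 : (p : Polynomial ℤ_[p]) ∣ (ltFrob π).comp (ltFrob π) - ltFrob π ^ p := by
        obtain ⟨q, hq⟩ := dvd_ltFrob_sub π hdvd
        have := congrArg (Polynomial.comp · (ltFrob π)) hq
        simp only [Polynomial.sub_comp, Polynomial.X_pow_comp, Polynomial.mul_comp,
          Polynomial.natCast_comp] at this
        exact ⟨_, this⟩
      have h4 := (dvd_ltFrob_sub π hdvd).trans (sub_dvd_pow_sub_pow _ _ p)
      have h5 := dvd_add h3 h4
      rwa [sub_add_sub_cancel, ← pow_mul, ← sq] at h5) i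
  have key := hD.coeff_relation n i j
  have e : PowerSeries.coeff n ((p : ℚ_[p]) • logCoeff D i j -
      ∑ l, (C i l : ℚ_[p]) • (logCoeff D l j).subst (PowerSeries.X ^ p : PowerSeries ℚ_[p]) +
      (logCoeff D i j).subst (PowerSeries.X ^ (p ^ 2) : PowerSeries ℚ_[p])) =
      p * ((1 : Matrix ι ι ℚ_[p]) i j * ((Polynomial.X : Polynomial ℤ_[p]).coeff n : ℚ_[p])) +
      ∑ l, (C i l : ℚ_[p]) * PowerSeries.coeff n ((logCoeff D l j).subst (PowerSeries.map
        (algebraMap ℤ_[p] ℚ_[p]) (ltFrob π : PowerSeries ℤ_[p])) -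
        (logCoeff D l j).subst (PowerSeries.X ^ p : PowerSeries ℚ_[p])) -
      PowerSeries.coeff n ((logCoeff D i j).subst (PowerSeries.map (algebraMap ℤ_[p] ℚ_[p])
        (((ltFrob π).comp (ltFrob π) : Polynomial ℤ_[p]) : PowerSeries ℤ_[p])) -
        (logCoeff D i j).subst (PowerSeries.X ^ (p ^ 2) : PowerSeries ℚ_[p])) := by
    rw [← key]
    simp only [map_add, map_sub, map_sum, PowerSeries.coeff_smul, mul_sub,
      Finset.sum_sub_distrib, smul_eq_mul]
    simp only [logCoeff, PowerSeries.coeff_mk]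
    ring
  rw [e]
  refine (IsUltrametricDist.norm_sub_le_max _ _).trans (max_le ?_ h2)
  refine (IsUltrametricDist.norm_add_le_max _ _).trans (max_le ?_ ?_)
  · rw [norm_mul, Padic.norm_p]
    refine mul_le_of_le_one_right (by positivity) ?_
    rw [norm_mul]
    refine mul_le_one₀ ?_ (norm_nonneg _) (PadicInt.norm_le_one _)
    by_cases hij : i = j <;> simp [hij, Matrix.one_apply]
  · refine IsUltrametricDist.norm_sum_le_of_forall_le_of_nonneg (by positivity) fun l _ => ?_
    rw [norm_mul]
    exact (mul_le_of_le_one_left (norm_nonneg _) (PadicInt.norm_le_one _)).trans (h1 l)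

end Padic
end

/-! ### Invertible matrices, and the Honda type of the Dirichlet logarithm. -/

noncomputable section
section Padic

variable {p : ℕ} [Fact p.Prime]

theorem isUnit_of_isUnit_toZMod {x : ℤ_[p]} (h : IsUnit (PadicInt.toZMod x)) : IsUnit x := by
  by_contra hx
  have : x ∈ RingHom.ker (PadicInt.toZMod (p := p)) := by
    rw [PadicInt.ker_toZMod]
    exact hx
  rw [RingHom.mem_ker] at this
  rw [this] at h
  exact not_isUnit_zero h

section Matrices

variable {ι : Type*} [Fintype ι] [DecidableEq ι]

/-- Modulo p this is a unit minus a commuting nilpotent, and a determinant over ℤ_p is a unit when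
its residue is. -/
theorem IsNilpotentModP.isUnit_smul_one_sub {C : Matrix ι ι ℤ_[p]} (hC : IsNilpotentModP C)
    {u : ℤ_[p]} (hu : IsUnit u) : IsUnit (u • (1 : Matrix ι ι ℤ_[p]) - C) := by
  obtain ⟨m, E, hE⟩ := hC
  rw [Matrix.isUnit_iff_isUnit_det]
  refine isUnit_of_isUnit_toZMod ?_
  rw [RingHom.map_det, ← Matrix.isUnit_iff_isUnit_det, map_sub, sub_eq_neg_add]
  have hnil : IsNilpotent ((PadicInt.toZMod (p := p)).mapMatrix C) := by
    refine ⟨m, ?_⟩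
    rw [← map_pow, hE]
    ext i j
    simp
  have hs : (PadicInt.toZMod (p := p)).mapMatrix (u • (1 : Matrix ι ι ℤ_[p])) =
      algebraMap (ZMod p) (Matrix ι ι (ZMod p)) (PadicInt.toZMod u) := by
    ext i j
    by_cases h : i = j <;> simp [h, Matrix.algebraMap_matrix_apply]
  rw [hs]
  refine hnil.neg.isUnit_add_right_of_commute ((hu.map PadicInt.toZMod).map _) ?_
  exact (Algebra.commutes' _ _).symm

omit [Fintype ι] in
theorem natCast_eq_smul_one (n : ℕ) : (n : Matrix ι ι ℤ_[p]) = (n : ℤ_[p]) • 1 := by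
  ext i j
  by_cases h : i = j <;> simp [h, Matrix.natCast_apply]

theorem IsNilpotentModP.isUnit_one_add_sub {C : Matrix ι ι ℤ_[p]} (hC : IsNilpotentModP C) :
    IsUnit (1 + (p : Matrix ι ι ℤ_[p]) - C) := by
  have h : 1 + (p : Matrix ι ι ℤ_[p]) = (1 + p : ℤ_[p]) • 1 := by
    rw [natCast_eq_smul_one, add_smul, one_smul]
  rw [h]
  refine hC.isUnit_smul_one_sub (isUnit_of_isUnit_toZMod ?_)
  simp

theorem IsNilpotentModP.isUnit_sub_two (hp : p ≠ 2) {C : Matrix ι ι ℤ_[p]}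
    (hC : IsNilpotentModP C) : IsUnit (C - 2) := by
  have h : (2 : Matrix ι ι ℤ_[p]) = (2 : ℤ_[p]) • 1 := by
    have := natCast_eq_smul_one (p := p) (ι := ι) 2
    simpa using this
  rw [← neg_sub, h]
  refine (hC.isUnit_smul_one_sub (isUnit_of_isUnit_toZMod ?_)).neg
  rw [map_ofNat]
  refine IsUnit.mk0 _ fun h2 => ?_
  have h3 : ((2 : ℕ) : ZMod p) = 0 := by exact_mod_cast h2
  rw [ZMod.natCast_eq_zero_iff] at h3
  exact hp ((Nat.prime_dvd_prime_iff_eq Fact.out Nat.prime_two).1 h3)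

end Matrices

/-! ### The Dirichlet series -/

section Dirichlet

variable {R : Type*} [CommRing R]

theorem dirichletCoeff_pow_mul (N : ℕ) (hN : ¬ p ∣ N) (a : ℕ → R) (k : ℕ) {m : ℕ}
    (hm : ¬ p ∣ m) :
    dirichletCoeff N a (p ^ k * m) = eulerCoeff (a p) (p : R) k * dirichletCoeff N a m := by
  have hp := (Fact.out : p.Prime)
  have hcop : (p ^ k).Coprime m := Nat.Coprime.pow_left k ((hp.coprime_iff_not_dvd).2 hm)
  rw [dirichletCoeff, Nat.factorization_mul_of_coprime hcop, Finsupp.prod_add_index_of_disjoint]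
  · rw [hp.factorization_pow, Finsupp.prod_single_index, if_neg hN]
    · rfl
    · rfl
  · exact hcop.disjoint_primeFactors

end Dirichlet

variable {ι : Type*} [Fintype ι] [DecidableEq ι]

/-- The n-th coefficient of the defect is p D_n/n - C D_{n/p}/(n/p) + D_{n/p²}/(n/p²), absent terms
being 0. If p ∣ n, multiplying by n/p turns it into the recurrence, so it vanishes; if p ∤ n, only p
D_n/n is left and n is a unit. -/
theorem hondaType_of_recurrence {C : Matrix ι ι ℤ_[p]} {D : ℕ → Matrix ι ι ℤ_[p]} (h1 : D 1 = 1)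
    (h2 : ∀ m, ¬ p ∣ m → D (p * m) = C * D m)
    (h3 : ∀ m, m ≠ 0 → D (p ^ 2 * m) = C * D (p * m) - (p : ℤ_[p]) • D m) : HondaType C D := by
  have hp0 := (Fact.out : p.Prime).ne_zero
  have hp : (p : ℚ_[p]) ≠ 0 := by exact_mod_cast hp0
  refine ⟨h1 ▸ isUnit_one, fun i j n => ?_⟩
  have hcoef : PowerSeries.coeff n ((p : ℚ_[p]) • logCoeff D i j -
      ∑ l, (C i l : ℚ_[p]) • (logCoeff D l j).subst (PowerSeries.X ^ p : PowerSeries ℚ_[p]) +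
      (logCoeff D i j).subst (PowerSeries.X ^ (p ^ 2) : PowerSeries ℚ_[p])) =
      p * ((D n i j : ℚ_[p]) / n) -
      ∑ l, (C i l : ℚ_[p]) * (if p ∣ n then (D (n / p) l j : ℚ_[p]) / ((n / p : ℕ) : ℚ_[p]) else 0)
      + if p ^ 2 ∣ n then (D (n / p ^ 2) i j : ℚ_[p]) / ((n / p ^ 2 : ℕ) : ℚ_[p]) else 0 := by
    simp only [map_add, map_sub, map_sum, PowerSeries.coeff_smul,
      PowerSeries.coeff_subst_X_pow hp0, PowerSeries.coeff_subst_X_pow (pow_ne_zero 2 hp0),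
      logCoeff, PowerSeries.coeff_mk, smul_eq_mul, Algebra.algebraMap_self, RingHom.id_apply]
  rw [hcoef]
  rcases eq_or_ne n 0 with rfl | hn
  · simp
  by_cases hpn : p ∣ n
  · obtain ⟨m, rfl⟩ := hpn
    have hm : m ≠ 0 := fun h => hn (by simp [h])
    have hm' : (m : ℚ_[p]) ≠ 0 := by exact_mod_cast hm
    simp only [dvd_mul_right, if_true, Nat.mul_div_cancel_left m (Fact.out : p.Prime).pos]
    by_cases hpm : p ∣ m
    · obtain ⟨q, rfl⟩ := hpm
      have hq : q ≠ 0 := fun h => hm (by simp [h])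
      have hq' : (q : ℚ_[p]) ≠ 0 := by exact_mod_cast hq
      have e : p * (p * q) = p ^ 2 * q := by ring
      rw [e, if_pos (dvd_mul_right _ _), Nat.mul_div_cancel_left q (pow_pos (Fact.out : p.Prime).pos 2)]
      have h4 := congrArg (fun M : Matrix ι ι ℤ_[p] => (M i j : ℚ_[p])) (h3 q hq)
      simp only [Matrix.sub_apply, Matrix.mul_apply, Matrix.smul_apply, smul_eq_mul,
        PadicInt.coe_sub, PadicInt.coe_sum, PadicInt.coe_mul, PadicInt.coe_natCast] at h4
      rw [h4]
      simp only [mul_div_assoc', ← Finset.sum_div]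
      push_cast
      have : (p : ℚ_[p]) * (∑ l, (C i l : ℚ_[p]) * D (p * q) l j - p * D q i j) / (p ^ 2 * q) -
        (∑ l, (C i l : ℚ_[p]) * D (p * q) l j) / (p * q) + (D q i j : ℚ_[p]) / q = 0 := by
        field_simp
        ring
      rw [this, norm_zero]
      positivity
    · rw [if_neg (fun h => hpm (by
        rw [sq] at h
        exact Nat.dvd_of_mul_dvd_mul_left (Fact.out : p.Prime).pos h)), add_zero, h2 m hpm]
      simp only [Matrix.mul_apply, PadicInt.coe_sum, PadicInt.coe_mul, mul_div_assoc',
        ← Finset.sum_div]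
      push_cast
      rw [mul_div_mul_left _ _ hp, sub_self, norm_zero]
      positivity
  · simp only [if_neg hpn, mul_zero, Finset.sum_const_zero, sub_zero]
    rw [if_neg (fun h => hpn ((dvd_pow_self p two_ne_zero).trans h)), add_zero, norm_mul,
      Padic.norm_p, norm_div]
    have h5 : ‖(n : ℚ_[p])‖ = 1 := by
      rw [Padic.norm_natCast_eq_one_iff]
      exact ((Fact.out : p.Prime).coprime_iff_not_dvd).2 hpn
    rw [h5, div_one]
    exact mul_le_of_le_one_right (by positivity) (PadicInt.norm_le_one _)

section MulMatrix

variable {F : Type*} [Field F] {g : ℕ} (b : Module.Basis (Fin g) ℤ (𝓞 F))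

/-- `mulMatrix` as a ring homomorphism. -/
def mulMatrixHom (p : ℕ) [Fact p.Prime] : 𝓞 F →+* Matrix (Fin g) (Fin g) ℤ_[p] :=
  (Int.castRingHom ℤ_[p]).mapMatrix.comp (Algebra.leftMulMatrix b : 𝓞 F →+* _)

theorem mulMatrix_eq (a : 𝓞 F) : mulMatrix p b a = mulMatrixHom b p a := rfl

/-- The radical of (p) is the intersection of the primes above p, so some power of a is divisible by
p. -/
theorem isNilpotentModP_mulMatrix {a : 𝓞 F}
    (ha : ∀ v : Ideal (𝓞 F), v.IsPrime → (p : 𝓞 F) ∈ v → a ∈ v) :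
    IsNilpotentModP (mulMatrix p b a) := by
  have h : a ∈ (Ideal.span {(p : 𝓞 F)}).radical := by
    rw [Ideal.radical_eq_sInf, Ideal.mem_sInf]
    intro v hv
    exact ha v hv.2 (hv.1 (Ideal.mem_span_singleton_self _))
  obtain ⟨m, hm⟩ := h
  obtain ⟨c, hc⟩ := Ideal.mem_span_singleton.1 hm
  refine ⟨m, mulMatrixHom b p c, ?_⟩
  rw [mulMatrix_eq, ← map_pow, hc, map_mul, map_natCast, natCast_eq_smul_one, Matrix.smul_mul,
    one_mul]

/-- The Euler factor at p supplies the recurrences; its quadratic term is present because p ∤ N. -/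
theorem hondaType_mulMatrix {N : ℕ} (hN : ¬ p ∣ N) (a : ℕ → 𝓞 F) :
    HondaType (mulMatrix p b (a p)) fun n => mulMatrix p b (dirichletCoeff N a n) := by
  have hp := (Fact.out : p.Prime)
  refine hondaType_of_recurrence ?_ (fun m hm => ?_) fun m hm => ?_
  · simp [mulMatrix_eq, dirichletCoeff]
  · have h1 := dirichletCoeff_pow_mul N hN a 1 hm
    rw [pow_one] at h1
    rw [h1, mulMatrix_eq, map_mul]
    rfl
  · obtain ⟨k, q, hq, rfl⟩ := Nat.exists_eq_pow_mul_and_not_dvd hm p hp.ne_one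
    rw [← mul_assoc, ← mul_assoc, ← pow_add, ← pow_succ', add_comm 2,
      dirichletCoeff_pow_mul N hN a _ hq, dirichletCoeff_pow_mul N hN a _ hq,
      dirichletCoeff_pow_mul N hN a _ hq, eulerCoeff]
    simp only [mulMatrix_eq, map_mul, map_sub, map_natCast]
    rw [natCast_eq_smul_one, sub_mul, mul_assoc, smul_mul_assoc, smul_mul_assoc, one_mul]

end MulMatrix

end Padic
end

/-! ### Values of logarithms at points. -/

noncomputable section
section Padic

variable {p : ℕ} [Fact p.Prime]

theorem exists_norm_natCast_eq {n : ℕ} (hn : n ≠ 0) :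
    ∃ v : ℕ, p ^ v ≤ n ∧ ‖(n : ℚ_[p])‖⁻¹ = (p : ℝ) ^ v := by
  have hp := (Fact.out : p.Prime)
  obtain ⟨v, m, hm, rfl⟩ := Nat.exists_eq_pow_mul_and_not_dvd hn p hp.ne_one
  have hm0 : m ≠ 0 := fun h => hm (h ▸ dvd_zero p)
  refine ⟨v, Nat.le_mul_of_pos_right _ (Nat.pos_of_ne_zero hm0), ?_⟩
  have h1 : ‖(m : ℚ_[p])‖ = 1 := by
    rw [Padic.norm_natCast_eq_one_iff]
    exact hp.coprime_iff_not_dvd.2 hm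
  push_cast
  rw [norm_mul, h1, mul_one, norm_pow, Padic.norm_p, inv_pow, inv_inv]

theorem norm_natCast_inv_le (n : ℕ) : ‖(n : ℚ_[p])‖⁻¹ ≤ n := by
  rcases eq_or_ne n 0 with rfl | hn
  · simp
  obtain ⟨v, hv, h⟩ := exists_norm_natCast_eq (p := p) hn
  rw [h]
  exact_mod_cast hv

variable {M : Type*} [NormedField M] [NormedAlgebra ℚ_[p] M]

theorem exists_norm_le_lt_one {σ : Type*} [Finite σ] {x : σ → M} (hx : ∀ s, ‖x s‖ < 1) :
    ∃ r : ℝ, 0 ≤ r ∧ r < 1 ∧ ∀ s, ‖x s‖ ≤ r := by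
  rcases isEmpty_or_nonempty σ with h | h
  · exact ⟨0, le_rfl, one_pos, fun s => (h.false s).elim⟩
  · obtain ⟨s, hs⟩ := Finite.exists_max fun s => ‖x s‖
    exact ⟨‖x s‖, norm_nonneg _, hx s, hs⟩

theorem norm_prod_pow_le {σ : Type*} {x : σ → M} {r : ℝ} (hr : ∀ s, ‖x s‖ ≤ r) (d : σ →₀ ℕ) :
    ‖d.prod fun s n => x s ^ n‖ ≤ r ^ d.degree := by
  have h : d.degree = ∑ s ∈ d.support, d s := rfl
  rw [Finsupp.prod, norm_prod, h, ← Finset.prod_pow_eq_pow_sum]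
  refine Finset.prod_le_prod (fun _ _ => norm_nonneg _) fun s _ => ?_
  rw [norm_pow]
  exact pow_le_pow_left₀ (norm_nonneg _) (hr s) _

theorem norm_algebraMap_logCoeff_le {ι : Type*} (D : ℕ → Matrix ι ι ℤ_[p]) (i j : ι) (n : ℕ) :
    ‖algebraMap ℚ_[p] M ((D n i j : ℚ_[p]) / n)‖ ≤ ‖(n : ℚ_[p])‖⁻¹ := by
  rw [norm_algebraMap', norm_div, div_eq_mul_inv]
  exact mul_le_of_le_one_left (by positivity) (PadicInt.norm_le_one _)

theorem tendsto_natCast_mul_pow_cofinite {σ : Type*} [Finite σ] {r : ℝ} (h0 : 0 ≤ r)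
    (h1 : r < 1) : Filter.Tendsto (fun d : σ →₀ ℕ => (d.degree : ℝ) * r ^ d.degree)
      Filter.cofinite (nhds 0) := by
  refine (tendsto_self_mul_const_pow_of_lt_one h0 h1).comp ?_
  rw [← Nat.cofinite_eq_atTop]
  refine Filter.Tendsto.cofinite_of_finite_preimage_singleton fun n => ?_
  exact (Finsupp.finite_of_degree_le n).subset fun d hd => le_of_eq hd

variable [IsUltrametricDist M]

theorem summable_evalAt [CompleteSpace M] {σ : Type*} [Finite σ] (f : MvPowerSeries σ ℤ_[p])
    {x : σ → M} (hx : ∀ s, ‖x s‖ < 1) :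
    Summable fun d : σ →₀ ℕ => algebraMap ℚ_[p] M (MvPowerSeries.coeff d (toQp f)) *
      d.prod fun s n => x s ^ n := by
  obtain ⟨r, hr0, hr1, hr⟩ := exists_norm_le_lt_one hx
  refine NonarchimedeanAddGroup.summable_of_tendsto_cofinite_zero ?_
  have h : Filter.Tendsto (fun d : σ →₀ ℕ => r ^ d.degree) Filter.cofinite (nhds 0) := by
    refine (tendsto_pow_atTop_nhds_zero_of_lt_one hr0 hr1).comp ?_
    rw [← Nat.cofinite_eq_atTop]
    refine Filter.Tendsto.cofinite_of_finite_preimage_singleton fun n => ?_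
    exact (Finsupp.finite_of_degree_le n).subset fun d hd => le_of_eq hd
  refine squeeze_zero_norm (fun d => ?_) h
  rw [norm_mul, norm_algebraMap']
  exact (mul_le_of_le_one_left (norm_nonneg _) (norm_coeff_toQp_le_one f d)).trans
    (norm_prod_pow_le hr d)

theorem evalAt_pow [CompleteSpace M] {σ : Type*} [Finite σ] (f : MvPowerSeries σ ℤ_[p])
    (hf : f.constantCoeff = 0) {x : σ → M} (hx : ∀ s, ‖x s‖ < 1) (n : ℕ) :
    evalAt (toQp (f ^ n)) x = evalAt (toQp f) x ^ n := by
  classical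
  have h0 : MvPowerSeries.HasSubst fun _ : Unit => f :=
    MvPowerSeries.hasSubst_of_constantCoeff_zero fun _ => hf
  have h := evalAt_subst ((MvPowerSeries.X () : MvPowerSeries Unit ℤ_[p]) ^ n) (fun _ => f)
    (fun _ => hf) x hx
  rw [MvPowerSeries.subst_pow h0, MvPowerSeries.subst_X h0] at h
  rw [h, evalAt, tsum_eq_single (Finsupp.single () n)]
  · rw [MvPowerSeries.coeff_map, MvPowerSeries.coeff_X_pow]
    simp
  · intro d hd
    rw [MvPowerSeries.coeff_map, MvPowerSeries.coeff_X_pow, if_neg hd]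
    simp

theorem evalAt_sub [CompleteSpace M] {σ : Type*} [Finite σ] (f g : MvPowerSeries σ ℤ_[p])
    {x : σ → M} (hx : ∀ s, ‖x s‖ < 1) :
    evalAt (toQp (f - g)) x = evalAt (toQp f) x - evalAt (toQp g) x := by
  rw [evalAt, evalAt, evalAt, ← (summable_evalAt f hx).tsum_sub (summable_evalAt g hx)]
  refine tsum_congr fun d => ?_
  simp [sub_mul]

/-- A power series over `ℤ_p` of order at least `2` takes values of norm at most `r ^ 2`. -/
theorem norm_evalAt_le_sq {σ : Type*} {f : MvPowerSeries σ ℤ_[p]} (hf : 2 ≤ f.order)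
    {x : σ → M} {r : ℝ} (hr0 : 0 ≤ r) (hr1 : r < 1) (hr : ∀ s, ‖x s‖ ≤ r) :
    ‖evalAt (toQp f) x‖ ≤ r ^ 2 := by
  refine IsUltrametricDist.norm_tsum_le_of_forall_le_of_nonneg (by positivity) fun d => ?_
  by_cases hd : d.degree < 2
  · rw [MvPowerSeries.coeff_map, MvPowerSeries.coeff_of_lt_order
      (lt_of_lt_of_le (by exact_mod_cast hd) hf)]
    simp only [map_zero, zero_mul, norm_zero]
    positivity
  · rw [norm_mul, norm_algebraMap']
    refine (mul_le_of_le_one_left (norm_nonneg _) (norm_coeff_toQp_le_one f d)).trans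
      ((norm_prod_pow_le hr d).trans ?_)
    exact pow_le_pow_of_le_one hr0 hr1.le (not_lt.1 hd)

variable {ι : Type*} [Fintype ι]

/-- The value of the logarithm `∑ (D n / n) y ^ n`. -/
def logVal (D : ℕ → Matrix ι ι ℤ_[p]) (y : ι → M) (i : ι) : M :=
  ∑ j, ∑' n : ℕ, algebraMap ℚ_[p] M ((D n i j : ℚ_[p]) / n) * y j ^ n

omit [IsUltrametricDist M] [Fintype ι] in
theorem norm_logTerm_le (D : ℕ → Matrix ι ι ℤ_[p]) (i j : ι) (n : ℕ) (z : M) :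
    ‖algebraMap ℚ_[p] M ((D n i j : ℚ_[p]) / n) * z ^ n‖ ≤ n * ‖z‖ ^ n := by
  rw [norm_mul, norm_pow]
  gcongr
  exact (norm_algebraMap_logCoeff_le D i j n).trans (norm_natCast_inv_le n)

omit [Fintype ι] in
theorem summable_logTerm [CompleteSpace M] (D : ℕ → Matrix ι ι ℤ_[p]) (i j : ι) {z : M}
    (hz : ‖z‖ < 1) :
    Summable fun n : ℕ => algebraMap ℚ_[p] M ((D n i j : ℚ_[p]) / n) * z ^ n := by
  refine NonarchimedeanAddGroup.summable_of_tendsto_cofinite_zero ?_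
  rw [Nat.cofinite_eq_atTop]
  exact squeeze_zero_norm (fun n => norm_logTerm_le D i j n z)
    (tendsto_self_mul_const_pow_of_lt_one (norm_nonneg z) hz)

theorem MvPowerSeries.coeff_pow_eq_zero {τ R : Type*} [CommRing R] {a : MvPowerSeries τ R}
    (ha : a.constantCoeff = 0) {n : ℕ} {d : τ →₀ ℕ} (h : d.degree < n) :
    MvPowerSeries.coeff d (a ^ n) = 0 :=
  MvPowerSeries.coeff_of_lt_order (lt_of_lt_of_le (by exact_mod_cast h)
    (MvPowerSeries.le_order_pow_of_constantCoeff_eq_zero n ha))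

omit [Fintype ι] in
-- Evaluation of a composite whose outer series has denominators, so integrality alone does not
-- suffice. The double family over (n, d) vanishes unless n ≤ |d| and is bounded by |d| r^|d|,
-- because 1/n has p-adic norm at most n. It is therefore summable and may be summed in either
-- order.
theorem hasSum_coeff_logCoeff_subst [CompleteSpace M] {τ : Type*} [Finite τ]
    (D : ℕ → Matrix ι ι ℤ_[p]) {a : MvPowerSeries τ ℤ_[p]} (ha : a.constantCoeff = 0)
    {x : τ → M} (hx : ∀ t, ‖x t‖ < 1) (i j : ι) :
    HasSum (fun d : τ →₀ ℕ => algebraMap ℚ_[p] M (MvPowerSeries.coeff d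
      ((logCoeff D i j).subst (toQp a))) * d.prod fun s n => x s ^ n)
      (∑' n : ℕ, algebraMap ℚ_[p] M ((D n i j : ℚ_[p]) / n) * evalAt (toQp a) x ^ n) := by
  obtain ⟨r, hr0, hr1, hr⟩ := exists_norm_le_lt_one hx
  have ha' := constantCoeff_toQp ha
  let u : ℕ × (τ →₀ ℕ) → M := fun q => algebraMap ℚ_[p] M ((D q.1 i j : ℚ_[p]) / q.1) *
    (algebraMap ℚ_[p] M (MvPowerSeries.coeff q.2 (toQp (a ^ q.1))) *
      q.2.prod fun s n => x s ^ n)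
  have hu0 : ∀ q, q.2.degree < q.1 → u q = 0 := fun q hq => by
    simp only [u]
    rw [MvPowerSeries.coeff_map, MvPowerSeries.coeff_pow_eq_zero ha hq]
    simp
  have hu : ∀ q, ‖u q‖ ≤ (q.2.degree : ℝ) * r ^ q.2.degree := fun q => by
    by_cases hq : q.2.degree < q.1
    · rw [hu0 q hq, norm_zero]
      positivity
    · simp only [u]
      rw [norm_mul, norm_mul, norm_algebraMap' _ (MvPowerSeries.coeff _ _)]
      refine mul_le_mul ?_ ?_ (by positivity) (by positivity)
      · refine ((norm_algebraMap_logCoeff_le D i j _).trans (norm_natCast_inv_le _)).trans ?_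
        exact_mod_cast not_lt.1 hq
      · exact (mul_le_of_le_one_left (norm_nonneg _) (norm_coeff_toQp_le_one _ _)).trans
          (norm_prod_pow_le hr _)
  have hsum : Summable u := by
    refine NonarchimedeanAddGroup.summable_of_tendsto_cofinite_zero ?_
    rw [NormedAddGroup.tendsto_nhds_zero]
    intro ε hε
    have h1 := (tendsto_natCast_mul_pow_cofinite (σ := τ) hr0 hr1).eventually (gt_mem_nhds hε)
    rw [Filter.eventually_cofinite] at h1 ⊢
    refine (h1.biUnion (t := fun d => (fun n => ((n, d) : ℕ × (τ →₀ ℕ))) ''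
      (Set.Iic d.degree)) fun d _ => (Set.finite_Iic _).image _).subset ?_
    rintro ⟨n, d⟩ hnd
    have h2 : ε ≤ ‖u (n, d)‖ := not_lt.1 hnd
    refine Set.mem_biUnion (x := d) ?_ ⟨n, ?_, rfl⟩
    · exact not_lt.2 (h2.trans (hu (n, d)))
    · by_contra hlt
      rw [hu0 (n, d) (not_le.1 hlt), norm_zero] at h2
      exact absurd hε (not_lt.2 h2)
  have h1 : ∀ n, HasSum (fun d => u (n, d))
      (algebraMap ℚ_[p] M ((D n i j : ℚ_[p]) / n) * evalAt (toQp a) x ^ n) := fun n => by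
    have h := (summable_evalAt (a ^ n) hx).hasSum.mul_left
      (algebraMap ℚ_[p] M ((D n i j : ℚ_[p]) / n))
    have h' := evalAt_pow a ha hx n
    rw [evalAt] at h'
    rwa [h'] at h
  have h2 : ∀ d, HasSum (fun n => u (n, d)) (algebraMap ℚ_[p] M (MvPowerSeries.coeff d
      ((logCoeff D i j).subst (toQp a))) * d.prod fun s n => x s ^ n) := fun d => by
    have e : MvPowerSeries.coeff d ((logCoeff D i j).subst (toQp a)) =
        ∑ n ∈ Finset.range (d.degree + 1),
          ((D n i j : ℚ_[p]) / n) * MvPowerSeries.coeff d (toQp (a ^ n)) := by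
      rw [PowerSeries.coeff_subst (PowerSeries.HasSubst.of_constantCoeff_zero ha'),
        finsum_eq_sum_of_support_subset (s := Finset.range (d.degree + 1)) _ fun n hn => ?_]
      · refine Finset.sum_congr rfl fun n _ => ?_
        have e2 : toQp (a ^ n) = toQp a ^ n := map_pow _ _ _
        rw [e2, smul_eq_mul, logCoeff, PowerSeries.coeff_mk]
      · simp only [Finset.coe_range, Set.mem_Iio]
        by_contra hlt
        exact hn (by
          simp only
          rw [MvPowerSeries.coeff_pow_eq_zero ha' (by omega), smul_zero])
    rw [e, map_sum, Finset.sum_mul]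
    have h3 : HasSum (fun n => u (n, d)) (∑ n ∈ Finset.range (d.degree + 1), u (n, d)) :=
      hasSum_sum_of_ne_finset_zero (s := Finset.range (d.degree + 1)) fun n hn => hu0 (n, d) (by
        have := Finset.mem_range.not.1 hn
        simp only
        omega)
    have e2 : ∀ n, u (n, d) = algebraMap ℚ_[p] M ((D n i j : ℚ_[p]) / n *
        MvPowerSeries.coeff d (toQp (a ^ n))) * d.prod fun s n => x s ^ n := fun n => by
      simp only [u, map_mul, mul_assoc]
    simp only [e2] at h3 ⊢
    exact h3
  have h3 := hsum.hasSum.prod_fiberwise h1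
  have h4 : HasSum (u ∘ Prod.swap) (∑' q, u q) := (Equiv.prodComm _ _).hasSum_iff.2 hsum.hasSum
  have h5 := h4.prod_fiberwise h2
  rwa [← h3.tsum_eq] at h5

theorem hasSum_coeff_logSubst [CompleteSpace M] {τ : Type*} [Finite τ]
    (D : ℕ → Matrix ι ι ℤ_[p]) {a : ι → MvPowerSeries τ ℤ_[p]}
    (ha : ∀ j, (a j).constantCoeff = 0) {x : τ → M} (hx : ∀ t, ‖x t‖ < 1) (i : ι) :
    HasSum (fun d : τ →₀ ℕ => algebraMap ℚ_[p] M (MvPowerSeries.coeff d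
      (logSubst D (fun j => toQp (a j)) i)) * d.prod fun s n => x s ^ n)
      (logVal D (fun j => evalAt (toQp (a j)) x) i) := by
  have h := hasSum_sum (s := Finset.univ) fun j _ =>
    hasSum_coeff_logCoeff_subst D (ha j) hx i j
  refine (funext fun d => ?_ : (fun d : τ →₀ ℕ => _) = fun d => _) ▸ h
  rw [logSubst, map_sum, map_sum, Finset.sum_mul]

theorem hasSum_coeff_logSubst_X [CompleteSpace M] {τ : Type*} [Finite τ]
    (D : ℕ → Matrix ι ι ℤ_[p]) (v : ι → τ) {x : τ → M} (hx : ∀ t, ‖x t‖ < 1) (i : ι) :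
    HasSum (fun d : τ →₀ ℕ => algebraMap ℚ_[p] M (MvPowerSeries.coeff d
      (logSubst D (fun j => MvPowerSeries.X (v j)) i)) * d.prod fun s n => x s ^ n)
      (logVal D (fun j => x (v j)) i) := by
  have h := hasSum_coeff_logSubst D (a := fun j => (MvPowerSeries.X (v j) :
    MvPowerSeries τ ℤ_[p])) (by simp) hx i
  have e : (fun j => evalAt (toQp (MvPowerSeries.X (v j) : MvPowerSeries τ ℤ_[p])) x) =
      fun j => x (v j) := funext fun j => evalAt_X _ _
  rw [e] at h
  simpa only [toQp_X] using h

theorem evalAt_dirichletLog [CompleteSpace M] [DecidableEq ι] (D : ℕ → Matrix ι ι ℤ_[p])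
    {y : ι → M} (hy : ∀ t, ‖y t‖ < 1) (i : ι) :
    evalAt (dirichletLog (fun n => (D n).map (algebraMap ℤ_[p] ℚ_[p])) i) y = logVal D y i := by
  rw [dirichletLog_eq_logSubst]
  exact (hasSum_coeff_logSubst_X D id hy i).tsum_eq

/-- The logarithm is additive on points. -/
theorem logVal_add [CompleteSpace M] {D : ℕ → Matrix ι ι ℤ_[p]} {F : FormalGroupLaw ι ℤ_[p]}
    (hF : HasLog D F.add) (x y : F.Points M) :
    logVal D (x + y).coord = logVal D x.coord + logVal D y.coord := by
  funext i
  have hxy := FormalGroupLaw.Points.norm_elim_lt_one x y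
  have h1 := hasSum_coeff_logSubst D F.constantCoeff_add hxy i
  have h2 := (hasSum_coeff_logSubst_X D Sum.inl hxy i).add
    (hasSum_coeff_logSubst_X D Sum.inr hxy i)
  refine h1.unique ?_
  refine (funext fun d => ?_ : (fun d : ι ⊕ ι →₀ ℕ => _) = fun d => _) ▸ h2
  rw [hF i, map_add, map_add, add_mul]

theorem logVal_onPoints [CompleteSpace M] {D D' : ℕ → Matrix ι ι ℤ_[p]}
    {F G : FormalGroupLaw ι ℤ_[p]} {B : Matrix ι ι ℤ_[p]} (φ : F.Hom G)
    (hφ : logSubst D' (fun j => toQp (φ.series j)) = matAct B (logSubst D MvPowerSeries.X))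
    (x : F.Points M) : logVal D' (φ.onPoints x).coord = matAct B (logVal D x.coord) := by
  funext i
  have h1 := hasSum_coeff_logSubst D' φ.constantCoeff_series x.norm_lt_one i
  have h2 := hasSum_sum (s := Finset.univ) fun j _ =>
    (hasSum_coeff_logSubst_X D id x.norm_lt_one j).const_smul (B i j : ℚ_[p])
  refine h1.unique ?_
  refine (funext fun d => ?_ : (fun d : ι →₀ ℕ => _) = fun d => _) ▸ h2
  rw [hφ, matAct, map_sum, map_sum, Finset.sum_mul]
  refine Finset.sum_congr rfl fun j _ => ?_
  rw [MvPowerSeries.coeff_smul, map_mul, Algebra.smul_def, mul_assoc]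
  rfl

omit [IsUltrametricDist M] in
theorem logVal_map {M' : Type*} [NormedField M'] [NormedAlgebra ℚ_[p] M'] [CompleteSpace M]
    [IsUltrametricDist M]
    (D : ℕ → Matrix ι ι ℤ_[p]) (f : M →ₐ[ℚ_[p]] M') (hf : Continuous f) {y : ι → M}
    (hy : ∀ j, ‖y j‖ < 1) (i : ι) : logVal D (fun j => f (y j)) i = f (logVal D y i) := by
  rw [logVal, logVal, map_sum]
  refine Finset.sum_congr rfl fun j _ => ?_
  have h := (summable_logTerm D i j (hy j)).hasSum.map f hf
  refine Eq.trans ?_ h.tsum_eq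
  refine tsum_congr fun n => ?_
  simp

end Padic
end

/-! ### The logarithm near the origin, and its kernel. -/

noncomputable section
section Padic

variable {p : ℕ} [Fact p.Prime]
variable {M : Type*} [NormedField M] [NormedAlgebra ℚ_[p] M] [IsUltrametricDist M]
variable {ι : Type*} [Fintype ι]

/-- The value of a polynomial over `ℤ_p` in an extension of `ℚ_p`. -/
def polyVal (M : Type*) [NormedField M] [NormedAlgebra ℚ_[p] M] (f : Polynomial ℤ_[p]) (z : M) : M :=
  f.eval₂ ((algebraMap ℚ_[p] M).comp (algebraMap ℤ_[p] ℚ_[p])) z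

/-- The coefficientwise definition of ℓ gives the expected value Σ x_k 𝔣^{(k)}(z). The double family
over (k, n) is bounded by ‖y_k‖ · n‖z‖^n, a product of two null sequences, so the order of summation
can be exchanged. -/
theorem hasSum_xSeq_mul_polyVal [CompleteSpace M] [DecidableEq ι] {π : ℤ_[p]}
    (hπ : (p : ℤ_[p]) ∣ π) {C : Matrix ι ι ℤ_[p]} (hC : IsNilpotentModP C)
    {D : ℕ → Matrix ι ι ℤ_[p]} (hD : IsLtCoeff π C D) {z : M} (hz : ‖z‖ < 1) (i j : ι) :
    HasSum (fun k => algebraMap ℚ_[p] M (xSeq (C.map (algebraMap ℤ_[p] ℚ_[p])) k i j) *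
      polyVal M (ltIter π k) z)
      (∑' n : ℕ, algebraMap ℚ_[p] M ((D n i j : ℚ_[p]) / n) * z ^ n) := by
  let u : ℕ × ℕ → M := fun q => algebraMap ℚ_[p] M
    (xSeq (C.map (algebraMap ℤ_[p] ℚ_[p])) q.1 i j * ((ltIter π q.1).coeff q.2 : ℚ_[p])) * z ^ q.2
  have hu : ∀ q, ‖u q‖ ≤ ‖ySeq C q.1 i j‖ * (q.2 * ‖z‖ ^ q.2) := fun q => by
    obtain ⟨k, n⟩ := q
    simp only [u]
    rcases eq_or_ne n 0 with rfl | hn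
    · rw [ltIter_coeff_zero]
      simp
    have h := norm_mul_xSeq_mul_coeff_le π hπ C k n i j
    have hn' : 0 < ‖(n : ℚ_[p])‖ := norm_pos_iff.2 (by exact_mod_cast hn)
    rw [norm_mul, ← le_div_iff₀' hn', div_eq_mul_inv] at h
    rw [norm_mul, norm_algebraMap', norm_pow, ← mul_assoc]
    gcongr
    exact h.trans (by gcongr; exact norm_natCast_inv_le n)
  have hsum : Summable u := by
    refine NonarchimedeanAddGroup.summable_of_tendsto_cofinite_zero ?_
    refine squeeze_zero_norm hu ?_
    refine tendsto_mul_cofinite_nhds_zero (f := fun k => ‖ySeq C k i j‖)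
      (g := fun n : ℕ => (n : ℝ) * ‖z‖ ^ n) ?_ ?_
    · rw [Nat.cofinite_eq_atTop]
      exact hC.tendsto_ySeq i j
    · rw [Nat.cofinite_eq_atTop]
      exact tendsto_self_mul_const_pow_of_lt_one (norm_nonneg z) hz
  have h1 : ∀ k, HasSum (fun n => u (k, n)) (algebraMap ℚ_[p] M
      (xSeq (C.map (algebraMap ℤ_[p] ℚ_[p])) k i j) * polyVal M (ltIter π k) z) := fun k => by
    have h : HasSum (fun n => u (k, n)) (∑ n ∈ (ltIter π k).support, u (k, n)) :=
      hasSum_sum_of_ne_finset_zero fun n hn => by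
        simp [u, Polynomial.notMem_support_iff.1 hn]
    rw [polyVal, Polynomial.eval₂_eq_sum, Polynomial.sum, Finset.mul_sum]
    simp only [u, map_mul, mul_assoc] at h ⊢
    exact h
  have h2 : ∀ n, HasSum (fun k => u (k, n))
      (algebraMap ℚ_[p] M ((D n i j : ℚ_[p]) / n) * z ^ n) := fun n =>
    ((hD n i j).map (algebraMap ℚ_[p] M) (algebraMapCLM ℚ_[p] M).continuous).mul_right _
  have h3 := hsum.hasSum.prod_fiberwise h1
  have h4 : HasSum (u ∘ Prod.swap) (∑' q, u q) := (Equiv.prodComm _ _).hasSum_iff.2 hsum.hasSum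
  have h5 := h4.prod_fiberwise h2
  rwa [← h5.tsum_eq] at h3

omit [Fintype ι] in
theorem norm_pow_sub_pow_le {a b : M} {r : ℝ} (hr : 0 ≤ r) (ha : ‖a‖ ≤ r) (hb : ‖b‖ ≤ r) (n : ℕ) :
    ‖a ^ n - b ^ n‖ ≤ r ^ (n - 1) * ‖a - b‖ := by
  rw [← geom_sum₂_mul, norm_mul]
  gcongr
  refine IsUltrametricDist.norm_sum_le_of_forall_le_of_nonneg (by positivity) fun i hi => ?_
  have hi' : i + (n - 1 - i) = n - 1 := by have := Finset.mem_range.1 hi; omega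
  rw [norm_mul, norm_pow, norm_pow, ← hi', pow_add]
  simp only [hi']
  gcongr

omit [IsUltrametricDist M] [Fintype ι] in
theorem one_lt_cast_prime : (1 : ℝ) < p := by exact_mod_cast (Fact.out : p.Prime).one_lt

omit [NormedAlgebra ℚ_[p] M] in
/-- For odd `p`, the terms of degree at least `2` of a logarithm are contracting on `p 𝓞`. -/
theorem norm_natCast_inv_mul_pow_le (hp : p ≠ 2) {n : ℕ} (hn : 2 ≤ n) :
    ‖(n : ℚ_[p])‖⁻¹ * ((p : ℝ)⁻¹) ^ (n - 1) ≤ (p : ℝ)⁻¹ := by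
  obtain ⟨v, hv, h⟩ := exists_norm_natCast_eq (p := p) (n := n) (by omega)
  have hp3 : 3 ≤ p := by
    have := (Fact.out : p.Prime).two_le
    omega
  -- Otherwise p^(n-1) ≤ p^v ≤ n, although n < 3^(n-1) for n ≥ 2. For p = 2 the claim fails at n =
  -- 2.
  have hvn : v + 1 ≤ n - 1 := by
    by_contra hlt
    have h1 : p ^ (n - 1) ≤ n := (Nat.pow_le_pow_right (by omega) (by omega)).trans hv
    have h2 : 3 ^ (n - 1) ≤ p ^ (n - 1) := Nat.pow_le_pow_left hp3 _
    obtain ⟨m, rfl⟩ : ∃ m, n = m + 2 := ⟨n - 2, by omega⟩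
    have h3 : ∀ m : ℕ, m + 2 < 3 ^ (m + 1) := fun m => by
      induction m with
      | zero => norm_num
      | succ m ih => rw [pow_succ]; omega
    have := h3 m
    simp only [Nat.add_succ_sub_one] at h1 h2
    omega
  have hp1 : (1 : ℝ) < p := one_lt_cast_prime
  rw [h]
  calc (p : ℝ) ^ v * ((p : ℝ)⁻¹) ^ (n - 1) ≤ (p : ℝ) ^ v * ((p : ℝ)⁻¹) ^ (v + 1) := by
        refine mul_le_mul_of_nonneg_left ?_ (by positivity)
        exact pow_le_pow_of_le_one (by positivity) (inv_le_one_of_one_le₀ hp1.le) hvn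
    _ = (p : ℝ)⁻¹ := by
        rw [pow_succ, ← mul_assoc, ← mul_pow, mul_inv_cancel₀ (by positivity), one_pow, one_mul]

theorem norm_matAct_le (B : Matrix ι ι ℤ_[p]) {v : ι → M} {r : ℝ} (hr : 0 ≤ r)
    (hv : ∀ j, ‖v j‖ ≤ r) (i : ι) : ‖matAct B v i‖ ≤ r := by
  refine IsUltrametricDist.norm_sum_le_of_forall_le_of_nonneg hr fun j _ => ?_
  rw [norm_smul]
  exact (mul_le_of_le_one_left (norm_nonneg _) (PadicInt.norm_le_one _)).trans (hv j)

/-- On the ball of radius 1/p the terms of degree n ≥ 2 have Lipschitz constant at most ‖n‖⁻¹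
p^(1-n) ≤ 1/p. Thus the logarithm is its linear part up to a contraction. -/
theorem norm_logVal_sub_le [CompleteSpace M] (hp : p ≠ 2) (D : ℕ → Matrix ι ι ℤ_[p])
    {y z : ι → M} (hy : ∀ j, ‖y j‖ ≤ (p : ℝ)⁻¹) (hz : ∀ j, ‖z j‖ ≤ (p : ℝ)⁻¹) {δ : ℝ} (hδ : 0 ≤ δ)
    (hyz : ∀ j, ‖y j - z j‖ ≤ δ) (i : ι) :
    ‖logVal D y i - logVal D z i - matAct (D 1) (y - z) i‖ ≤ (p : ℝ)⁻¹ * δ := by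
  have hp1 : (1 : ℝ) < p := one_lt_cast_prime
  have hp1' : (p : ℝ)⁻¹ < 1 := inv_lt_one_of_one_lt₀ hp1
  rw [logVal, logVal, matAct, ← Finset.sum_sub_distrib, ← Finset.sum_sub_distrib]
  refine IsUltrametricDist.norm_sum_le_of_forall_le_of_nonneg (by positivity) fun j _ => ?_
  have h := (summable_logTerm D i j ((hy j).trans_lt hp1')).hasSum.sub
    (summable_logTerm D i j ((hz j).trans_lt hp1')).hasSum
  have h1 := h.sub (hasSum_ite_eq 1 ((D 1 i j : ℚ_[p]) • (y - z) j))
  rw [← h1.tsum_eq]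
  refine IsUltrametricDist.norm_tsum_le_of_forall_le_of_nonneg (by positivity) fun n => ?_
  rcases eq_or_ne n 1 with rfl | hn1
  · simp only [Nat.cast_one, div_one, pow_one, if_true, Pi.sub_apply, ← mul_sub, Algebra.smul_def,
      sub_self, norm_zero]
    positivity
  rw [if_neg hn1, sub_zero, ← mul_sub, norm_mul]
  rcases eq_or_ne n 0 with rfl | hn0
  · simp only [pow_zero, sub_self, norm_zero, mul_zero]
    positivity
  calc _ ≤ ‖(n : ℚ_[p])‖⁻¹ * (((p : ℝ)⁻¹) ^ (n - 1) * ‖y j - z j‖) := by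
        refine mul_le_mul (norm_algebraMap_logCoeff_le D i j n)
          (norm_pow_sub_pow_le (by positivity) (hy j) (hz j) n) (norm_nonneg _) (by positivity)
    _ ≤ _ := by
        rw [← mul_assoc]
        exact mul_le_mul (norm_natCast_inv_mul_pow_le hp (by omega)) (hyz j) (norm_nonneg _)
          (by positivity)

omit [IsUltrametricDist M] in
theorem logVal_zero (D : ℕ → Matrix ι ι ℤ_[p]) : logVal D (0 : ι → M) = 0 := by
  funext i
  refine Finset.sum_eq_zero fun j _ => ?_
  rw [tsum_eq_single 0]
  · simp
  · intro n hn
    simp [hn]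

variable [DecidableEq ι]

omit [IsUltrametricDist M] in
theorem matAct_inv_mul {A : Matrix ι ι ℤ_[p]} (hA : IsUnit A) (v : ι → M) :
    matAct A⁻¹ (matAct A v) = v := by
  rw [← matAct_mul, Matrix.nonsing_inv_mul _ ((Matrix.isUnit_iff_isUnit_det A).1 hA), matAct_one]

/-- Inverting D 1 does not increase norms, so equal logarithms force ‖y - z‖ ≤ ‖y - z‖ / p. -/
theorem eq_of_logVal_eq [CompleteSpace M] (hp : p ≠ 2) {D : ℕ → Matrix ι ι ℤ_[p]}
    (hD : IsUnit (D 1)) {y z : ι → M} (hy : ∀ j, ‖y j‖ ≤ (p : ℝ)⁻¹) (hz : ∀ j, ‖z j‖ ≤ (p : ℝ)⁻¹)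
    (h : logVal D y = logVal D z) : y = z := by
  have hp1 : (1 : ℝ) < p := one_lt_cast_prime
  have hp1' : (p : ℝ)⁻¹ < 1 := inv_lt_one_of_one_lt₀ hp1
  have h0 : 0 ≤ ‖y - z‖ := norm_nonneg _
  have h1 : ‖y - z‖ ≤ (p : ℝ)⁻¹ * ‖y - z‖ := by
    refine (pi_norm_le_iff_of_nonneg (by positivity)).2 fun i => ?_
    have e : (y - z) i = matAct (D 1)⁻¹ (matAct (D 1) (y - z)) i := by rw [matAct_inv_mul hD]
    rw [e]
    refine norm_matAct_le _ (by positivity) (fun j => ?_) i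
    have h2 := norm_logVal_sub_le hp D hy hz h0 (norm_le_pi_norm (y - z)) j
    rwa [h, sub_self, zero_sub, norm_neg] at h2
  have h2 : ‖y - z‖ = 0 := by nlinarith
  exact sub_eq_zero.1 (norm_eq_zero.1 h2)

/-- The solution is the fixed point of y ↦ y - (D 1)⁻¹(log y - w), a contraction of the ball of
radius 1/p. This will produce ε. -/
theorem exists_logVal_eq [CompleteSpace M] (hp : p ≠ 2) {D : ℕ → Matrix ι ι ℤ_[p]}
    (hD : IsUnit (D 1)) {w : ι → M} (hw : ∀ j, ‖w j‖ ≤ (p : ℝ)⁻¹) :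
    ∃ y : ι → M, (∀ j, ‖y j‖ ≤ (p : ℝ)⁻¹) ∧ logVal D y = w := by
  have hp1 : (1 : ℝ) < p := one_lt_cast_prime
  have hp1' : (p : ℝ)⁻¹ < 1 := inv_lt_one_of_one_lt₀ hp1
  let T : (ι → M) → ι → M := fun y => y - matAct (D 1)⁻¹ (logVal D y - w)
  let s : Set (ι → M) := {y | ∀ j, ‖y j‖ ≤ (p : ℝ)⁻¹}
  have hT : ∀ y ∈ s, ∀ z ∈ s, ∀ δ, 0 ≤ δ → (∀ j, ‖y j - z j‖ ≤ δ) →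
      ∀ i, ‖T y i - T z i‖ ≤ (p : ℝ)⁻¹ * δ := fun y hy z hz δ hδ hyz i => by
    have e : T y - T z = - matAct (D 1)⁻¹ (logVal D y - logVal D z - matAct (D 1) (y - z)) := by
      simp only [T]
      rw [matAct_sub_right _ (logVal D y - logVal D z), matAct_inv_mul hD]
      simp only [matAct_sub_right]
      abel
    have e' : T y i - T z i =
        - matAct (D 1)⁻¹ (logVal D y - logVal D z - matAct (D 1) (y - z)) i := congrFun e i
    rw [e', norm_neg]
    exact norm_matAct_le _ (by positivity) (fun j => norm_logVal_sub_le hp D hy hz hδ hyz j) i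
  have hs0 : (0 : ι → M) ∈ s := fun j => by
    rw [Pi.zero_apply, norm_zero]
    positivity
  have hms : Set.MapsTo T s s := fun y hy i => by
    have h1 := hT y hy 0 hs0 (p : ℝ)⁻¹ (by positivity) (fun j => by simpa using hy j) i
    have h2 : ‖T 0 i‖ ≤ (p : ℝ)⁻¹ := by
      simp only [T, logVal_zero, zero_sub, matAct_neg_right, neg_neg]
      exact norm_matAct_le _ (by positivity) hw i
    have h3 := IsUltrametricDist.norm_add_le_max (T y i - T 0 i) (T 0 i)
    rw [sub_add_cancel] at h3
    refine h3.trans (max_le (h1.trans ?_) h2)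
    exact mul_le_of_le_one_left (by positivity) hp1'.le
  have hsc : IsComplete s := by
    refine IsClosed.isComplete ?_
    simp only [s, Set.ofPred_forall]
    exact isClosed_iInter fun j => isClosed_le (continuous_apply j).norm continuous_const
  have hK : (⟨(p : ℝ)⁻¹, by positivity⟩ : NNReal) < 1 := hp1'
  have hcon : ContractingWith ⟨(p : ℝ)⁻¹, by positivity⟩ (hms.restrict T s s) := by
    refine ⟨hK, LipschitzWith.of_dist_le_mul fun y z => ?_⟩
    rw [Subtype.dist_eq, Subtype.dist_eq, dist_eq_norm, dist_eq_norm]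
    refine (pi_norm_le_iff_of_nonneg (mul_nonneg (NNReal.coe_nonneg _) (norm_nonneg _))).2 fun i => ?_
    exact hT y y.2 z z.2 _ (norm_nonneg _) (norm_le_pi_norm ((y : ι → M) - (z : ι → M))) i
  obtain ⟨y, hy, hfix, -⟩ := hcon.exists_fixedPoint' hsc hms hs0 (edist_ne_top _ _)
  refine ⟨y, hy, ?_⟩
  have h1 : matAct (D 1)⁻¹ (logVal D y - w) = 0 := sub_eq_self.1 hfix
  have h2 := congrArg (matAct (D 1)) h1
  rw [← matAct_mul, Matrix.mul_nonsing_inv _ ((Matrix.isUnit_iff_isUnit_det _).1 hD), matAct_one,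
    matAct_zero_right] at h2
  exact sub_eq_zero.1 h2

/-! ### Torsion points -/

/-- Comparing linear parts in log F = log x + log y and cancelling the invertible D 1 gives F(x, y)
≡ x + y modulo degree 2. -/
theorem HasLog.two_le_order {D : ℕ → Matrix ι ι ℤ_[p]} (hD : IsUnit (D 1))
    {F : FormalGroupLaw ι ℤ_[p]} (hF : HasLog D F.add) (i : ι) :
    2 ≤ (F.add i - MvPowerSeries.X (Sum.inl i) - MvPowerSeries.X (Sum.inr i)).order := by
  have h1 : ∀ (s : ι ⊕ ι) (l : ι), (∑ j, D 1 l j * MvPowerSeries.coeff (Finsupp.single s 1)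
      (F.add j - MvPowerSeries.X (Sum.inl j) - MvPowerSeries.X (Sum.inr j))) = 0 := fun s l => by
    have h := congrArg (MvPowerSeries.coeff (Finsupp.single s 1)) (hF l)
    rw [map_add, coeff_single_logSubst _ (fun j => constantCoeff_toQp (F.constantCoeff_add j)),
      coeff_single_logSubst _ (by simp), coeff_single_logSubst _ (by simp)] at h
    have hinj : Function.Injective (algebraMap ℤ_[p] ℚ_[p]) := IsFractionRing.injective _ _
    refine hinj ?_
    rw [map_zero, map_sum]
    simp only [map_mul, map_sub, mul_sub, Finset.sum_sub_distrib]
    rw [sub_sub, sub_eq_zero]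
    simp only [← MvPowerSeries.coeff_map, MvPowerSeries.map_X]
    exact h
  have h2 : ∀ (s : ι ⊕ ι), MvPowerSeries.coeff (Finsupp.single s 1)
      (F.add i - MvPowerSeries.X (Sum.inl i) - MvPowerSeries.X (Sum.inr i)) = 0 := fun s => by
    have h3 : (D 1).mulVec (fun j => MvPowerSeries.coeff (Finsupp.single s 1)
      (F.add j - MvPowerSeries.X (Sum.inl j) - MvPowerSeries.X (Sum.inr j))) =
        (D 1).mulVec 0 := by
      rw [Matrix.mulVec_zero]
      exact funext (h1 s)
    exact congrFun (Matrix.mulVec_injective_of_isUnit hD h3) i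
  refine MvPowerSeries.le_order fun d hd => ?_
  have hd2 : d.degree < 2 := by exact_mod_cast hd
  rcases Nat.lt_succ_iff_lt_or_eq.1 hd2 with h | h
  · rw [(Finsupp.degree_eq_zero_iff d).1 (by omega)]
    simp [F.constantCoeff_add]
  · obtain ⟨s, rfl⟩ := (Finsupp.sum_eq_one_iff d).1 h
    exact h2 s

variable [FiniteDimensional ℚ_[p] M]

section Torsion
variable {D : ℕ → Matrix ι ι ℤ_[p]} {F : FormalGroupLaw ι ℤ_[p]}

theorem norm_add_coord_sub_le (hD : IsUnit (D 1)) (hF : HasLog D F.add) {x y : F.Points M} {r : ℝ}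
    (hr0 : 0 ≤ r) (hr1 : r < 1) (hx : ∀ j, ‖x.coord j‖ ≤ r) (hy : ∀ j, ‖y.coord j‖ ≤ r) (i : ι) :
    ‖(x + y).coord i - x.coord i - y.coord i‖ ≤ r ^ 2 := by
  have := FiniteDimensional.complete ℚ_[p] M
  have h := FormalGroupLaw.Points.norm_elim_lt_one x y
  have e := norm_evalAt_le_sq (HasLog.two_le_order hD hF i) (x := Sum.elim x.coord y.coord) hr0 hr1
    (by rintro (j | j); exacts [hx j, hy j])
  rwa [evalAt_sub _ _ h, evalAt_sub _ _ h, evalAt_X, evalAt_X] at e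

theorem norm_nsmul_coord_le (hD : IsUnit (D 1)) (hF : HasLog D F.add) {x : F.Points M} {r : ℝ}
    (hr0 : 0 ≤ r) (hr1 : r < 1) (hx : ∀ j, ‖x.coord j‖ ≤ r) (n : ℕ) (i : ι) :
    ‖(n • x).coord i - n * x.coord i‖ ≤ r ^ 2 ∧ ‖(n • x).coord i‖ ≤ r := by
  have hn : ∀ n : ℕ, ‖(n : M)‖ ≤ 1 := IsUltrametricDist.norm_natCast_le_one M
  have hrr : r ^ 2 ≤ r := by nlinarith
  induction n generalizing i with
  | zero =>
    rw [zero_smul, FormalGroupLaw.Points.zero_coord]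
    simp only [Nat.cast_zero, zero_mul, sub_zero, norm_zero]
    exact ⟨by positivity, hr0⟩
  | succ n ih =>
    have h1 : ‖((n + 1) • x).coord i - (n + 1 : ℕ) * x.coord i‖ ≤ r ^ 2 := by
      have h := norm_add_coord_sub_le hD hF hr0 hr1 (fun j => (ih j).2) hx i
      have e : ((n + 1) • x).coord i - (n + 1 : ℕ) * x.coord i =
          ((n • x + x).coord i - (n • x).coord i - x.coord i) +
            ((n • x).coord i - n * x.coord i) := by
        rw [succ_nsmul]
        push_cast
        ring
      rw [e]
      exact (IsUltrametricDist.norm_add_le_max _ _).trans (max_le h (ih i).1)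
    refine ⟨h1, ?_⟩
    have h := IsUltrametricDist.norm_add_le_max (((n + 1) • x).coord i - (n + 1 : ℕ) * x.coord i)
      ((n + 1 : ℕ) * x.coord i)
    rw [sub_add_cancel] at h
    refine h.trans (max_le (h1.trans hrr) ?_)
    rw [norm_mul]
    exact (mul_le_of_le_one_left (norm_nonneg _) (hn _)).trans (hx i)

/-- Since [p](x) is p x up to terms of size ‖x‖², multiplication by p shrinks a point of norm at
most r by the factor max(1/p, r) < 1. -/
theorem exists_norm_pow_nsmul_coord_le (hD : IsUnit (D 1)) (hF : HasLog D F.add)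
    (x : F.Points M) : ∃ m : ℕ, ∀ i, ‖(p ^ m • x).coord i‖ ≤ (p : ℝ)⁻¹ := by
  obtain ⟨r, hr0, hr1, hr⟩ := exists_norm_le_lt_one x.norm_lt_one
  have hp1 : (1 : ℝ) < p := one_lt_cast_prime
  have hp1' : (p : ℝ)⁻¹ < 1 := inv_lt_one_of_one_lt₀ hp1
  have hpM : ‖(p : M)‖ = (p : ℝ)⁻¹ := by
    rw [← map_natCast (algebraMap ℚ_[p] M), norm_algebraMap', Padic.norm_p]
  set s := max (p : ℝ)⁻¹ r with hs
  have hs0 : 0 ≤ s := hr0.trans (le_max_right _ _)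
  have hs1 : s < 1 := max_lt hp1' hr1
  have key : ∀ m i, ‖(p ^ m • x).coord i‖ ≤ s ^ m * r := fun m => by
    induction m with
    | zero => simpa using hr
    | succ m ih =>
      intro i
      have hm0 : 0 ≤ s ^ m * r := by positivity
      have hmr : s ^ m * r ≤ r := mul_le_of_le_one_left hr0 (pow_le_one₀ hs0 hs1.le)
      have h1 := (norm_nsmul_coord_le hD hF hm0 (hmr.trans_lt hr1) ih p i).1
      have e : p ^ (m + 1) • x = p • (p ^ m • x) := by rw [pow_succ', mul_nsmul']
      have h2 := IsUltrametricDist.norm_add_le_max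
        ((p • (p ^ m • x)).coord i - p * (p ^ m • x).coord i) (p * (p ^ m • x).coord i)
      rw [sub_add_cancel] at h2
      rw [e]
      refine h2.trans (max_le (h1.trans ?_) ?_)
      · rw [sq, pow_succ', mul_assoc s]
        exact mul_le_mul_of_nonneg_right (hmr.trans (le_max_right _ _)) hm0
      · rw [norm_mul, hpM, pow_succ', mul_assoc]
        exact mul_le_mul (le_max_left _ _) (ih i) (norm_nonneg _) hs0
  obtain ⟨m, hm⟩ := exists_pow_lt_of_lt_one (inv_pos.2 (zero_lt_one.trans hp1)) hs1
  exact ⟨m, fun i => (key m i).trans ((mul_le_of_le_one_right (by positivity) hr1.le).trans hm.le)⟩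

/-- The logarithm as a homomorphism. -/
def logHom (hF : HasLog D F.add) (M : Type*) [NormedField M] [NormedAlgebra ℚ_[p] M]
    [IsUltrametricDist M] [FiniteDimensional ℚ_[p] M] : F.Points M →+ (ι → M) :=
  have := FiniteDimensional.complete ℚ_[p] M
  AddMonoidHom.mk' (fun x => logVal D x.coord) (logVal_add hF)

omit [DecidableEq ι] in
theorem logHom_apply (hF : HasLog D F.add) (x : F.Points M) : logHom hF M x = logVal D x.coord :=
  rfl

/-- A multiple by a power of p lies in the ball where the logarithm is injective, and its logarithm
is still 0. -/
theorem exists_pow_nsmul_eq_zero (hp : p ≠ 2) (hD : IsUnit (D 1)) (hF : HasLog D F.add)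
    {x : F.Points M} (hx : logHom hF M x = 0) : ∃ m : ℕ, p ^ m • x = 0 := by
  have := FiniteDimensional.complete ℚ_[p] M
  obtain ⟨m, hm⟩ := exists_norm_pow_nsmul_coord_le hD hF x
  refine ⟨m, FormalGroupLaw.Points.ext (eq_of_logVal_eq hp hD hm (fun j => ?_) ?_)⟩
  · rw [FormalGroupLaw.Points.zero_coord, norm_zero]
    positivity
  · rw [← logHom_apply hF, ← logHom_apply hF, map_nsmul, hx, smul_zero, map_zero]

theorem padic_norm_le_inv {z : ℚ_[p]} (hz : ‖z‖ < 1) : ‖z‖ ≤ (p : ℝ)⁻¹ := by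
  have h := (PadicInt.norm_le_pow_iff_norm_lt_pow_add_one (⟨z, hz.le⟩ : ℤ_[p]) (-1)).2
    (by simpa using hz)
  simpa using h

end Torsion

end Padic
end

/-! ### Injectivity of the logarithm over cyclic p-extensions, and traces. -/

noncomputable section
section Padic

variable {p : ℕ} [Fact p.Prime]
variable {ι : Type*} [Fintype ι]
variable {F : FormalGroupLaw ι ℤ_[p]} {D : ℕ → Matrix ι ι ℤ_[p]}

section Map

variable {M M' : Type*} [NormedField M] [NormedAlgebra ℚ_[p] M] [IsUltrametricDist M]
  [NormedField M'] [NormedAlgebra ℚ_[p] M'] [IsUltrametricDist M']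

theorem evalAt_map [CompleteSpace M] {σ : Type*} [Finite σ] (f : MvPowerSeries σ ℤ_[p])
    (g : M →ₐ[ℚ_[p]] M') (hg : Continuous g) {x : σ → M} (hx : ∀ s, ‖x s‖ < 1) :
    evalAt (toQp f) (fun s => g (x s)) = g (evalAt (toQp f) x) := by
  have h := (summable_evalAt f hx).hasSum.map g hg
  refine Eq.trans ?_ h.tsum_eq
  refine tsum_congr fun d => ?_
  simp [Finsupp.prod, map_prod]

variable [FiniteDimensional ℚ_[p] M] [FiniteDimensional ℚ_[p] M']

omit [FiniteDimensional ℚ_[p] M'] in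
theorem AlgHom.continuous_of_finiteDimensional_padic (g : M →ₐ[ℚ_[p]] M') : Continuous g :=
  g.toLinearMap.continuous_of_finiteDimensional

/-- `F(𝔪_M) → F(𝔪_M')` as a group homomorphism. -/
def FormalGroupLaw.Points.mapHom (g : M →ₐ[ℚ_[p]] M') : F.Points M →+ F.Points M' :=
  AddMonoidHom.mk' (FormalGroupLaw.Points.map g) fun x y => by
    have := FiniteDimensional.complete ℚ_[p] M
    refine FormalGroupLaw.Points.ext (funext fun i => ?_)
    refine (evalAt_map (F.add i) g g.continuous_of_finiteDimensional_padic
      (FormalGroupLaw.Points.norm_elim_lt_one x y)).symm.trans ?_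
    rw [FormalGroupLaw.Points.add_coord]
    congr 1
    funext s
    rcases s with j | j <;> rfl

theorem logHom_map (hF : HasLog D F.add) (g : M →ₐ[ℚ_[p]] M') (x : F.Points M) (i : ι) :
    logHom hF M' (x.map g) i = g (logHom hF M x i) := by
  have := FiniteDimensional.complete ℚ_[p] M
  exact logVal_map D g g.continuous_of_finiteDimensional_padic x.norm_lt_one i

end Map

/-- An automorphism of `p`-power order of an abelian group fixes a nonzero element of every stable
subgroup that contains an element of order `p`. -/
theorem exists_fixed_of_pow_eq_one (hp : p ≠ 2) {A : Type*} [AddCommGroup A]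
    (s : AddMonoid.End A) {n : ℕ} (hs : s ^ p ^ n = 1) (S : AddSubgroup A)
    (hS : ∀ y ∈ S, s y ∈ S) {y : A} (hyS : y ∈ S) (hy0 : y ≠ 0) (hy : p • y = 0) :
    ∃ z ∈ S, z ≠ 0 ∧ s z = z := by
  have hpp := (Fact.out : p.Prime)
  have hodd : Odd (p ^ n) := (hpp.odd_of_ne_two hp).pow
  -- Modulo p, (s - 1)^(p^n) is s^(p^n) + (-1)^(p^n), which is 1 - 1 = 0 because p^n is odd.
  obtain ⟨r, hr⟩ : ∃ r : AddMonoid.End A, (s - 1) ^ p ^ n = r * (p : AddMonoid.End A) := by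
    have h := (Commute.neg_right (Commute.one_right s)).add_pow_prime_pow_eq hpp n
    rw [← sub_eq_add_neg, hs, hodd.neg_one_pow, add_neg_cancel, zero_add] at h
    rw [mul_assoc, mul_assoc, (Nat.cast_commute p _).eq] at h
    exact ⟨_, h⟩
  have hkill : ((s - 1) ^ p ^ n) y = 0 := by
    rw [hr]
    change r ((p : AddMonoid.End A) y) = 0
    rw [AddMonoid.End.natCast_apply, hy, map_zero]
  have hex : ∃ m : ℕ, ((s - 1) ^ m) y = 0 := ⟨_, hkill⟩
  classical
  have hm := Nat.find_spec hex
  -- With m + 1 the least exponent killing y, the nonzero element (s - 1)^m y is fixed by s.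
  obtain ⟨m, hm'⟩ : ∃ m, Nat.find hex = m + 1 := Nat.exists_eq_succ_of_ne_zero fun h0 => by
    rw [h0, pow_zero] at hm
    exact hy0 hm
  have hmem : ∀ m : ℕ, ((s - 1) ^ m) y ∈ S := fun m => by
    induction m with
    | zero => exact hyS
    | succ m ih =>
      rw [pow_succ']
      exact S.sub_mem (hS _ ih) ih
  refine ⟨((s - 1) ^ m) y, hmem m, Nat.find_min hex (by omega), ?_⟩
  rw [hm', pow_succ'] at hm
  exact sub_eq_zero.1 hm

/-- A nonzero kernel contains a point of order p, hence, as the Galois group is cyclic of p-power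
order, a nonzero fixed point. Its coordinates lie in pℤ_p, where the logarithm is injective for odd
p. -/
theorem logHom_injective [DecidableEq ι] (hp : p ≠ 2) (hD : IsUnit (D 1)) (hF : HasLog D F.add)
    (K : IntermediateField ℚ_[p] (PadicAlgCl p)) [FiniteDimensional ℚ_[p] K] [IsGalois ℚ_[p] K]
    [IsCyclic (K ≃ₐ[ℚ_[p]] K)] {n : ℕ} (hn : Module.finrank ℚ_[p] K = p ^ n) :
    Function.Injective (logHom hF K) := by
  rw [injective_iff_map_eq_zero]
  intro x hx
  by_contra hx0
  obtain ⟨m, hm⟩ := exists_pow_nsmul_eq_zero hp hD hF hx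
  obtain ⟨y, hy, hy0, hpy⟩ : ∃ y, logHom hF K y = 0 ∧ y ≠ 0 ∧ p • y = 0 := by
    induction m with
    | zero => simp at hm; exact absurd hm hx0
    | succ m ih =>
      by_cases h : p ^ m • x = 0
      · exact ih h
      · refine ⟨p ^ m • x, ?_, h, ?_⟩
        · rw [map_nsmul, hx, smul_zero]
        · rw [← hm, pow_succ', mul_nsmul']
  obtain ⟨g, hg⟩ := IsCyclic.exists_generator (α := K ≃ₐ[ℚ_[p]] K)
  let s : AddMonoid.End (F.Points K) := FormalGroupLaw.Points.mapHom (g : K →ₐ[ℚ_[p]] K)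
  have hpow : ∀ m x i, ((s ^ m) x).coord i = (g ^ m) (x.coord i) := fun m => by
    induction m with
    | zero => exact fun x i => rfl
    | succ m ih =>
      intro x i
      rw [pow_succ', pow_succ', AlgEquiv.mul_apply, ← ih]
      rfl
  have hcard : g ^ p ^ n = 1 := by
    rw [← hn, ← IsGalois.card_aut_eq_finrank]
    exact pow_card_eq_one'
  have hs : s ^ p ^ n = 1 := by
    ext x i
    rw [hpow, hcard]
    rfl
  obtain ⟨z, hzS, hz0, hz⟩ := exists_fixed_of_pow_eq_one hp s hs (logHom hF K).ker
    (fun y hy => by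
      rw [AddMonoidHom.mem_ker] at hy ⊢
      funext i
      refine (logHom_map hF _ y i).trans ?_
      rw [hy, Pi.zero_apply, map_zero]) hy hy0 hpy
  refine hz0 ?_
  have hzg : ∀ i, g (z.coord i) = z.coord i := fun i =>
    congrFun (congrArg FormalGroupLaw.Points.coord hz) i
  have hfix : ∀ (τ : K ≃ₐ[ℚ_[p]] K) i, τ (z.coord i) = z.coord i := fun τ i => by
    have hle : Subgroup.zpowers g ≤ MulAction.stabilizer (K ≃ₐ[ℚ_[p]] K) (z.coord i) :=
      (Subgroup.zpowers_le).2 (hzg i)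
    exact hle (hg τ)
  -- The norm bound improves from < 1 to ≤ 1/p because the fixed coordinates lie in ℚ_p, whose
  -- valuation is discrete with uniformizer p.
  have hnorm : ∀ i, ‖z.coord i‖ ≤ (p : ℝ)⁻¹ := fun i => by
    have hbot : z.coord i ∈ (⊥ : IntermediateField ℚ_[p] K) :=
      (IsGalois.mem_bot_iff_fixed _).2 fun τ => hfix τ i
    obtain ⟨q, hq⟩ := IntermediateField.mem_bot.1 hbot
    have hlt := z.norm_lt_one i
    rw [← hq, norm_algebraMap'] at hlt ⊢
    exact padic_norm_le_inv hlt
  have := FiniteDimensional.complete ℚ_[p] K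
  refine FormalGroupLaw.Points.ext (eq_of_logVal_eq hp hD hnorm (fun j => ?_) ?_)
  · rw [FormalGroupLaw.Points.zero_coord, norm_zero]
    positivity
  · rw [← logHom_apply hF, ← logHom_apply hF, map_zero]
    exact hzS

/-! ### Traces -/

section Trace

variable {M₁ M₂ : IntermediateField ℚ_[p] (PadicAlgCl p)}

/-- The normalized trace to `K` on the algebraic closure. -/
def avg (K : IntermediateField ℚ_[p] (PadicAlgCl p)) : PadicAlgCl p →ₗ[ℚ_[p]] PadicAlgCl p :=
  (((Algebra.linearMap K (PadicAlgCl p)).comp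
    (Algebra.normalizedTrace K (PadicAlgCl p))).restrictScalars ℚ_[p])

theorem avg_apply (K : IntermediateField ℚ_[p] (PadicAlgCl p)) (z : PadicAlgCl p) :
    avg K z = (Algebra.normalizedTrace K (PadicAlgCl p) z : K) := rfl

theorem avg_mem (K : IntermediateField ℚ_[p] (PadicAlgCl p)) (z : PadicAlgCl p) : avg K z ∈ K :=
  (Algebra.normalizedTrace K (PadicAlgCl p) z : K).2

theorem avg_of_mem {K : IntermediateField ℚ_[p] (PadicAlgCl p)} {z : PadicAlgCl p} (hz : z ∈ K) :
    avg K z = z := by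
  rw [avg_apply]
  have h := Algebra.normalizedTrace_algebraMap_apply_eq_self K (PadicAlgCl p) ⟨z, hz⟩
  exact congrArg Subtype.val h

theorem avg_avg (h : M₂ ≤ M₁) (z : PadicAlgCl p) : avg M₂ (avg M₁ z) = avg M₂ z := by
  let _ : Algebra M₂ M₁ := (IntermediateField.inclusion h).toRingHom.toAlgebra
  have : IsScalarTower M₂ M₁ (PadicAlgCl p) := IsScalarTower.of_algebraMap_eq fun _ => rfl
  have : IsScalarTower ℚ_[p] M₂ M₁ := IsScalarTower.of_algebraMap_eq fun _ => rfl
  have : Algebra.IsIntegral M₂ M₁ := Algebra.IsIntegral.tower_top ℚ_[p]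
  have h1 := Algebra.normalizedTrace_trans_apply M₂ M₁ (PadicAlgCl p) z
  have h2 := Algebra.normalizedTrace_algebraMap_apply M₂ M₁ (PadicAlgCl p)
    (Algebra.normalizedTrace M₁ (PadicAlgCl p) z)
  exact congrArg Subtype.val (h2.trans h1)

theorem avg_minpoly (K : IntermediateField ℚ_[p] (PadicAlgCl p)) (z : PadicAlgCl p) :
    avg K z = -((minpoly K z).nextCoeff : PadicAlgCl p) / (minpoly K z).natDegree := by
  rw [avg_apply, Algebra.normalizedTrace_minpoly, smul_eq_mul]
  push_cast
  ring

theorem avg_algHom (K : IntermediateField ℚ_[p] (PadicAlgCl p))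
    (τ : PadicAlgCl p →ₐ[ℚ_[p]] PadicAlgCl p) (hτ : ∀ z ∈ K, τ z = z) (z : PadicAlgCl p) :
    avg K (τ z) = avg K z := by
  let τ' : PadicAlgCl p →ₐ[K] PadicAlgCl p := { τ with commutes' := fun x => hτ x x.2 }
  exact congrArg Subtype.val (Algebra.normalizedTrace_map K (PadicAlgCl p) τ' z)

open scoped Classical in
/-- The automorphisms of `M₁` that fix `M₂`. -/
def galFix (M₁ M₂ : IntermediateField ℚ_[p] (PadicAlgCl p)) [FiniteDimensional ℚ_[p] M₁] :
    Finset (M₁ ≃ₐ[ℚ_[p]] M₁) :=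
  {σ | ∀ z : M₁, (z : PadicAlgCl p) ∈ M₂ → σ z = z}

variable [FiniteDimensional ℚ_[p] M₁]

theorem mem_galFix {σ : M₁ ≃ₐ[ℚ_[p]] M₁} :
    σ ∈ galFix M₁ M₂ ↔ ∀ z : M₁, (z : PadicAlgCl p) ∈ M₂ → σ z = z := by
  simp [galFix]

theorem mem_galFix_iff_mem_fixingSubgroup (h : M₂ ≤ M₁) {σ : M₁ ≃ₐ[ℚ_[p]] M₁} :
    σ ∈ galFix M₁ M₂ ↔ σ ∈ (IntermediateField.restrict h).fixingSubgroup := by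
  rw [mem_galFix, IntermediateField.mem_fixingSubgroup_iff]
  simp only [IntermediateField.mem_restrict]

theorem mem_of_galFix_fixed (h : M₂ ≤ M₁) [IsGalois ℚ_[p] M₁] {z : M₁}
    (hz : ∀ σ ∈ galFix M₁ M₂, σ z = z) : (z : PadicAlgCl p) ∈ M₂ := by
  rw [← IntermediateField.mem_restrict h, ← IsGalois.fixedField_fixingSubgroup
    (IntermediateField.restrict h), IntermediateField.mem_fixedField_iff]
  exact fun σ hσ => hz σ ((mem_galFix_iff_mem_fixingSubgroup h).2 hσ)

theorem card_galFix_mul (h : M₂ ≤ M₁) [IsGalois ℚ_[p] M₁] :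
    Module.finrank ℚ_[p] M₂ * (galFix M₁ M₂).card = Module.finrank ℚ_[p] M₁ := by
  have h1 := IsGalois.card_fixingSubgroup_eq_finrank (IntermediateField.restrict h)
  have h2 : (galFix M₁ M₂).card = Nat.card (IntermediateField.restrict h).fixingSubgroup := by
    rw [← Fintype.card_coe, ← Nat.card_eq_fintype_card]
    exact Nat.card_congr (Equiv.subtypeEquivRight fun σ => mem_galFix_iff_mem_fixingSubgroup h)
  rw [h2, h1, (IntermediateField.restrictAlgEquiv h).toLinearEquiv.finrank_eq]
  exact Module.finrank_mul_finrank _ _ _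

theorem sum_galFix_reindex {A : Type*} [AddCommMonoid A] {τ : M₁ ≃ₐ[ℚ_[p]] M₁}
    (hτ : τ ∈ galFix M₁ M₂) (f : (M₁ ≃ₐ[ℚ_[p]] M₁) → A) :
    ∑ σ ∈ galFix M₁ M₂, f (τ * σ) = ∑ σ ∈ galFix M₁ M₂, f σ := by
  rw [mem_galFix] at hτ
  refine Finset.sum_bij' (fun σ _ => τ * σ) (fun σ _ => τ⁻¹ * σ) (fun σ hσ => ?_) (fun σ hσ => ?_)
    (fun σ _ => by simp) (fun σ _ => by simp) fun σ _ => rfl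
  · rw [mem_galFix] at hσ ⊢
    intro z hz
    rw [AlgEquiv.mul_apply, hσ z hz, hτ z hz]
  · rw [mem_galFix] at hσ ⊢
    intro z hz
    rw [AlgEquiv.mul_apply, hσ z hz]
    exact (AlgEquiv.symm_apply_eq τ).2 (hτ z hz).symm

/-- The trace of `z` is the degree times its normalized trace. -/
theorem sum_galFix_apply (h : M₂ ≤ M₁) [IsGalois ℚ_[p] M₁] (z : M₁) :
    ((∑ σ ∈ galFix M₁ M₂, σ z : M₁) : PadicAlgCl p) =
      (galFix M₁ M₂).card * avg M₂ (z : PadicAlgCl p) := by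
  -- The sum is fixed by the group, so it lies in M₂ and equals its own normalized trace; conjugates
  -- have equal normalized traces.
  have hmem : ((∑ σ ∈ galFix M₁ M₂, σ z : M₁) : PadicAlgCl p) ∈ M₂ :=
    mem_of_galFix_fixed h fun τ hτ => by
      rw [map_sum]
      exact sum_galFix_reindex hτ fun σ => σ z
  have hconj : ∀ σ ∈ galFix M₁ M₂, avg M₂ (σ z : M₁) = avg M₂ (z : PadicAlgCl p) := fun σ hσ => by
    rw [mem_galFix] at hσ
    have e : σ.liftNormal (PadicAlgCl p) z = (σ z : M₁) := σ.liftNormal_commutes _ z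
    rw [← e]
    refine avg_algHom M₂ (σ.liftNormal (PadicAlgCl p) : PadicAlgCl p →ₐ[ℚ_[p]] PadicAlgCl p)
      (fun w hw => ?_) z
    have e2 : σ.liftNormal (PadicAlgCl p) w = (σ ⟨w, h hw⟩ : M₁) :=
      σ.liftNormal_commutes _ (⟨w, h hw⟩ : M₁)
    refine e2.trans ?_
    rw [hσ ⟨w, h hw⟩ hw]
  rw [← avg_of_mem hmem, AddSubmonoidClass.coe_finsetSum, map_sum, Finset.sum_congr rfl hconj,
    Finset.sum_const, nsmul_eq_mul]

variable [FiniteDimensional ℚ_[p] M₂]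

theorem isTrace_iff (h : M₂ ≤ M₁) (x : F.Points M₁) (y : F.Points M₂) :
    F.IsTrace h x y ↔ y.map (IntermediateField.inclusion h) =
      ∑ σ ∈ galFix M₁ M₂, FormalGroupLaw.Points.mapHom (σ : M₁ →ₐ[ℚ_[p]] M₁) x :=
  Iff.rfl

/-- Translation by an element of the group permutes the summands, so the coordinates of the sum are
Galois-fixed and descend to M₂. -/
theorem exists_isTrace (h : M₂ ≤ M₁) [IsGalois ℚ_[p] M₁] (x : F.Points M₁) :
    ∃ y : F.Points M₂, F.IsTrace h x y := by
  set s := ∑ σ ∈ galFix M₁ M₂, FormalGroupLaw.Points.mapHom (σ : M₁ →ₐ[ℚ_[p]] M₁) x with hs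
  have hfix : ∀ τ ∈ galFix M₁ M₂, ∀ i, τ (s.coord i) = s.coord i := fun τ hτ i => by
    have h1 : FormalGroupLaw.Points.mapHom (τ : M₁ →ₐ[ℚ_[p]] M₁) s = s := by
      rw [hs, map_sum]
      exact sum_galFix_reindex hτ fun σ =>
        FormalGroupLaw.Points.mapHom (σ : M₁ →ₐ[ℚ_[p]] M₁) x
    exact congrFun (congrArg FormalGroupLaw.Points.coord h1) i
  have hmem := fun i => mem_of_galFix_fixed h fun τ hτ => hfix τ hτ i
  exact ⟨⟨fun i => ⟨s.coord i, hmem i⟩, fun i => s.norm_lt_one i⟩, rfl⟩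

/-- The logarithm of a point, with coordinates in the algebraic closure. -/
def logCl (D : ℕ → Matrix ι ι ℤ_[p]) {K : IntermediateField ℚ_[p] (PadicAlgCl p)}
    (x : F.Points K) (i : ι) : PadicAlgCl p := (logVal D x.coord i : K)

omit [FiniteDimensional ℚ_[p] M₂] in
theorem logCl_sum_galFix (hF : HasLog D F.add) (h : M₂ ≤ M₁) [IsGalois ℚ_[p] M₁]
    (x : F.Points M₁) (i : ι) :
    logCl D (∑ σ ∈ galFix M₁ M₂, FormalGroupLaw.Points.mapHom (σ : M₁ →ₐ[ℚ_[p]] M₁) x) i =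
      (galFix M₁ M₂).card * avg M₂ (logCl D x i) := by
  rw [logCl, logCl, ← sum_galFix_apply h, ← logHom_apply hF, map_sum, Finset.sum_apply]
  refine congrArg Subtype.val (Finset.sum_congr rfl fun σ _ => ?_)
  exact logHom_map hF _ x i

theorem logCl_map (h : M₂ ≤ M₁) (hF : HasLog D F.add) (y : F.Points M₂) :
    logCl D (y.map (IntermediateField.inclusion h)) = logCl D y := by
  funext i
  exact congrArg Subtype.val (logHom_map hF (IntermediateField.inclusion h) y i)

theorem logCl_of_isTrace (hF : HasLog D F.add) {h : M₂ ≤ M₁} [IsGalois ℚ_[p] M₁]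
    {x : F.Points M₁} {y : F.Points M₂} (hxy : F.IsTrace h x y) (i : ι) :
    logCl D y i = (galFix M₁ M₂).card * avg M₂ (logCl D x i) := by
  rw [isTrace_iff] at hxy
  rw [← logCl_map h hF, hxy, logCl_sum_galFix hF h]

/-- Injectivity of the logarithm over M₁ reduces a trace relation between points to a linear
identity in the algebraic closure. Only this direction needs injectivity. -/
theorem isTrace_of_logCl (hF : HasLog D F.add) {h : M₂ ≤ M₁} [IsGalois ℚ_[p] M₁]
    (hinj : Function.Injective (logHom hF M₁))
    {x : F.Points M₁} {y : F.Points M₂}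
    (hxy : ∀ i, logCl D y i = (galFix M₁ M₂).card * avg M₂ (logCl D x i)) : F.IsTrace h x y := by
  rw [isTrace_iff]
  refine hinj (funext fun i => Subtype.ext ?_)
  have h1 := hxy i
  rw [← logCl_map h hF, ← logCl_sum_galFix hF h] at h1
  exact h1

theorem logCl_add {K : IntermediateField ℚ_[p] (PadicAlgCl p)} [FiniteDimensional ℚ_[p] K]
    (hF : HasLog D F.add) (x y : F.Points K) : logCl D (x + y) = logCl D x + logCl D y := by
  funext i
  exact congrArg Subtype.val (congrFun (map_add (logHom hF K) x y) i)

theorem logCl_sub {K : IntermediateField ℚ_[p] (PadicAlgCl p)} [FiniteDimensional ℚ_[p] K]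
    (hF : HasLog D F.add) (x y : F.Points K) : logCl D (x - y) = logCl D x - logCl D y := by
  funext i
  exact congrArg Subtype.val (congrFun (map_sub (logHom hF K) x y) i)

theorem logCl_onPoints {K : IntermediateField ℚ_[p] (PadicAlgCl p)} [FiniteDimensional ℚ_[p] K]
    {B : Matrix ι ι ℤ_[p]} (φ : F.Hom F)
    (hφ : logSubst D (fun j => toQp (φ.series j)) = matAct B (logSubst D MvPowerSeries.X))
    (x : F.Points K) : logCl D (φ.onPoints x) = matAct B (logCl D x) := by
  have := FiniteDimensional.complete ℚ_[p] K
  funext i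
  have h := congrArg Subtype.val (congrFun (logVal_onPoints φ hφ x) i)
  refine h.trans ((AddSubmonoidClass.coe_finsetSum _ _).trans (Finset.sum_congr rfl fun j _ => rfl))

theorem logCl_map_ofId {K : IntermediateField ℚ_[p] (PadicAlgCl p)} [FiniteDimensional ℚ_[p] K]
    (hF : HasLog D F.add) (x : F.Points ℚ_[p]) (i : ι) :
    logCl D (x.map (Algebra.ofId ℚ_[p] K)) i = algebraMap ℚ_[p] (PadicAlgCl p) (logVal D x.coord i) :=
  congrArg Subtype.val (logHom_map hF (Algebra.ofId ℚ_[p] K) x i)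

end Trace

end Padic
end

/-! ### Degrees and normalized traces of Lubin–Tate torsion points. -/

noncomputable section
section Padic

variable {p : ℕ} [Fact p.Prime]

/-! ### Division polynomials of the Lubin-Tate group -/

theorem ltFrob_coeff (π : ℤ_[p]) {n : ℕ} (hn : 2 ≤ n) : (ltFrob π).coeff n = (p.choose n : ℤ_[p]) := by
  rw [ltFrob, Polynomial.coeff_add, Polynomial.finsetSum_coeff, Polynomial.coeff_C_mul,
    Polynomial.coeff_X_of_ne_one (by omega), mul_zero, zero_add]
  simp only [Polynomial.coeff_C_mul_X_pow]
  rw [Finset.sum_ite_eq]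
  split_ifs with h
  · rfl
  · rw [Nat.choose_eq_zero_of_lt, Nat.cast_zero]
    simp only [Finset.mem_Icc] at h
    omega

theorem natDegree_ltFrob (π : ℤ_[p]) : (ltFrob π).natDegree = p := by
  have h2 := (Fact.out : p.Prime).two_le
  refine Polynomial.natDegree_eq_of_le_of_coeff_ne_zero ?_ ?_
  · refine Polynomial.natDegree_le_iff_coeff_eq_zero.2 fun n hn => ?_
    rw [ltFrob_coeff π (by omega), Nat.choose_eq_zero_of_lt hn, Nat.cast_zero]
  · rw [ltFrob_coeff π h2, Nat.choose_self, Nat.cast_one]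
    exact one_ne_zero

theorem monic_ltFrob (π : ℤ_[p]) : (ltFrob π).Monic := by
  rw [Polynomial.Monic, Polynomial.leadingCoeff, natDegree_ltFrob,
    ltFrob_coeff π (Fact.out : p.Prime).two_le, Nat.choose_self, Nat.cast_one]

theorem natDegree_ltIter (π : ℤ_[p]) (n : ℕ) : (ltIter π n).natDegree = p ^ n := by
  induction n with
  | zero => rw [ltIter, Polynomial.natDegree_X, pow_zero]
  | succ n ih => rw [ltIter, Polynomial.natDegree_comp, ih, natDegree_ltFrob, pow_succ']

theorem monic_ltIter (π : ℤ_[p]) (n : ℕ) : (ltIter π n).Monic := by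
  induction n with
  | zero => exact Polynomial.monic_X
  | succ n ih =>
    refine (monic_ltFrob π).comp ih ?_
    rw [natDegree_ltIter]
    exact pow_ne_zero _ (Fact.out : p.Prime).ne_zero

theorem dvd_ltIter_sub (π : ℤ_[p]) (hπ : (p : ℤ_[p]) ∣ π) (n : ℕ) :
    (p : Polynomial ℤ_[p]) ∣ ltIter π n - Polynomial.X ^ p ^ n := by
  induction n with
  | zero => simp [ltIter]
  | succ n ih =>
    obtain ⟨g, hg⟩ := dvd_ltFrob_sub π hπ
    have h1 : ltIter π (n + 1) = ltIter π n ^ p + p * g.comp (ltIter π n) := by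
      have h2 := congrArg (fun f => f.comp (ltIter π n)) hg
      simp only [Polynomial.sub_comp, Polynomial.X_pow_comp, Polynomial.mul_comp,
        Polynomial.natCast_comp] at h2
      rw [ltIter, ← h2]
      ring
    rw [h1, pow_succ, pow_mul, add_sub_right_comm]
    exact dvd_add (ih.trans (sub_dvd_pow_sub_pow _ _ p)) (dvd_mul_right _ _)

/-- `𝔣(X) / X` -/
def ltQuot (π : ℤ_[p]) : Polynomial ℤ_[p] := (ltFrob π).divX

theorem ltQuot_mul_X (π : ℤ_[p]) : ltQuot π * Polynomial.X = ltFrob π := by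
  have h := Polynomial.divX_mul_X_add (ltFrob π)
  rwa [ltFrob_coeff_zero, Polynomial.C_0, add_zero] at h

theorem ltQuot_coeff (π : ℤ_[p]) (n : ℕ) : (ltQuot π).coeff n = (ltFrob π).coeff (n + 1) :=
  Polynomial.coeff_divX

theorem natDegree_ltQuot (π : ℤ_[p]) : (ltQuot π).natDegree = p - 1 := by
  rw [ltQuot, Polynomial.natDegree_divX_eq_natDegree_tsub_one, natDegree_ltFrob]

theorem monic_ltQuot (π : ℤ_[p]) : (ltQuot π).Monic := by
  have h1 := (Fact.out : p.Prime).one_lt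
  rw [Polynomial.Monic, Polynomial.leadingCoeff, natDegree_ltQuot, ltQuot_coeff,
    Nat.sub_add_cancel h1.le]
  have h := monic_ltFrob π
  rwa [Polynomial.Monic, Polynomial.leadingCoeff, natDegree_ltFrob] at h

/-- `𝔣^{(n+1)} / 𝔣^{(n)}` -/
def ltPhi (π : ℤ_[p]) (n : ℕ) : Polynomial ℤ_[p] := (ltQuot π).comp (ltIter π n)

theorem ltPhi_mul (π : ℤ_[p]) (n : ℕ) : ltPhi π n * ltIter π n = ltIter π (n + 1) := by
  rw [ltIter, ← ltQuot_mul_X, Polynomial.mul_comp, Polynomial.X_comp, ltPhi]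

theorem natDegree_ltPhi (π : ℤ_[p]) (n : ℕ) : (ltPhi π n).natDegree = (p - 1) * p ^ n := by
  rw [ltPhi, Polynomial.natDegree_comp, natDegree_ltQuot, natDegree_ltIter]

theorem monic_ltPhi (π : ℤ_[p]) (n : ℕ) : (ltPhi π n).Monic := by
  refine (monic_ltQuot π).comp (monic_ltIter π n) ?_
  rw [natDegree_ltIter]
  exact pow_ne_zero _ (Fact.out : p.Prime).ne_zero

theorem dvd_ltPhi_sub (π : ℤ_[p]) (hπ : (p : ℤ_[p]) ∣ π) (n : ℕ) :
    (p : Polynomial ℤ_[p]) ∣ ltPhi π n - Polynomial.X ^ ((p - 1) * p ^ n) := by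
  have hp1 := (Fact.out : p.Prime).one_lt
  have h1 : (Polynomial.C (p : ℤ_[p])) ∣ ltQuot π - Polynomial.X ^ (p - 1) := by
    have h := dvd_ltFrob_sub π hπ
    have e : (p : Polynomial ℤ_[p]) = Polynomial.C (p : ℤ_[p]) := by simp
    rw [e, Polynomial.C_dvd_iff_dvd_coeff] at h
    rw [Polynomial.C_dvd_iff_dvd_coeff]
    intro i
    have h2 := h (i + 1)
    rw [Polynomial.coeff_sub, Polynomial.coeff_X_pow] at h2
    rw [Polynomial.coeff_sub, ltQuot_coeff, Polynomial.coeff_X_pow]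
    have e2 : (i = p - 1) ↔ (i + 1 = p) := by omega
    simpa only [e2] using h2
  obtain ⟨g, hg⟩ := h1
  have h2 := congrArg (fun f => f.comp (ltIter π n)) hg
  simp only [Polynomial.sub_comp, Polynomial.X_pow_comp, Polynomial.mul_comp,
    map_natCast, Polynomial.natCast_comp] at h2
  have e : ltPhi π n - Polynomial.X ^ ((p - 1) * p ^ n) =
      (p : Polynomial ℤ_[p]) * g.comp (ltIter π n) +
      (ltIter π n ^ (p - 1) - (Polynomial.X ^ p ^ n) ^ (p - 1)) := by
    rw [← h2, ltPhi, ← pow_mul, mul_comm (p ^ n)]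
    ring
  rw [e]
  exact dvd_add (dvd_mul_right _ _) ((dvd_ltIter_sub π hπ n).trans (sub_dvd_pow_sub_pow _ _ _))

/-- Eisenstein at p: the polynomial is a power of X modulo p, and its constant term π is exactly
divisible by p. -/
theorem irreducible_ltPhi {π c : ℤ_[p]} (hπ : π = p * (1 + p * c)) (n : ℕ) :
    Irreducible ((ltPhi π n).map (algebraMap ℤ_[p] ℚ_[p])) := by
  have hp := (Fact.out : p.Prime)
  rw [← (monic_ltPhi π n).irreducible_iff_irreducible_map_fraction_map]
  have hprime : (Ideal.span {(p : ℤ_[p])}).IsPrime := by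
    rw [Ideal.span_singleton_prime PadicInt.prime_p.ne_zero]
    exact PadicInt.prime_p
  have hE : (ltPhi π n).IsEisensteinAt (Ideal.span {(p : ℤ_[p])}) := by
    refine ⟨?_, fun {i} hi => ?_, ?_⟩
    · rw [monic_ltPhi π n]
      exact fun h => hprime.ne_top ((Ideal.eq_top_iff_one _).2 h)
    · have h := dvd_ltPhi_sub π ⟨_, hπ⟩ n
      have e : (p : Polynomial ℤ_[p]) = Polynomial.C (p : ℤ_[p]) := by simp
      rw [e, Polynomial.C_dvd_iff_dvd_coeff] at h
      have h2 := h i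
      rw [natDegree_ltPhi] at hi
      rw [Polynomial.coeff_sub, Polynomial.coeff_X_pow, if_neg hi.ne, sub_zero] at h2
      exact Ideal.mem_span_singleton.2 h2
    · have h0 : (ltPhi π n).coeff 0 = π := by
        rw [ltPhi, Polynomial.coeff_zero_eq_eval_zero, Polynomial.eval_comp,
          ← Polynomial.coeff_zero_eq_eval_zero, ltIter_coeff_zero,
          ← Polynomial.coeff_zero_eq_eval_zero, ltQuot_coeff, zero_add, ltFrob_coeff_one]
      rw [h0, Ideal.span_singleton_pow, Ideal.mem_span_singleton, hπ, sq,
        mul_dvd_mul_iff_left PadicInt.prime_p.ne_zero]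
      intro h
      exact PadicInt.prime_p.not_isUnit (isUnit_of_dvd_one
        ((dvd_add_left (dvd_mul_right _ _)).1 h))
  refine hE.irreducible hprime (monic_ltPhi π n).isPrimitive ?_
  rw [natDegree_ltPhi]
  exact Nat.mul_pos (by have := hp.one_lt; omega) (pow_pos hp.pos n)

theorem evalPoly_eq_aeval (f : Polynomial ℤ_[p]) (x : PadicAlgCl p) :
    evalPoly f x = Polynomial.aeval x (f.map (algebraMap ℤ_[p] ℚ_[p])) := by
  rw [evalPoly, Polynomial.aeval_def, Polynomial.eval₂_map]

theorem evalPoly_mul (f g : Polynomial ℤ_[p]) (x : PadicAlgCl p) :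
    evalPoly (f * g) x = evalPoly f x * evalPoly g x := Polynomial.eval₂_mul _ _

theorem evalPoly_comp (f g : Polynomial ℤ_[p]) (x : PadicAlgCl p) :
    evalPoly (f.comp g) x = evalPoly f (evalPoly g x) := by
  rw [evalPoly_eq_aeval, evalPoly_eq_aeval, evalPoly_eq_aeval, Polynomial.map_comp,
    Polynomial.aeval_comp]

section PiSequence

variable {π : ℤ_[p]} {e : ℕ → PadicAlgCl p}

theorem IsPiSequence.norm_lt_one (he : IsPiSequence π e) (n : ℕ) : ‖e n‖ < 1 := by
  cases n with
  | zero => rw [he.zero, norm_zero]; exact one_pos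
  | succ n => exact (he.mem n).1

theorem IsPiSequence.evalPoly_ltIter (he : IsPiSequence π e) (k n : ℕ) :
    evalPoly (ltIter π k) (e (n + k)) = e n := by
  induction k generalizing n with
  | zero => exact Polynomial.eval₂_X _ _
  | succ k ih => rw [ltIter_succ, evalPoly_comp, ← add_assoc, he.map_succ, ih]

theorem evalPoly_ltIter_zero (π : ℤ_[p]) (k : ℕ) : evalPoly (ltIter π k) 0 = 0 := by
  have h := Polynomial.hom_eval₂ (ltIter π k) (RingHom.id ℤ_[p])
    ((algebraMap ℚ_[p] (PadicAlgCl p)).comp (algebraMap ℤ_[p] ℚ_[p])) 0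
  rw [map_zero, RingHom.comp_id, Polynomial.eval₂_id, ← Polynomial.coeff_zero_eq_eval_zero,
    ltIter_coeff_zero, map_zero] at h
  exact h.symm

theorem IsPiSequence.evalPoly_ltIter_of_le (he : IsPiSequence π e) {k n : ℕ} (h : n ≤ k) :
    evalPoly (ltIter π k) (e n) = 0 := by
  obtain ⟨m, rfl⟩ := Nat.exists_eq_add_of_le' h
  have h1 : ltIter π (m + n) = (ltIter π m).comp (ltIter π n) := by
    clear h
    induction n with
    | zero => simp [ltIter]
    | succ n ih => rw [← add_assoc, ltIter_succ, ih, ltIter_succ, Polynomial.comp_assoc]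
  have h2 := he.evalPoly_ltIter n 0
  rw [zero_add] at h2
  rw [h1, evalPoly_comp, h2, he.zero, evalPoly_ltIter_zero]

theorem IsPiSequence.evalPoly_ltPhi (he : IsPiSequence π e) (n : ℕ) :
    evalPoly (ltPhi π n) (e (n + 1)) = 0 := by
  have h1 := (he.mem n).2
  rw [← ltPhi_mul, evalPoly_mul] at h1
  exact (mul_eq_zero.1 h1).resolve_right fun h => he.notMem n ⟨(he.mem n).1, h⟩

theorem IsPiSequence.finrank_adjoin {c : ℤ_[p]} (hπ : π = p * (1 + p * c))
    (he : IsPiSequence π e) (n : ℕ) :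
    Module.finrank ℚ_[p] (IntermediateField.adjoin ℚ_[p] {e (n + 1)}) = (p - 1) * p ^ n := by
  have h0 := he.evalPoly_ltPhi n
  rw [evalPoly_eq_aeval] at h0
  rw [IntermediateField.adjoin.finrank (Algebra.IsIntegral.isIntegral _),
    ← minpoly.eq_of_irreducible_of_monic (irreducible_ltPhi hπ n) h0
      ((monic_ltPhi π n).map _), (monic_ltPhi π n).natDegree_map, natDegree_ltPhi]

/-- The normalized trace of an element can be read off from any monic polynomial of the right
degree. -/
theorem avg_eq_of_aeval_eq_zero (K : IntermediateField ℚ_[p] (PadicAlgCl p))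
    [FiniteDimensional ℚ_[p] K] {x : PadicAlgCl p} {q : Polynomial K} (hq : q.Monic)
    (hx : Polynomial.aeval x q = 0) (hdeg : Module.finrank ℚ_[p] K * q.natDegree =
      Module.finrank ℚ_[p] (IntermediateField.adjoin ℚ_[p] {x})) :
    avg K x = -(q.nextCoeff : PadicAlgCl p) / q.natDegree := by
  have hint : IsIntegral K x := Algebra.IsIntegral.isIntegral x
  have h : q = minpoly K x := by
    refine Polynomial.eq_of_monic_of_dvd_of_natDegree_le (minpoly.monic hint) hq
      (minpoly.dvd K x hx) ?_
    -- The degree of K(x) over ℚ_p is at least that of ℚ_p(x), which by hypothesis is [K : ℚ_p] deg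
    -- q. So the minimal polynomial over K, a divisor of q, has at least the degree of q.
    have h1 := IntermediateField.adjoin.finrank hint
    have : FiniteDimensional K (IntermediateField.adjoin K {x}) :=
      IntermediateField.adjoin.finiteDimensional hint
    have : FiniteDimensional ℚ_[p] (IntermediateField.adjoin K {x}) := Module.Finite.trans K _
    let E := (IntermediateField.adjoin K {x}).restrictScalars ℚ_[p]
    have : FiniteDimensional ℚ_[p] E := this
    have hle : IntermediateField.adjoin ℚ_[p] {x} ≤ E := by
      rw [IntermediateField.adjoin_simple_le_iff]
      exact IntermediateField.mem_adjoin_simple_self K x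
    have h2 : Module.finrank ℚ_[p] (IntermediateField.adjoin ℚ_[p] {x}) ≤
        Module.finrank ℚ_[p] E :=
      LinearMap.finrank_le_finrank_of_injective
        (f := (IntermediateField.inclusion hle).toLinearMap)
        (IntermediateField.inclusion_injective hle)
    have h3 : Module.finrank ℚ_[p] K * Module.finrank K (IntermediateField.adjoin K {x}) =
      Module.finrank ℚ_[p] E :=
        Module.finrank_mul_finrank ℚ_[p] K (IntermediateField.adjoin K {x})
    rw [← h3, ← hdeg, h1] at h2
    exact Nat.le_of_mul_le_mul_left h2 Module.finrank_pos
  rw [avg_minpoly, ← h]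

/-- The minimal polynomial 𝔣(X)/X of e_1 has degree p - 1 and second coefficient p. For p = 2 that
coefficient would be π instead. -/
theorem IsPiSequence.avg_one {c : ℤ_[p]} (hp : p ≠ 2) (hπ : π = p * (1 + p * c))
    (he : IsPiSequence π e) (K : IntermediateField ℚ_[p] (PadicAlgCl p))
    [FiniteDimensional ℚ_[p] K] (hK : Module.finrank ℚ_[p] K = 1) :
    ((p : PadicAlgCl p) - 1) * avg K (e 1) = -p := by
  have h2 := (Fact.out : p.Prime).two_le
  have hq := (monic_ltQuot π).map ((algebraMap ℚ_[p] K).comp (algebraMap ℤ_[p] ℚ_[p]))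
  have hd := (monic_ltQuot π).natDegree_map ((algebraMap ℚ_[p] K).comp (algebraMap ℤ_[p] ℚ_[p]))
  rw [natDegree_ltQuot] at hd
  have hx := he.evalPoly_ltPhi 0
  rw [ltPhi, ltIter, Polynomial.comp_X] at hx
  have h := avg_eq_of_aeval_eq_zero K hq (x := e 1) (by
    rw [Polynomial.aeval_def, Polynomial.eval₂_map]
    exact hx) (by
    rw [he.finrank_adjoin hπ 0, hd, hK, one_mul, pow_zero, mul_one])
  rw [h, hd, Polynomial.nextCoeff_of_natDegree_pos (by rw [hd]; omega), hd, Polynomial.coeff_map,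
    ltQuot_coeff, ltFrob_coeff π (by omega)]
  have e1 : p - 1 - 1 + 1 = p - 1 := by omega
  have e2 : p.choose (p - 1) = p := by
    rw [Nat.choose_symm_of_eq_add (b := 1) (by omega), Nat.choose_one_right]
  have e3 : ((p - 1 : ℕ) : PadicAlgCl p) = (p : PadicAlgCl p) - 1 := by
    rw [Nat.cast_sub (by omega), Nat.cast_one]
  have e4 : ((p - 1 : ℕ) : PadicAlgCl p) ≠ 0 := by
    exact_mod_cast (by omega : p - 1 ≠ 0)
  rw [e1, e2, ← e3, mul_div_cancel₀ _ e4]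
  simp

/-- Over a field of the degree of ℚ_p(e_{n+1}) containing e_{n+1}, the minimal polynomial of e_{n+2}
is 𝔣(X) - e_{n+1}. Its degree and its coefficient of X^(p-1) are both p, so the normalized trace is
-p/p. -/
theorem IsPiSequence.avg_succ {c : ℤ_[p]} (hp : p ≠ 2) (hπ : π = p * (1 + p * c))
    (he : IsPiSequence π e) (n : ℕ) (K : IntermediateField ℚ_[p] (PadicAlgCl p))
    [FiniteDimensional ℚ_[p] K] (hK : Module.finrank ℚ_[p] K = (p - 1) * p ^ n)
    (hmem : e (n + 1) ∈ K) : avg K (e (n + 2)) = -1 := by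
  have h2 := (Fact.out : p.Prime).two_le
  have h0 : (ltFrob π).natDegree = p := natDegree_ltFrob π
  have hm := (monic_ltFrob π).map ((algebraMap ℚ_[p] K).comp (algebraMap ℤ_[p] ℚ_[p]))
  have hd := (monic_ltFrob π).natDegree_map ((algebraMap ℚ_[p] K).comp (algebraMap ℤ_[p] ℚ_[p]))
  rw [natDegree_ltFrob] at hd
  set q := (ltFrob π).map ((algebraMap ℚ_[p] K).comp (algebraMap ℤ_[p] ℚ_[p])) with hqd
  have hlt : (Polynomial.C (⟨e (n + 1), hmem⟩ : K)).degree < q.degree := by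
    refine lt_of_le_of_lt Polynomial.degree_C_le ?_
    rw [Polynomial.degree_eq_natDegree hm.ne_zero, hd]
    exact_mod_cast (by omega : 0 < p)
  have hm2 : (q - Polynomial.C (⟨e (n + 1), hmem⟩ : K)).Monic := hm.sub_of_left hlt
  have hd2 : (q - Polynomial.C (⟨e (n + 1), hmem⟩ : K)).natDegree = p := by
    rw [Polynomial.natDegree_sub_C, hd]
  have h := avg_eq_of_aeval_eq_zero K hm2 (x := e (n + 2)) (by
    rw [map_sub, Polynomial.aeval_C, Polynomial.aeval_def, hqd, Polynomial.eval₂_map]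
    exact sub_eq_zero.2 (he.map_succ (n + 1))) (by
    rw [he.finrank_adjoin hπ (n + 1), hd2, hK, pow_succ, mul_assoc])
  rw [h, hd2, Polynomial.nextCoeff_of_natDegree_pos (by rw [hd2]; omega), hd2,
    Polynomial.coeff_sub, Polynomial.coeff_C_of_ne_zero (by omega), sub_zero, hqd,
    Polynomial.coeff_map, ltFrob_coeff π (by omega)]
  have e2 : p.choose (p - 1) = p := by
    rw [Nat.choose_symm_of_eq_add (b := 1) (by omega), Nat.choose_one_right]
  have e4 : (p : PadicAlgCl p) ≠ 0 := by
    exact_mod_cast (by omega : p ≠ 0)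
  have e5 : ((p : K) : PadicAlgCl p) = p := map_natCast (algebraMap K (PadicAlgCl p)) p
  rw [e2, map_natCast, e5, neg_div, div_self e4]

end PiSequence

end Padic
end

/-! ### The fields k_n and L_n. -/

noncomputable section
section Padic

variable {p : ℕ} [Fact p.Prime]

/-- In a cyclic group x^m = 1 has at most m solutions, so a subgroup of order m is the whole
solution set. -/
theorem Subgroup.eq_of_card_eq_of_isCyclic {G : Type*} [Group G] [Finite G] [IsCyclic G]
    {H K : Subgroup G} (h : Nat.card H = Nat.card K) : H = K := by
  classical
  have := Fintype.ofFinite G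
  have key : ∀ H : Subgroup G, (H : Set G) = {g | g ^ Nat.card H = 1} := fun H => by
    have hle : (H : Set G).toFinset ⊆ Finset.univ.filter fun g : G => g ^ Nat.card H = 1 := by
      intro g hg
      rw [Set.mem_toFinset] at hg
      simp only [Finset.mem_filter, Finset.mem_univ, true_and]
      exact congrArg Subtype.val (pow_card_eq_one' (x := (⟨g, hg⟩ : H)))
    have hcard : (Finset.univ.filter fun g : G => g ^ Nat.card H = 1).card ≤
        (H : Set G).toFinset.card := by
      refine (IsCyclic.card_pow_eq_one_le Nat.card_pos).trans (le_of_eq ?_)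
      rw [Set.toFinset_card, ← Nat.card_eq_fintype_card]
      rfl
    have := Finset.eq_of_subset_of_card_le hle hcard
    ext g
    have h2 := Finset.ext_iff.1 this g
    simpa using h2
  refine SetLike.coe_injective ?_
  rw [key H, key K, h]

section Fields

variable {K₁ K₂ L : IntermediateField ℚ_[p] (PadicAlgCl p)}

theorem IntermediateField.finrank_dvd_finrank_of_le (h : K₁ ≤ L) :
    Module.finrank ℚ_[p] K₁ ∣ Module.finrank ℚ_[p] L := by
  rw [(IntermediateField.restrictAlgEquiv h).toLinearEquiv.finrank_eq]
  exact ⟨_, (Module.finrank_mul_finrank ℚ_[p] (IntermediateField.restrict h) L).symm⟩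

/-- In a finite cyclic extension, a subfield is determined by its degree. -/
theorem IntermediateField.eq_of_finrank_eq_of_isCyclic [FiniteDimensional ℚ_[p] L]
    [IsGalois ℚ_[p] L] [IsCyclic (L ≃ₐ[ℚ_[p]] L)] (h₁ : K₁ ≤ L) (h₂ : K₂ ≤ L)
    (h : Module.finrank ℚ_[p] K₁ = Module.finrank ℚ_[p] K₂) : K₁ = K₂ := by
  have key : ∀ {K : IntermediateField ℚ_[p] (PadicAlgCl p)} (hK : K ≤ L),
      Module.finrank ℚ_[p] K * Nat.card (IntermediateField.restrict hK).fixingSubgroup =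
        Module.finrank ℚ_[p] L := fun {K} hK => by
    rw [(IntermediateField.restrictAlgEquiv hK).toLinearEquiv.finrank_eq,
      IsGalois.card_fixingSubgroup_eq_finrank]
    exact Module.finrank_mul_finrank _ _ _
  have hpos : 0 < Module.finrank ℚ_[p] K₁ := Nat.pos_of_ne_zero fun h0 => by
    have h1 := key h₁
    rw [h0, zero_mul] at h1
    exact Module.finrank_pos.ne h1
  have h2 := (key h₁).trans (key h₂).symm
  rw [h] at h2 hpos
  have h3 := Subgroup.eq_of_card_eq_of_isCyclic (Nat.eq_of_mul_eq_mul_left hpos h2)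
  have h4 := congrArg IntermediateField.fixedField h3
  rw [IsGalois.fixedField_fixingSubgroup, IsGalois.fixedField_fixingSubgroup] at h4
  have h5 := congrArg IntermediateField.lift h4
  rwa [IntermediateField.lift_restrict, IntermediateField.lift_restrict] at h5

/-- The restriction of automorphisms of a composite field to its two constituents. -/
theorem IntermediateField.exists_injective_hom_prod [IsGalois ℚ_[p] K₁] [IsGalois ℚ_[p] K₂] :
    ∃ f : ((K₁ ⊔ K₂ : IntermediateField ℚ_[p] (PadicAlgCl p)) ≃ₐ[ℚ_[p]]
      (K₁ ⊔ K₂ : IntermediateField ℚ_[p] (PadicAlgCl p))) →*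
        (K₁ ≃ₐ[ℚ_[p]] K₁) × (K₂ ≃ₐ[ℚ_[p]] K₂), Function.Injective f := by
  set L := K₁ ⊔ K₂
  have h₁ : K₁ ≤ L := le_sup_left
  have h₂ : K₂ ≤ L := le_sup_right
  let _ : Algebra K₁ L := (IntermediateField.inclusion h₁).toRingHom.toAlgebra
  let _ : Algebra K₂ L := (IntermediateField.inclusion h₂).toRingHom.toAlgebra
  have : IsScalarTower ℚ_[p] K₁ L := IsScalarTower.of_algebraMap_eq fun _ => rfl
  have : IsScalarTower ℚ_[p] K₂ L := IsScalarTower.of_algebraMap_eq fun _ => rfl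
  refine ⟨(AlgEquiv.restrictNormalHom K₁).prod (AlgEquiv.restrictNormalHom K₂), ?_⟩
  rw [injective_iff_map_eq_one]
  intro σ hσ
  rw [MonoidHom.prod_apply, Prod.mk_eq_one] at hσ
  have hfix₁ : ∀ z : K₁, σ (algebraMap K₁ L z) = algebraMap K₁ L z := fun z => by
    rw [← AlgEquiv.restrictNormal_commutes]
    exact congrArg _ (DFunLike.congr_fun hσ.1 z)
  have hfix₂ : ∀ z : K₂, σ (algebraMap K₂ L z) = algebraMap K₂ L z := fun z => by
    rw [← AlgEquiv.restrictNormal_commutes]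
    exact congrArg _ (DFunLike.congr_fun hσ.2 z)
  -- An automorphism trivial on both constituents has a fixed field containing both, hence their
  -- composite.
  let E := IntermediateField.fixedField (Subgroup.zpowers σ)
  have hE : ∀ z : L, σ z = z → z ∈ E := fun z hz => by
    rw [IntermediateField.mem_fixedField_iff]
    intro τ hτ
    have hle : Subgroup.zpowers σ ≤ MulAction.stabilizer (L ≃ₐ[ℚ_[p]] L) z :=
      Subgroup.zpowers_le.2 hz
    exact hle hτ
  have hL : L ≤ IntermediateField.lift E := by
    refine sup_le (fun z hz => ?_) fun z hz => ?_
    · exact (IntermediateField.mem_lift (⟨z, h₁ hz⟩ : L)).2 (hE _ (hfix₁ ⟨z, hz⟩))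
    · exact (IntermediateField.mem_lift (⟨z, h₂ hz⟩ : L)).2 (hE _ (hfix₂ ⟨z, hz⟩))
  ext z
  have hz := (IntermediateField.mem_lift z).1 (hL z.2)
  rw [IntermediateField.mem_fixedField_iff] at hz
  rw [hz σ (Subgroup.mem_zpowers σ)]
  rfl

end Fields

/-! ### The cyclotomic field -/

instance isCyclotomicExtension_muField : IsCyclotomicExtension {p} ℚ_[p] (muField p) := by
  have h0 : NeZero p := ⟨(Fact.out : p.Prime).ne_zero⟩
  have h1 : NeZero ((p : ℕ) : PadicAlgCl p) := ⟨by exact_mod_cast (Fact.out : p.Prime).ne_zero⟩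
  have h := IntermediateField.isCyclotomicExtension_adjoin_of_exists_isPrimitiveRoot {p} ℚ_[p]
    (PadicAlgCl p) (fun n hn _ => by
      rw [Set.mem_singleton_iff] at hn
      subst hn
      exact HasEnoughRootsOfUnity.exists_primitiveRoot (PadicAlgCl n) n)
  have e : {b : PadicAlgCl p | ∃ n ∈ ({p} : Set ℕ), n ≠ 0 ∧ b ^ n = 1} = {ζ | ζ ^ p = 1} := by
    ext b
    simp [h0.ne]
  rw [e] at h
  exact h

instance isGalois_muField : IsGalois ℚ_[p] (muField p) :=
  IsCyclotomicExtension.isGalois {p} ℚ_[p] (muField p)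

theorem exists_injective_hom_units : ∃ f : (muField p ≃ₐ[ℚ_[p]] muField p) →* (ZMod p)ˣ,
    Function.Injective f := by
  have h0 : NeZero p := ⟨(Fact.out : p.Prime).ne_zero⟩
  exact ⟨_, (IsCyclotomicExtension.zeta_spec p ℚ_[p] (muField p)).autToPow_injective ℚ_[p]⟩

instance isCyclic_muField : IsCyclic (muField p ≃ₐ[ℚ_[p]] muField p) := by
  obtain ⟨f, hf⟩ := exists_injective_hom_units (p := p)
  exact isCyclic_of_injective f hf

theorem finrank_muField_dvd : Module.finrank ℚ_[p] (muField p) ∣ p - 1 := by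
  obtain ⟨f, hf⟩ := exists_injective_hom_units (p := p)
  rw [← IsGalois.card_aut_eq_finrank, ← ZMod.card_units p, ← Nat.card_eq_fintype_card]
  exact Subgroup.card_dvd_of_injective f hf

/-! ### The tower -/

section Tower

variable {k : ℕ → IntermediateField ℚ_[p] (PadicAlgCl p)} [∀ n, FiniteDimensional ℚ_[p] (k n)]

omit [∀ n, FiniteDimensional ℚ_[p] (k n)] in
theorem cycloLayer_mono (hk : IsRamifiedZpTower k) : Monotone (cycloLayer k) := by
  refine monotone_nat_of_le_succ fun n => ?_
  cases n with
  | zero => exact bot_le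
  | succ n => exact sup_le_sup_right (hk.le_succ n) _

omit [∀ n, FiniteDimensional ℚ_[p] (k n)] in
theorem isGalois_cycloLayer (hk : IsRamifiedZpTower k) (n : ℕ) : IsGalois ℚ_[p] (cycloLayer k n) := by
  cases n with
  | zero => exact inferInstanceAs (IsGalois ℚ_[p] (⊥ : IntermediateField ℚ_[p] (PadicAlgCl p)))
  | succ n =>
    have := hk.isGalois n
    exact inferInstanceAs (IsGalois ℚ_[p]
      (k n ⊔ muField p : IntermediateField ℚ_[p] (PadicAlgCl p)))

/-- The Galois group of the composite embeds in the product. Only divisibility is available here;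
equality comes from the torsion points. -/
theorem finrank_cycloLayer_dvd (hk : IsRamifiedZpTower k) (n : ℕ) :
    Module.finrank ℚ_[p] (cycloLayer k (n + 1)) ∣ p ^ n * Module.finrank ℚ_[p] (muField p) := by
  have := hk.isGalois n
  have := isGalois_cycloLayer hk (n + 1)
  obtain ⟨f, hf⟩ := IntermediateField.exists_injective_hom_prod (K₁ := k n) (K₂ := muField p)
  have h := Subgroup.card_dvd_of_injective f hf
  rw [Nat.card_prod, IsGalois.card_aut_eq_finrank ℚ_[p] (k n),
    IsGalois.card_aut_eq_finrank ℚ_[p] (muField p), hk.finrank_eq] at h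
  rw [← IsGalois.card_aut_eq_finrank ℚ_[p] (cycloLayer k (n + 1))]
  exact h

theorem coprime_sub_one_prime_pow (n : ℕ) : (p - 1).Coprime (p ^ n) := by
  have hp := (Fact.out : p.Prime)
  refine Nat.Coprime.pow_right n (Nat.Coprime.symm ?_)
  rw [hp.coprime_iff_not_dvd]
  exact Nat.not_dvd_of_pos_of_lt (by have := hp.one_lt; omega) (by have := hp.pos; omega)

variable {π c : ℤ_[p]} {e : ℕ → PadicAlgCl p}

omit [∀ n, FiniteDimensional ℚ_[p] (k n)] in
theorem exists_mem_cycloLayer (hk : IsRamifiedZpTower k) {x : PadicAlgCl p}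
    (hx : x ∈ ⨆ m, cycloLayer k m) (n : ℕ) : ∃ m, n ≤ m ∧ x ∈ cycloLayer k (m + 1) := by
  have h : x ∈ ((⨆ m, cycloLayer k m : IntermediateField ℚ_[p] (PadicAlgCl p)) :
    Set (PadicAlgCl p)) := hx
  rw [IntermediateField.coe_iSup_of_directed (cycloLayer_mono hk).directed_le, Set.mem_iUnion] at h
  obtain ⟨m, hm⟩ := h
  exact ⟨max n m, le_max_left _ _,
    cycloLayer_mono hk ((le_max_right n m).trans (Nat.le_succ _)) hm⟩

/-- The degree p - 1 of e_1, which lies in some L_{m+1}, divides p^m [ℚ_p(μ_p) : ℚ_p] and is prime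
to p. -/
theorem finrank_muField (hk : IsRamifiedZpTower k) (hπ : π = p * (1 + p * c))
    (he : IsPiSequence π e) (heL : ∀ n, e n ∈ ⨆ m, cycloLayer k m) :
    Module.finrank ℚ_[p] (muField p) = p - 1 := by
  refine Nat.dvd_antisymm finrank_muField_dvd ?_
  obtain ⟨m, -, hm⟩ := exists_mem_cycloLayer hk (heL 1) 0
  have h1 := IntermediateField.finrank_dvd_finrank_of_le
    ((IntermediateField.adjoin_simple_le_iff).2 hm)
  have h2 := he.finrank_adjoin hπ 0
  rw [pow_zero, mul_one] at h2
  rw [zero_add] at h2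
  rw [h2] at h1
  exact (coprime_sub_one_prime_pow m).dvd_of_dvd_mul_left (h1.trans (finrank_cycloLayer_dvd hk m))

theorem finrank_cycloLayer (hk : IsRamifiedZpTower k) (hπ : π = p * (1 + p * c))
    (he : IsPiSequence π e) (heL : ∀ n, e n ∈ ⨆ m, cycloLayer k m) (n : ℕ) :
    Module.finrank ℚ_[p] (cycloLayer k (n + 1)) = (p - 1) * p ^ n := by
  have hmu := finrank_muField hk hπ he heL
  refine Nat.dvd_antisymm ?_ ?_
  · have h := finrank_cycloLayer_dvd hk n
    rwa [hmu, mul_comm] at h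
  · refine (coprime_sub_one_prime_pow n).mul_dvd_of_dvd_of_dvd ?_ ?_
    · rw [← hmu]
      exact IntermediateField.finrank_dvd_finrank_of_le le_sup_right
    · rw [← hk.finrank_eq n]
      exact IntermediateField.finrank_dvd_finrank_of_le le_sup_left

/-- The Galois group embeds in a product of cyclic groups of coprime orders p^n and p - 1. -/
theorem isCyclic_cycloLayer (hk : IsRamifiedZpTower k) (hπ : π = p * (1 + p * c))
    (he : IsPiSequence π e) (heL : ∀ n, e n ∈ ⨆ m, cycloLayer k m) (n : ℕ) :
    IsCyclic (cycloLayer k (n + 1) ≃ₐ[ℚ_[p]] cycloLayer k (n + 1)) := by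
  have := hk.isGalois n
  have := hk.isCyclic n
  obtain ⟨f, hf⟩ := IntermediateField.exists_injective_hom_prod (K₁ := k n) (K₂ := muField p)
  have : IsCyclic ((k n ≃ₐ[ℚ_[p]] k n) × (muField p ≃ₐ[ℚ_[p]] muField p)) := by
    refine Group.isCyclic_prod_iff.2 ⟨inferInstance, inferInstance, ?_⟩
    rw [IsGalois.card_aut_eq_finrank, IsGalois.card_aut_eq_finrank, hk.finrank_eq,
      finrank_muField hk hπ he heL]
    exact (coprime_sub_one_prime_pow n).symm
  exact isCyclic_of_injective f hf

/-- Both ℚ_p(e_{n+1}) and L_{n+1} lie in one cyclic layer L_{m+1} and have degree (p - 1)p^n, so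
they coincide. -/
theorem mem_cycloLayer (hk : IsRamifiedZpTower k) (hπ : π = p * (1 + p * c))
    (he : IsPiSequence π e) (heL : ∀ n, e n ∈ ⨆ m, cycloLayer k m) (n : ℕ) :
    e n ∈ cycloLayer k n := by
  cases n with
  | zero =>
    rw [he.zero]
    exact zero_mem _
  | succ n =>
    obtain ⟨m, hnm, hm⟩ := exists_mem_cycloLayer hk (heL (n + 1)) n
    have := isGalois_cycloLayer hk (m + 1)
    have := isCyclic_cycloLayer hk hπ he heL m
    have h := IntermediateField.eq_of_finrank_eq_of_isCyclic
      ((IntermediateField.adjoin_simple_le_iff).2 hm)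
      (cycloLayer_mono hk (Nat.succ_le_succ hnm))
      ((he.finrank_adjoin hπ n).trans (finrank_cycloLayer hk hπ he heL n).symm)
    rw [← h]
    exact IntermediateField.mem_adjoin_simple_self _ _

theorem card_galFix_cycloLayer (hk : IsRamifiedZpTower k) (hπ : π = p * (1 + p * c))
    (he : IsPiSequence π e) (heL : ∀ n, e n ∈ ⨆ m, cycloLayer k m) (n : ℕ) :
    (galFix (cycloLayer k (n + 1)) (k n)).card = p - 1 := by
  have := isGalois_cycloLayer hk (n + 1)
  have h := card_galFix_mul (le_cycloLayer k n)
  rw [finrank_cycloLayer hk hπ he heL, hk.finrank_eq, mul_comm] at h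
  exact Nat.eq_of_mul_eq_mul_right (pow_pos (Fact.out : p.Prime).pos n) h

theorem card_galFix_succ (hk : IsRamifiedZpTower k) (n : ℕ) :
    (galFix (k (n + 1)) (k n)).card = p := by
  have := hk.isGalois (n + 1)
  have h := card_galFix_mul (hk.le_succ n)
  rw [hk.finrank_eq, hk.finrank_eq, pow_succ] at h
  exact Nat.eq_of_mul_eq_mul_left (pow_pos (Fact.out : p.Prime).pos n) h

/-- The intersection has p-power degree dividing (p - 1)p^n, hence degree at most p^n, and it
contains k_n. -/
theorem inf_cycloLayer_eq (hk : IsRamifiedZpTower k) (hπ : π = p * (1 + p * c))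
    (he : IsPiSequence π e) (heL : ∀ n, e n ∈ ⨆ m, cycloLayer k m) (n : ℕ) :
    k (n + 1) ⊓ cycloLayer k (n + 1) = k n := by
  have hp := (Fact.out : p.Prime)
  have hle : k n ≤ k (n + 1) ⊓ cycloLayer k (n + 1) := le_inf (hk.le_succ n) (le_cycloLayer k n)
  have hfd : FiniteDimensional ℚ_[p]
      (k (n + 1) ⊓ cycloLayer k (n + 1) : IntermediateField ℚ_[p] (PadicAlgCl p)) :=
    FiniteDimensional.of_injective
      (IntermediateField.inclusion (inf_le_left : k (n + 1) ⊓ cycloLayer k (n + 1) ≤ k (n + 1))).toLinearMap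
      (IntermediateField.inclusion_injective inf_le_left)
  have h1 := IntermediateField.finrank_dvd_finrank_of_le
    (inf_le_left : k (n + 1) ⊓ cycloLayer k (n + 1) ≤ k (n + 1))
  have h2 := IntermediateField.finrank_dvd_finrank_of_le
    (inf_le_right : k (n + 1) ⊓ cycloLayer k (n + 1) ≤ cycloLayer k (n + 1))
  rw [hk.finrank_eq] at h1
  rw [finrank_cycloLayer hk hπ he heL] at h2
  obtain ⟨i, hi, hi2⟩ := (Nat.dvd_prime_pow hp).1 h1
  rw [hi2] at h2
  have h3 : p ^ i ∣ p ^ n := (Nat.Coprime.symm (coprime_sub_one_prime_pow i)).dvd_of_dvd_mul_left h2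
  refine (IntermediateField.eq_of_le_of_finrank_le hle ?_).symm
  rw [hi2, hk.finrank_eq]
  exact Nat.le_of_dvd (pow_pos hp.pos n) h3

/-- The normalized traces to `k_n` and `k_{n+1}` agree on `L_{n+1}`. -/
theorem avg_succ_eq (hk : IsRamifiedZpTower k) (hπ : π = p * (1 + p * c))
    (he : IsPiSequence π e) (heL : ∀ n, e n ∈ ⨆ m, cycloLayer k m) (n : ℕ) {z : PadicAlgCl p}
    (hz : z ∈ cycloLayer k (n + 1)) : avg (k (n + 1)) z = avg (k n) z := by
  have := isGalois_cycloLayer hk (n + 2)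
  have := isGalois_cycloLayer hk (n + 1)
  have hle := cycloLayer_mono hk (Nat.le_succ (n + 1))
  have hcard := card_galFix_cycloLayer hk hπ he heL (n + 1)
  have h := sum_galFix_apply (le_cycloLayer k (n + 1)) (⟨z, hle hz⟩ : cycloLayer k (n + 2))
  -- The normalized trace to k_{n+1} is an average of conjugates of z, and these stay in the normal
  -- extension L_{n+1}. So it lies in k_{n+1} ∩ L_{n+1} = k_n.
  have hmem : avg (k (n + 1)) z ∈ cycloLayer k (n + 1) := by
    have h0 : ((galFix (cycloLayer k (n + 1 + 1)) (k (n + 1))).card : PadicAlgCl p) ≠ 0 := by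
      rw [hcard]
      have := (Fact.out : p.Prime).one_lt
      exact_mod_cast (by omega : p - 1 ≠ 0)
    have hσ : ∀ σ ∈ galFix (cycloLayer k (n + 1 + 1)) (k (n + 1)),
        ((σ (⟨z, hle hz⟩ : cycloLayer k (n + 2)) : cycloLayer k (n + 2)) : PadicAlgCl p) ∈
          cycloLayer k (n + 1) := fun σ _ => by
      let f : cycloLayer k (n + 1) →ₐ[ℚ_[p]] PadicAlgCl p :=
        ((cycloLayer k (n + 2)).val.comp (σ : cycloLayer k (n + 2) →ₐ[ℚ_[p]] _)).comp
          (IntermediateField.inclusion hle)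
      have hf : f.fieldRange = cycloLayer k (n + 1) := AlgHom.fieldRange_of_normal f
      have hf2 : f ⟨z, hz⟩ ∈ f.fieldRange := ⟨_, rfl⟩
      rw [hf] at hf2
      exact hf2
    rw [eq_comm, ← eq_inv_mul_iff_mul_eq₀ h0, AddSubmonoidClass.coe_finsetSum] at h
    rw [h]
    exact mul_mem (inv_mem (natCast_mem _ _)) (sum_mem hσ)
  have hmem' : avg (k (n + 1)) z ∈ k (n + 1) ⊓ cycloLayer k (n + 1) := ⟨avg_mem _ _, hmem⟩
  rw [inf_cycloLayer_eq hk hπ he heL n] at hmem'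
  rw [← avg_avg (hk.le_succ n) z, avg_of_mem hmem']

end Tower

end Padic
end

/-! ### Logarithms of the points and the trace relations. -/

noncomputable section
section Padic

variable {p : ℕ} [Fact p.Prime]
variable {ι : Type*} [Fintype ι] [DecidableEq ι]

/-- The vector `x_k u_1`. -/
def xVec (C : Matrix ι ι ℤ_[p]) (k : ℕ) (i : ι) : ℚ_[p] :=
  ∑ j, xSeq (C.map (algebraMap ℤ_[p] ℚ_[p])) k i j

theorem xVec_zero (C : Matrix ι ι ℤ_[p]) (i : ι) : xVec C 0 i = 1 := by
  simp [xVec, xSeq, Matrix.one_apply]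

omit [DecidableEq ι] in
theorem matAct_sum_row (C : Matrix ι ι ℤ_[p]) (X : Matrix ι ι ℚ_[p]) (i : ι) :
    ∑ j, (C.map (algebraMap ℤ_[p] ℚ_[p]) * X) i j = matAct C (fun m => ∑ j, X m j) i := by
  simp only [Matrix.mul_apply, matAct, Finset.smul_sum]
  exact Finset.sum_comm

theorem smul_xVec_one (C : Matrix ι ι ℤ_[p]) (i : ι) :
    (p : ℚ_[p]) * xVec C 1 i = matAct C (xVec C 0) i := by
  have hp : (p : ℚ_[p]) ≠ 0 := by exact_mod_cast (Fact.out : p.Prime).ne_zero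
  have h : matAct C (xVec C 0) i = _ := (matAct_sum_row C _ i).symm
  rw [h, xVec, Finset.mul_sum]
  refine Finset.sum_congr rfl fun j _ => ?_
  rw [xSeq, xSeq, mul_one, Matrix.smul_apply, smul_eq_mul, mul_inv_cancel_left₀ hp]

theorem smul_xVec_add_two (C : Matrix ι ι ℤ_[p]) (k : ℕ) (i : ι) :
    (p : ℚ_[p]) * xVec C (k + 2) i = matAct C (xVec C (k + 1)) i - xVec C k i := by
  have hp : (p : ℚ_[p]) ≠ 0 := by exact_mod_cast (Fact.out : p.Prime).ne_zero
  have h : matAct C (xVec C (k + 1)) i = _ := (matAct_sum_row C _ i).symm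
  rw [h, xVec, xVec, Finset.mul_sum, ← Finset.sum_sub_distrib]
  refine Finset.sum_congr rfl fun j _ => ?_
  rw [xSeq, Matrix.smul_apply, smul_eq_mul, mul_inv_cancel_left₀ hp, Matrix.sub_apply]

/-- `∑_{j < n} a_{n-j} x_j u_1` -/
def xConv {V : Type*} [AddCommGroup V] [Module ℚ_[p] V] (C : Matrix ι ι ℤ_[p]) (a : ℕ → V) (n : ℕ)
    (i : ι) : V :=
  ∑ j ∈ Finset.range n, xVec C j i • a (n - j)

section Conv

variable {V : Type*} [AddCommGroup V] [Module ℚ_[p] V]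

theorem matAct_xConv (C : Matrix ι ι ℤ_[p]) (a : ℕ → V) (n : ℕ) (i : ι) :
    matAct C (xConv C a n) i = ∑ j ∈ Finset.range n, matAct C (xVec C j) i • a (n - j) := by
  simp only [matAct, xConv, Finset.smul_sum, Finset.sum_smul, smul_assoc]
  exact Finset.sum_comm

/-- The recurrence p x_{j+2} = C x_{j+1} - x_j passes to the convolution with a. The term j = 0
contributes p a_{n+2}, and j = 1 completes the C-part by its initial term. -/
theorem smul_xConv_add_two (C : Matrix ι ι ℤ_[p]) (a : ℕ → V) (n : ℕ) :
    (p : ℚ_[p]) • xConv C a (n + 2) = (fun _ => (p : ℚ_[p]) • a (n + 2)) +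
      matAct C (xConv C a (n + 1)) - xConv C a n := by
  funext i
  simp only [Pi.smul_apply, Pi.add_apply, Pi.sub_apply]
  rw [matAct_xConv, xConv, xConv, Finset.sum_range_succ', Finset.sum_range_succ',
    Finset.sum_range_succ', smul_add, smul_add, Finset.smul_sum, smul_smul, smul_smul, zero_add,
    smul_xVec_one, xVec_zero, mul_one]
  have h : ∀ j, (p : ℚ_[p]) • xVec C (j + 1 + 1) i • a (n + 2 - (j + 1 + 1)) =
      matAct C (xVec C (j + 1)) i • a (n + 1 - (j + 1)) - xVec C j i • a (n - j) := fun j => by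
    rw [smul_smul, smul_xVec_add_two, sub_smul, Nat.add_sub_add_right,
      Nat.add_sub_add_right]
  simp only [h, Finset.sum_sub_distrib]
  rw [show n + 2 - 1 = n + 1 by omega, Nat.sub_zero, Nat.sub_zero]
  abel

theorem xConv_congr (C : Matrix ι ι ℤ_[p]) {a b : ℕ → V} {n : ℕ} (h : ∀ m ≤ n, a m = b m) :
    xConv C a n = xConv C b n := by
  funext i
  exact Finset.sum_congr rfl fun j _ => by rw [h _ (Nat.sub_le n j)]

theorem map_xConv {W : Type*} [AddCommGroup W] [Module ℚ_[p] W] (f : V →ₗ[ℚ_[p]] W)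
    (C : Matrix ι ι ℤ_[p]) (a : ℕ → V) (n : ℕ) (i : ι) :
    f (xConv C a n i) = xConv C (fun m => f (a m)) n i := by
  simp [xConv, map_sum]

end Conv

theorem polyVal_coe {K : IntermediateField ℚ_[p] (PadicAlgCl p)} (f : Polynomial ℤ_[p]) (z : K) :
    (polyVal K f z : PadicAlgCl p) = evalPoly f z :=
  Polynomial.hom_eval₂ f _ (algebraMap K (PadicAlgCl p)) z

/-- The logarithm of `e_n u_1`. -/
theorem logCl_eq_xConv {π : ℤ_[p]} (hπ : (p : ℤ_[p]) ∣ π) {C : Matrix ι ι ℤ_[p]}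
    (hC : IsNilpotentModP C) {D : ℕ → Matrix ι ι ℤ_[p]} (hD : IsLtCoeff π C D)
    {F : FormalGroupLaw ι ℤ_[p]} {e : ℕ → PadicAlgCl p} (he : IsPiSequence π e)
    {K : IntermediateField ℚ_[p] (PadicAlgCl p)} [FiniteDimensional ℚ_[p] K] {n : ℕ}
    {x : F.Points K} (hx : ∀ i, (x.coord i : PadicAlgCl p) = e n) :
    logCl D x = xConv C e n := by
  have := FiniteDimensional.complete ℚ_[p] K
  funext i
  rw [logCl, logVal, AddSubmonoidClass.coe_finsetSum, xConv]
  simp only [xVec, Finset.sum_smul]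
  rw [Finset.sum_comm]
  refine Finset.sum_congr rfl fun j _ => ?_
  have h := hasSum_xSeq_mul_polyVal hπ hC hD (x.norm_lt_one j) i j
  -- The series for ℓ(e_n u_1) is finite: 𝔣^{(k)}(e_n) vanishes for k ≥ n and is e_{n-k} for k < n.
  have h1 := h.unique (hasSum_sum_of_ne_finset_zero (s := Finset.range n) fun k hk => by
    have h0 : polyVal K (ltIter π k) (x.coord j) = 0 := Subtype.ext (by
      rw [polyVal_coe, hx]
      exact he.evalPoly_ltIter_of_le (not_lt.1 (Finset.mem_range.not.1 hk)))
    rw [h0, mul_zero])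
  rw [h1, AddSubmonoidClass.coe_finsetSum]
  refine Finset.sum_congr rfl fun k hk => ?_
  have h2 := he.evalPoly_ltIter k (n - k)
  rw [Nat.sub_add_cancel (Finset.mem_range.1 hk).le] at h2
  rw [MulMemClass.coe_mul, polyVal_coe, hx, h2, Algebra.smul_def]
  rfl

section Final

variable {k : ℕ → IntermediateField ℚ_[p] (PadicAlgCl p)} [∀ n, FiniteDimensional ℚ_[p] (k n)]
  {π c : ℤ_[p]} {e : ℕ → PadicAlgCl p} {C : Matrix ι ι ℤ_[p]} {D : ℕ → Matrix ι ι ℤ_[p]}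
  {F : FormalGroupLaw ι ℤ_[p]}

omit [DecidableEq ι] in
theorem matAct_algebraMap (B : Matrix ι ι ℤ_[p]) (w : ι → ℤ_[p]) :
    matAct B (fun i => algebraMap ℚ_[p] (PadicAlgCl p) (w i)) =
      fun i => algebraMap ℚ_[p] (PadicAlgCl p) (B.mulVec w i) := by
  funext i
  simp [matAct, Matrix.mulVec, dotProduct, Algebra.smul_def]

/-- The logarithm of the trace of `ε + e_{n+1} u_1` to `k_n`. -/
theorem logCl_trace (hk : IsRamifiedZpTower k) (hπ : π = p * (1 + p * c)) (he : IsPiSequence π e)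
    (heL : ∀ n, e n ∈ ⨆ m, cycloLayer k m) (hC : IsNilpotentModP C) (hD : IsLtCoeff π C D)
    (hF : HasLog D F.add) {ε : F.Points ℚ_[p]} {n : ℕ} {E : F.Points (cycloLayer k (n + 1))}
    (hE : ∀ i, (E.coord i : PadicAlgCl p) = e (n + 1)) {d : F.Points (k n)}
    (hd : F.IsTrace (le_cycloLayer k n) (ε.map (Algebra.ofId ℚ_[p] (cycloLayer k (n + 1))) + E) d) :
    logCl D d = ((p : ℚ_[p]) - 1) • ((fun i => algebraMap ℚ_[p] (PadicAlgCl p)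
      (logVal D ε.coord i)) + xConv C (fun m => avg (k n) (e m)) (n + 1)) := by
  have := isGalois_cycloLayer hk (n + 1)
  have hp1 := (Fact.out : p.Prime).one_lt
  funext i
  rw [logCl_of_isTrace hF hd, card_galFix_cycloLayer hk hπ he heL, logCl_add hF, Pi.add_apply,
    logCl_map_ofId hF, logCl_eq_xConv ⟨_, hπ⟩ hC hD he hE, map_add, map_xConv,
    avg_of_mem ((k n).algebraMap_mem _), Pi.smul_apply, Pi.add_apply, Algebra.smul_def]
  congr 1
  rw [Nat.cast_sub hp1.le]
  simp

/-- The right-hand computation for the trace of d_{n+1}: p is the degree of k_{n+1} over k_n, the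
convolution obeys the recurrence, and the new term is p · (-1) since e_{n+2} has normalized trace
-1. -/
theorem smul_avg_logCl_trace (hk : IsRamifiedZpTower k) (hp : p ≠ 2) (hπ : π = p * (1 + p * c))
    (he : IsPiSequence π e) (heL : ∀ n, e n ∈ ⨆ m, cycloLayer k m)
    (n : ℕ) (W : ι → ℚ_[p]) (i : ι) :
    (p : ℚ_[p]) • avg (k n) ((((p : ℚ_[p]) - 1) • ((fun i => algebraMap ℚ_[p] (PadicAlgCl p) (W i)) +
      xConv C (fun m => avg (k (n + 1)) (e m)) (n + 2))) i) =
      ((((p : ℚ_[p]) - 1) • ((p : ℚ_[p]) • (fun i => algebraMap ℚ_[p] (PadicAlgCl p) (W i)) -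
        (fun _ => (p : PadicAlgCl p)) + matAct C (xConv C (fun m => avg (k n) (e m)) (n + 1)) -
        xConv C (fun m => avg (k n) (e m)) n) : ι → PadicAlgCl p)) i := by
  have h1 : avg (k n) (e (n + 2)) = -1 := by
    have h := he.avg_succ hp hπ n (cycloLayer k (n + 1)) (finrank_cycloLayer hk hπ he heL n)
      (mem_cycloLayer hk hπ he heL (n + 1))
    rw [← avg_avg (le_cycloLayer k n), h, avg_of_mem (neg_mem (one_mem _))]
  have h2 := congrFun (smul_xConv_add_two C (fun m => avg (k n) (e m)) n) i
  rw [Pi.smul_apply, map_smul, Pi.add_apply, map_add, map_xConv, avg_of_mem ((k n).algebraMap_mem _)]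
  simp only [avg_avg (hk.le_succ n)]
  rw [smul_comm, smul_add, ← Pi.smul_apply (p : ℚ_[p]) (xConv C _ (n + 2)), h2, Pi.smul_apply]
  simp only [Pi.add_apply, Pi.sub_apply, Pi.smul_apply, h1]
  have h3 : (p : ℚ_[p]) • (-1 : PadicAlgCl p) = -p := by
    rw [Algebra.smul_def, map_natCast, mul_neg, mul_one]
  rw [h3]
  congr 1
  ring

end Final

end Padic
end

theorem mainTheorem3 (p : ℕ) [Fact p.Prime] (hp : p ≠ 2)
    -- the Hecke field, an integral basis with coordinates `(1, …, 1)` of `1`, Hecke eigenvalues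
    {F : Type*} [Field F] [NumberField F] {g : ℕ} (b : Module.Basis (Fin g) ℤ (𝓞 F))
    (hb : ∑ i, b i = 1) (N : ℕ) (hN : ¬ p ∣ N) (a : ℕ → 𝓞 F)
    (ha : ∀ v : Ideal (𝓞 F), v.IsPrime → (p : 𝓞 F) ∈ v → a p ∈ v)
    -- the tower of local fields, the uniformizer and the Lubin-Tate `π`-sequence
    (k : ℕ → IntermediateField ℚ_[p] (PadicAlgCl p)) [∀ n, FiniteDimensional ℚ_[p] (k n)]
    (hk : IsRamifiedZpTower k) (π : ℤ_[p]) (hπ : ∃ c : ℤ_[p], π = p * (1 + p * c))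
    (e : ℕ → PadicAlgCl p) (he : IsPiSequence π e) (heL : ∀ n, e n ∈ ⨆ m, cycloLayer k m)
    -- the matrix `C_p` and the logarithm `ℓ`
    (C : Matrix (Fin g) (Fin g) ℤ_[p]) (hC : C = mulMatrix p b (a p))
    (ℓ : Fin g → MvPowerSeries (Fin g) ℚ_[p])
    (hℓ : ℓ = ltLog π (C.map (algebraMap ℤ_[p] ℚ_[p]))) :
    ∃ A : FormalGroupLaw (Fin g) ℤ_[p], A.IsOfLog ℓ ∧
      (∃ H : FormalGroupLaw (Fin g) ℤ_[p],
        H.IsOfLog (dirichletLog fun n =>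
          (mulMatrix p b (dirichletCoeff N a n)).map (algebraMap ℤ_[p] ℚ_[p])) ∧
        ∃ θ : A.Hom H, θ.IsStrongIso) ∧
      ∃ act : Matrix (Fin g) (Fin g) ℤ_[p] → A.Hom A,
        (∀ B, Commute B C → (act B).ActsAs ℓ B) ∧
        (∃ ε : A.Points ℚ_[p], ∀ i, evalAt (ℓ i) ε.coord =
          (((1 + (p : Matrix (Fin g) (Fin g) ℤ_[p]) - C)⁻¹.mulVec fun _ => (p : ℤ_[p])) i)) ∧
        ∀ ε : A.Points ℚ_[p],
          (∀ i, evalAt (ℓ i) ε.coord =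
            (((1 + (p : Matrix (Fin g) (Fin g) ℤ_[p]) - C)⁻¹.mulVec fun _ => (p : ℤ_[p])) i)) →
          ∃ (E c : ∀ n, A.Points (cycloLayer k n)) (d : ∀ n, A.Points (k n)),
            -- `E n` is the point `e_n u_1`
            (∀ n i, ((E n).coord i : PadicAlgCl p) = e n) ∧
            (∀ n, c n = ε.map (Algebra.ofId ℚ_[p] (cycloLayer k n)) + E n) ∧
            (∀ n, A.IsTrace (le_cycloLayer k n) (c (n + 1)) (d n)) ∧
            (∀ n, A.IsTrace (hk.le_succ (n + 1)) (d (n + 2))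
              ((act C).onPoints (d (n + 1)) -
                (d n).map (IntermediateField.inclusion (hk.le_succ n)))) ∧
            A.IsTrace (hk.le_succ 0) (d 1)
              ((act (C - (C - 2)⁻¹ * ((p : Matrix (Fin g) (Fin g) ℤ_[p]) - 1))).onPoints (d 0)) := by
  obtain ⟨c₀, hc⟩ := hπ
  have hdvd : (p : ℤ_[p]) ∣ π := ⟨_, hc⟩
  have hCn : IsNilpotentModP C := hC ▸ isNilpotentModP_mulMatrix b ha
  obtain ⟨D, hD⟩ := exists_isLtCoeff π hdvd hCn
  have hH := hD.hondaType hc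
  obtain ⟨A, hA⟩ := hH.exists_formalGroupLaw
  have hlog : ℓ = dirichletLog fun n => (D n).map (algebraMap ℤ_[p] ℚ_[p]) :=
    hℓ.trans (ltLog_eq_dirichletLog π hD)
  have hH' : HondaType C fun n => mulMatrix p b (dirichletCoeff N a n) :=
    hC ▸ hondaType_mulMatrix b hN a
  obtain ⟨H, hHlog⟩ := hH'.exists_formalGroupLaw
  refine ⟨A, hlog ▸ hH.isOfLog hA, ⟨H, hH'.isOfLog hHlog, ?_⟩, ?_⟩
  -- This matrix is the inverse of the linear part D 1 of ℓ, so the homomorphism it defines has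
  -- identity linear part.
  · have hcomm : Commute (1 - (1 + p * c₀) • C +
        (p * (1 + p * c₀) ^ 2 : ℤ_[p]) • (1 : Matrix (Fin g) (Fin g) ℤ_[p])) C :=
      ((Commute.one_left C).sub_left ((Commute.refl C).smul_left _)).add_left
        ((Commute.one_left C).smul_left _)
    obtain ⟨θ, hθ⟩ := hH.exists_hom hH' hA hHlog hcomm
    refine ⟨θ, isStrongIso_of_logSubst ?_ (hD.mul_eq_one hc) θ hθ⟩
    simp only [dirichletCoeff, Nat.factorization_one, Finsupp.prod_zero_index, mulMatrix_eq,
      map_one]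
  -- For B not commuting with C there is no [B]; the homomorphism attached to the identity matrix
  -- serves as a default.
  have hact : ∀ B : Matrix (Fin g) (Fin g) ℤ_[p], ∃ φ : A.Hom A, Commute B C →
      logSubst D (fun j => toQp (φ.series j)) = matAct B (logSubst D MvPowerSeries.X) := fun B => by
    by_cases hB : Commute B C
    · obtain ⟨φ, hφ⟩ := hH.exists_hom hH hA hA hB
      exact ⟨φ, fun _ => hφ⟩
    · obtain ⟨φ, -⟩ := hH.exists_hom hH hA hA (Commute.one_left C)
      exact ⟨φ, fun h => absurd h hB⟩
  choose act hact using hact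
  set w := (1 + (p : Matrix (Fin g) (Fin g) ℤ_[p]) - C)⁻¹.mulVec fun _ => (p : ℤ_[p]) with hw
  have heval : ∀ ε : A.Points ℚ_[p], ∀ i, evalAt (ℓ i) ε.coord = logVal D ε.coord i := fun ε i => by
    rw [hlog]
    exact evalAt_dirichletLog D ε.norm_lt_one i
  have hmulw : (1 + (p : Matrix (Fin g) (Fin g) ℤ_[p]) - C).mulVec w = fun _ => (p : ℤ_[p]) := by
    rw [hw, Matrix.mulVec_mulVec, Matrix.mul_nonsing_inv _
      ((Matrix.isUnit_iff_isUnit_det _).1 hCn.isUnit_one_add_sub), Matrix.one_mulVec]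
  refine ⟨act, fun B hB => hlog ▸ actsAs_of_logSubst (act B) (hact B hB), ?_, ?_⟩
  -- The prescribed value is an integral matrix applied to p u_1, so it lies in the ball of radius
  -- 1/p where the logarithm can be inverted.
  · have hwn : ∀ j, ‖(w j : ℚ_[p])‖ ≤ (p : ℝ)⁻¹ := fun j => by
      rw [← PadicInt.norm_def, hw, Matrix.mulVec, dotProduct]
      refine IsUltrametricDist.norm_sum_le_of_forall_le_of_nonneg (by positivity) fun l _ => ?_
      rw [norm_mul, PadicInt.norm_p]
      exact mul_le_of_le_one_left (by positivity) (PadicInt.norm_le_one _)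
    obtain ⟨y, hy, hyw⟩ := exists_logVal_eq hp hH.isUnit hwn
    exact ⟨⟨y, fun i => (hy i).trans_lt (inv_lt_one_of_one_lt₀ one_lt_cast_prime)⟩, fun i =>
      (heval _ i).trans (congrFun hyw i)⟩
  intro ε hε
  have hmemL := mem_cycloLayer hk hc he heL
  let E : ∀ n, A.Points (cycloLayer k n) := fun n =>
    ⟨fun _ => ⟨e n, hmemL n⟩, fun _ => he.norm_lt_one n⟩
  let cc : ∀ n, A.Points (cycloLayer k n) := fun n => ε.map (Algebra.ofId ℚ_[p] (cycloLayer k n)) + E n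
  have hd : ∀ n, ∃ d : A.Points (k n), A.IsTrace (le_cycloLayer k n) (cc (n + 1)) d := fun n => by
    have := isGalois_cycloLayer hk (n + 1)
    exact exists_isTrace _ _
  choose d hd using hd
  have hlogε : (fun i => (logVal D ε.coord i : ℚ_[p])) = fun i => (w i : ℚ_[p]) :=
    funext fun i => (heval ε i).symm.trans (hε i)
  let W : Fin g → PadicAlgCl p := fun i => algebraMap ℚ_[p] (PadicAlgCl p) (w i)
  have hld : ∀ n, logCl D (d n) = ((p : ℚ_[p]) - 1) •
      (W + xConv C (fun m => avg (k n) (e m)) (n + 1)) := fun n => by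
    have h := logCl_trace hk hc he heL hCn hD hA (E := E (n + 1)) (fun _ => rfl) (hd n)
    have h' : (fun i => algebraMap ℚ_[p] (PadicAlgCl p) (logVal D ε.coord i)) = W :=
      funext fun i => congrArg _ (congrFun hlogε i)
    rwa [h'] at h
  -- The defining property of ε. In the form pW - p u_1 = CW - W it absorbs the -p produced by the
  -- normalized trace of e_{n+2}.
  have hW : W + (p : ℚ_[p]) • W - matAct C W = fun _ => (p : PadicAlgCl p) := by
    have h1 : matAct (1 + (p : Matrix (Fin g) (Fin g) ℤ_[p]) - C) W = fun _ => (p : PadicAlgCl p) := by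
      rw [matAct_algebraMap, hmulw]
      funext i
      simp
    rwa [matAct_sub_left, matAct_add_left, matAct_one, matAct_natCast] at h1
  -- The logarithm of the trace of d_{n+1} to k_n, the common source of both relations.
  have htr : ∀ n, ∀ i, ((galFix (k (n + 1)) (k n)).card : PadicAlgCl p) *
      avg (k n) (logCl D (d (n + 1)) i) = (((p : ℚ_[p]) - 1) • (matAct C W - W +
        matAct C (xConv C (fun m => avg (k n) (e m)) (n + 1)) -
        xConv C (fun m => avg (k n) (e m)) n) : Fin g → PadicAlgCl p) i := fun n i => by
    have h := smul_avg_logCl_trace hk hp hc he heL n (fun i => (w i : ℚ_[p])) i (C := C)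
    have e1 : (p : ℚ_[p]) • W - (fun _ => (p : PadicAlgCl p)) = matAct C W - W := by
      rw [← hW]
      abel
    change _ = ((((p : ℚ_[p]) - 1) • ((p : ℚ_[p]) • W - (fun _ => (p : PadicAlgCl p)) + _ - _) :
      Fin g → PadicAlgCl p)) i at h
    rw [e1] at h
    have e2 : ∀ x : PadicAlgCl p, (p : PadicAlgCl p) * x = (p : ℚ_[p]) • x := fun x => by
      rw [Algebra.smul_def, map_natCast]
    rw [← h, card_galFix_succ hk, hld, e2]
  have hinj : ∀ n, Function.Injective (logHom hA (k n)) := fun n => by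
    have := hk.isGalois n
    have := hk.isCyclic n
    exact logHom_injective hp hH.isUnit hA (k n) (hk.finrank_eq n)
  refine ⟨E, cc, d, fun _ _ => rfl, fun _ => rfl, hd, fun n => ?_, ?_⟩
  -- Relation 1 with its index shifted to n + 1, so that it starts at 1.
  · have := hk.isGalois (n + 2)
    refine isTrace_of_logCl hA (hinj (n + 2)) fun i => ?_
    rw [htr, logCl_sub hA, logCl_map _ hA, logCl_onPoints _ (hact C (Commute.refl C)), hld, hld,
      matAct_smul_right, matAct_add_right, ← smul_sub]
    -- The two logarithms on the right average over k_{n+1} and k_n respectively; on e_m with m ≤ n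
    -- + 1 the averages agree.
    have h2 : xConv C (fun m => avg (k (n + 1)) (e m)) (n + 1) =
        xConv C (fun m => avg (k n) (e m)) (n + 1) :=
      xConv_congr C fun m hm => avg_succ_eq hk hc he heL n (cycloLayer_mono hk hm (hmemL m))
    rw [h2]
    refine congrArg (fun v : Fin g → PadicAlgCl p => (((p : ℚ_[p]) - 1) • v) i) ?_
    abel
  · have := hk.isGalois 1
    have hu : IsUnit (C - 2) := hCn.isUnit_sub_two hp
    have hdet := (Matrix.isUnit_iff_isUnit_det _).1 hu
    have hcomm2 : Commute (C - 2)⁻¹ C := by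
      have h0 : Commute (C - 2) C := (Commute.refl C).sub_left (Nat.cast_commute 2 C)
      have h1 : (C - 2)⁻¹ * (C * (C - 2)) * (C - 2)⁻¹ = (C - 2)⁻¹ * ((C - 2) * C) * (C - 2)⁻¹ := by
        rw [h0.eq]
      rw [mul_assoc, mul_assoc, Matrix.mul_nonsing_inv _ hdet, mul_one, ← mul_assoc (C - 2)⁻¹ (C - 2),
        Matrix.nonsing_inv_mul _ hdet, one_mul] at h1
      exact h1
    have hcommp : Commute ((p : Matrix (Fin g) (Fin g) ℤ_[p]) - 1) C :=
      (Nat.cast_commute p C).sub_left (Commute.one_left C)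
    have hcommB : Commute (C - (C - 2)⁻¹ * ((p : Matrix (Fin g) (Fin g) ℤ_[p]) - 1)) C :=
      (Commute.refl C).sub_left (hcomm2.mul_left hcommp)
    -- Here log d_0 = (p - 1)W - p u_1 because e_1 has normalized trace -p/(p - 1), and p u_1 = (1 +
    -- p - C)W. Invertibility of C - 2 later recovers W from log d_0.
    have h0 : logCl D (d 0) = matAct (C - 2) W := by
      have e1 : ((p : ℚ_[p]) - 1) • xConv C (fun m => avg (k 0) (e m)) 1 =
          fun _ => -(p : PadicAlgCl p) := by
        funext i
        have h := he.avg_one hp hc (k 0) (by rw [hk.finrank_eq, pow_zero])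
        rw [Pi.smul_apply, xConv, Finset.sum_range_one, xVec_zero, one_smul, Nat.sub_zero, ← h,
          Algebra.smul_def, map_sub, map_natCast, map_one]
      have e2 : matAct (2 : Matrix (Fin g) (Fin g) ℤ_[p]) W = (2 : ℚ_[p]) • W := by
        exact_mod_cast matAct_natCast (p := p) (ι := Fin g) 2 W
      have e3 : (fun _ => -(p : PadicAlgCl p)) = -(W + (p : ℚ_[p]) • W - matAct C W) := by
        rw [hW]
        rfl
      rw [hld, smul_add, e1, matAct_sub_left, e2, e3, sub_smul, one_smul, two_smul]
      abel
    refine isTrace_of_logCl hA (hinj 1) fun i => ?_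
    rw [htr, logCl_onPoints _ (hact _ hcommB)]
    -- On log d_0 = (C - 2)W the asserted endomorphism gives C(C - 2)W - (p - 1)W, which is the
    -- value of `htr` at n = 0.
    have e4 : (C - (C - 2)⁻¹ * ((p : Matrix (Fin g) (Fin g) ℤ_[p]) - 1)) * (C - 2) =
        C * (C - 2) - ((p : Matrix (Fin g) (Fin g) ℤ_[p]) - 1) := by
      have h1 : Commute ((p : Matrix (Fin g) (Fin g) ℤ_[p]) - 1) (C - 2) :=
        (Nat.cast_commute p _).sub_left (Commute.one_left _)
      rw [sub_mul, mul_assoc, h1.eq, ← mul_assoc, Matrix.nonsing_inv_mul _ hdet, one_mul]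
    have e5 : ((p : ℚ_[p]) - 1) • matAct C (xConv C (fun m => avg (k 0) (e m)) 1) =
        matAct C (matAct (C - 2) W) - ((p : ℚ_[p]) - 1) • matAct C W := by
      rw [← h0, hld, smul_add, matAct_add_right, matAct_smul_right, matAct_smul_right]
      abel
    have e6 : xConv C (fun m => avg (k 0) (e m)) 0 = 0 := rfl
    rw [h0, ← matAct_mul, e4, e6, sub_zero, smul_add, e5, matAct_sub_left, matAct_mul,
      matAct_sub_left _ 1, matAct_natCast, matAct_one]
    refine congrFun (f := (_ : Fin g → PadicAlgCl p)) ?_ i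
    rw [smul_sub, sub_smul _ _ W, one_smul]
    abel
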